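/- All graphs are finite and simple, and graphs are considered up to isomorphism. For a graph $G$ let $\overline{G}$ be its complement, $A(G)$ its adjacency matrix, and $t(G)$ its number of spanning trees. The join of two graphs is $G\wedge H=\overline{\overline{G}\cup\overline{H}}$ (where $\cup$ is disjoint union), and $G^{(k)}$ is the join of $k$ disjoint copies of $G$. Let $\mathcal{R}_d(n)$ be the class of $d$-regular graphs on $n$ vertices. A graph $G$ with $n$ vertices and $m$ edges is $t$-optimal if $t(G)\ge t(H)$ for every graph $H$ with $n$ vertices and $m$ edges. A graph $G\in\mathcal{R}_d(n)$ is trace-minimal if for every $H\in\mathcal{R}_d(n)$ either $\mathrm{tr}(A(G)^i)=\mathrm{tr}(A(H)^i)$ for all $i\ge 1$, or there is $j\ge 1$ with $\mathrm{tr}(A(G)^i)\le\mathrm{tr}(A(H)^i)$ for $1\le i<j$ and $\mathrm{tr}(A(G)^j)<\mathrm{tr}(A(H)^j)$. Let $H_5=\overline{K_5}$, $H_6=3K_2$, $H_7=C_7$; let $H_8$ be the $8$-cycle together with its four long diagonals; and let $H_9$ be the graph on $\{a,b,c,d,e,f,g,h,i\}$ with edges $ad,ae,af,ag,bd,be,bf,bg,cf,cg,ch,ci,dh,di,eh,ei,fh,gi$.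 For $n\ge 5$ write $n=5q+\rho$ with $\rho\in\{0,1,2,3,4\}$ and put $H_n=H_{5+\rho}\wedge\overline{K_5}^{(q-1)}$. Then, for every $n\ge 5$, $H_n$ is the unique trace-minimal graph in $\mathcal{R}_{n-5}(n)$. Moreover, there is a positive integer $n_0$ such that, for all $n\ge n_0$, $H_n$ is the unique $t$-optimal graph in $\mathcal{R}_{n-5}(n)$. -/

import Mathlib

/-- The number `t(G)` of spanning trees of `G`. -/
noncomputable def spanningTreeCount {V : Type*} (G : SimpleGraph V) : ℕ :=
  Set.ncard {T : SimpleGraph V | T ≤ G ∧ T.IsTree}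

/-- `G` is `t`-optimal: it maximizes the number of spanning trees among all simple graphs
with as many vertices and edges as `G`. -/
def IsTOptimal {V : Type*} (G : SimpleGraph V) : Prop :=
  ∀ H : SimpleGraph V, H.edgeSet.ncard = G.edgeSet.ncard →
    spanningTreeCount H ≤ spanningTreeCount G

open Classical in
/-- `G` belongs to the class `R_d(n)` of `d`-regular graphs on `n` vertices. -/
def InRegularClass (d n : ℕ) {V : Type*} [Fintype V] (G : SimpleGraph V) : Prop :=
  Fintype.card V = n ∧ G.IsRegularOfDegree d

open Classical in
/-- The adjacency sequence `a_i(G) = tr (A(G) ^ i)`. -/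
noncomputable def adjSeq {V : Type*} [Fintype V] (G : SimpleGraph V) (i : ℕ) : ℝ :=
  Matrix.trace (G.adjMatrix ℝ ^ i)

/-- The lexicographic relation `b ≼ c` for real sequences indexed by the positive integers
(the two alternatives exclude each other). -/
def SeqLexLE (b c : ℕ → ℝ) : Prop :=
  (∀ i, 1 ≤ i → b i = c i) ∨
    ∃ j, 1 ≤ j ∧ (∀ i, 1 ≤ i → i < j → b i ≤ c i) ∧ b j < c j

/-- `G` is a trace-minimal graph of the class `R_d(n)`. -/
def IsTraceMinimal (d n : ℕ) {V : Type*} [Fintype V] (G : SimpleGraph V) : Prop :=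
  InRegularClass d n G ∧
    ∀ H : SimpleGraph (Fin n), InRegularClass d n H → SeqLexLE (adjSeq G) (adjSeq H)

/-- The join of two graphs: the complement of the disjoint union of the complements. -/
def graphJoin {V W : Type*} (G : SimpleGraph V) (H : SimpleGraph W) : SimpleGraph (V ⊕ W) :=
  (Gᶜ ⊕g Hᶜ)ᶜ

/-- `G^(k)`, the join of `k` disjoint copies of `G`: the vertex `(i, v)` is the vertex `v` of
the `i`-th copy, and vertices of different copies are adjacent. -/
def joinPower {V : Type*} (G : SimpleGraph V) (k : ℕ) : SimpleGraph (Fin k × V) where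
  Adj x y := x.1 ≠ y.1 ∨ G.Adj x.2 y.2
  symm := ⟨fun _ _ h => h.imp Ne.symm SimpleGraph.Adj.symm⟩
  loopless := ⟨fun _ h => h.elim (fun h => h rfl) (fun h => h.ne rfl)⟩

/-- The graph `3K₂` on six vertices. -/
def threeK2 : SimpleGraph (Fin 6) :=
  SimpleGraph.fromEdgeSet {s(0, 1), s(2, 3), s(4, 5)}

/-- The 8-cycle together with its four long diagonals. -/
def graphH8 : SimpleGraph (Fin 8) :=
  SimpleGraph.fromEdgeSet
    {s(0, 1), s(1, 2), s(2, 3), s(3, 4), s(4, 5), s(5, 6), s(6, 7), s(7, 0),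
     s(0, 4), s(1, 5), s(2, 6), s(3, 7)}

/-- The 4-regular graph on nine vertices, the vertices `a, …, i` being numbered `0, …, 8`. -/
def graphH9 : SimpleGraph (Fin 9) :=
  SimpleGraph.fromEdgeSet
    {s(0, 3), s(0, 4), s(0, 5), s(0, 6), s(1, 3), s(1, 4), s(1, 5), s(1, 6),
     s(2, 5), s(2, 6), s(2, 7), s(2, 8), s(3, 7), s(3, 8), s(4, 7), s(4, 8),
     s(5, 7), s(6, 8)}

/-- The graph `H_{5+ρ}` for `ρ ∈ {0, 1, 2, 3, 4}` (larger `ρ` do not occur). -/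
def baseGraph : (ρ : ℕ) → SimpleGraph (Fin (5 + ρ))
  | 0 => (⊤ : SimpleGraph (Fin 5))ᶜ
  | 1 => threeK2
  | 2 => SimpleGraph.cycleGraph 7
  | 3 => graphH8
  | 4 => graphH9
  | _ => ⊥

/-- The graph `H_n = H_{5+ρ} ∧ (K̄₅)^(q-1)`, where `n = 5q + ρ` and `0 ≤ ρ ≤ 4`
(meaningful for `5 ≤ n`). -/
def graphH (n : ℕ) : SimpleGraph (Fin (5 + n % 5) ⊕ (Fin (n / 5 - 1) × Fin 5)) :=
  graphJoin (baseGraph (n % 5)) (joinPower (⊤ : SimpleGraph (Fin 5))ᶜ (n / 5 - 1))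

/-! The whole proof takes place in the complement. If `G` is `(n-5)`-regular, then `F = Gᶜ` is
4-regular, and the all-ones matrix `J` commutes with the adjacency matrix `A(F)`. Hence tr A(G)³ =
c₃ - tr A(F)³ and tr A(G)⁴ = c₄ + 4 tr A(F)³ + tr A(F)⁴ with constants depending only on `n`. It
therefore suffices that the complement of `graphH n` has the most triangles and, among 4-regular
graphs with equally many, strictly the fewest closed 4-walks.

Triangles are counted by what is missing: a vertex lies in (12 - defect)/2 of them. A vertex of
defect 0 spans a K₅ component, which is split off (`exists_peel`), so one inducts on the number of
blocks. If no defect vanishes, a vertex of defect below 4 has a closed neighborhood K₅ minus an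
edge. The three centers of such a piece have defect at least 2, but its two ends have defect at
least 6, so the total defect is at least 4n - 2u with u ≤ n/5 pieces (`four_mul_le_sum_defect`).
From 10 + ρ vertices on this exceeds the total defect of the candidate, whose K₅ components
contribute nothing. What is left is 5 + ρ vertices, where the complement is ρ-regular and the
extremal graph is found by hand (`base_cases`).

For spanning trees, Kirchhoff's theorem gives n² t(G) = ∏ (n - xᵢ) with xᵢ the Laplacian eigenvalues
of Gᶜ. Expanding the logarithm in powers of 1/n, the product is ruled by the first power sum of the
xᵢ that differs, a larger one making the product smaller. The first is fixed by the number of edges,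
the second is 20n + Σ (deg - 4)² and so favors regular graphs, and the third and fourth reproduce
the trace comparison above (`lapSeq_cases`). These sums are integers, so gaps are at least 1. The
tail is controlled uniformly in `n` because nearly all components of the extremal complement are K₅,
with Laplacian eigenvalues 0 and 5, while x(x-5)²q(x) ≥ 0 bounds the power sums of every competitor
from below (`prod_sub_lt_prod_sub`). -/

open Finset

/-! ### Traces of adjacency powers and passage to the complement. -/

section Traces

open scoped Classical

variable {V W : Type*} [Fintype V] [Fintype W]

theorem InRegularClass.card_filter_adj {d n : ℕ} {G : SimpleGraph V} (h : InRegularClass d n G)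
    (v : V) : (univ.filter fun w => G.Adj v w).card = d := by
  have := h.2 v
  rw [← SimpleGraph.card_neighborFinset_eq_degree, SimpleGraph.neighborFinset_eq_filter] at this
  exact this

theorem inRegularClass_iff {d n : ℕ} {G : SimpleGraph V} :
    InRegularClass d n G ↔
      Fintype.card V = n ∧ ∀ v, (univ.filter fun w => G.Adj v w).card = d := by
  refine ⟨fun h => ⟨h.1, h.card_filter_adj⟩, fun h => ⟨h.1, fun v => ?_⟩⟩
  rw [← SimpleGraph.card_neighborFinset_eq_degree, SimpleGraph.neighborFinset_eq_filter]
  exact h.2 v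

theorem InRegularClass.of_iso {d n : ℕ} {G : SimpleGraph V} {H : SimpleGraph W}
    (h : InRegularClass d n G) (e : G ≃g H) : InRegularClass d n H := by
  rw [inRegularClass_iff] at h ⊢
  refine ⟨by rw [← h.1]; exact (Fintype.card_congr e.toEquiv).symm, fun v => ?_⟩
  rw [← h.2 (e.symm v)]
  refine Finset.card_bij' (fun w _ => e.symm w) (fun w _ => e w) ?_ ?_ ?_ ?_
  · intro a ha
    simp only [mem_filter, mem_univ, true_and] at ha ⊢
    exact e.symm.map_adj_iff.2 ha
  · intro a ha
    simp only [mem_filter, mem_univ, true_and] at ha ⊢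
    have := e.map_adj_iff.2 ha
    simpa using this
  · simp
  · simp

theorem InRegularClass.compl {d n : ℕ} {G : SimpleGraph V} (h : InRegularClass d n G) :
    InRegularClass (n - 1 - d) n Gᶜ := by
  refine ⟨h.1, ?_⟩
  have := h.2.compl
  rw [h.1] at this
  intro v
  convert this v

theorem adjSeq_iso {G : SimpleGraph V} {H : SimpleGraph W} (e : G ≃g H) (i : ℕ) :
    adjSeq G i = adjSeq H i := by
  unfold adjSeq
  have h : H.adjMatrix ℝ = Matrix.reindexAlgEquiv ℝ ℝ e.toEquiv (G.adjMatrix ℝ) := by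
    ext a b
    simp only [Matrix.coe_reindexAlgEquiv, Matrix.reindex_apply, Matrix.submatrix_apply,
      SimpleGraph.adjMatrix_apply]
    have : G.Adj (e.toEquiv.symm a) (e.toEquiv.symm b) ↔ H.Adj a b := e.symm.map_adj_iff
    simp only [this]
  rw [h, ← map_pow, Matrix.coe_reindexAlgEquiv, Matrix.reindex_apply, Matrix.trace,
    Matrix.trace]
  exact (Equiv.sum_comp e.toEquiv.symm fun i_1 => ((G.adjMatrix ℝ) ^ i).diag i_1).symm

theorem adjSeq_sum (G : SimpleGraph V) (H : SimpleGraph W) (i : ℕ) :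
    adjSeq (G ⊕g H) i = adjSeq G i + adjSeq H i := by
  unfold adjSeq
  have h : (G ⊕g H).adjMatrix ℝ
      = Matrix.fromBlocks (G.adjMatrix ℝ) 0 0 (H.adjMatrix ℝ) := by
    ext (a | a) (b | b) <;> simp [SimpleGraph.adjMatrix_apply]
  have h2 := Matrix.fromBlocks_diagonal_pow (G.adjMatrix ℝ) (H.adjMatrix ℝ) i
  rw [h]
  calc _ = (Matrix.fromBlocks (G.adjMatrix ℝ) 0 0 (H.adjMatrix ℝ) ^ i).trace := by
        congr!
    _ = _ := by rw [h2]; simp [Matrix.trace]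

theorem adjSeq_zero (G : SimpleGraph V) : adjSeq G 0 = Fintype.card V := by
  simp [adjSeq]

theorem adjSeq_one (G : SimpleGraph V) : adjSeq G 1 = 0 := by
  simp [adjSeq]

theorem adjMatrix_sq_apply (G : SimpleGraph V) (u v : V) :
    (G.adjMatrix ℝ ^ 2) u v = ((univ.filter fun w => G.Adj u w ∧ G.Adj v w).card : ℝ) := by
  rw [pow_two, Matrix.mul_apply, Finset.card_filter]
  push_cast
  refine sum_congr rfl fun w _ => ?_
  simp only [SimpleGraph.adjMatrix_apply, G.adj_comm w v, ite_and]
  split_ifs <;> simp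

theorem InRegularClass.adjSeq_two {d n : ℕ} {G : SimpleGraph V} (h : InRegularClass d n G) :
    adjSeq G 2 = n * d := by
  unfold adjSeq
  rw [Matrix.trace]
  simp only [Matrix.diag_apply, adjMatrix_sq_apply, and_self, h.card_filter_adj]
  simp [h.1]

theorem adjSeq_three (G : SimpleGraph V) :
    adjSeq G 3 = ∑ v, ((univ.filter fun p : V × V =>
      G.Adj v p.1 ∧ G.Adj v p.2 ∧ G.Adj p.1 p.2).card : ℝ) := by
  unfold adjSeq
  rw [Matrix.trace]
  refine sum_congr rfl fun v _ => ?_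
  rw [Matrix.diag_apply, pow_succ, Matrix.mul_apply, Finset.card_filter, Fintype.sum_prod_type]
  push_cast
  refine sum_congr rfl fun u _ => ?_
  rw [adjMatrix_sq_apply, Finset.card_filter]
  push_cast
  rw [sum_mul]
  refine sum_congr rfl fun w _ => ?_
  simp only [SimpleGraph.adjMatrix_apply, G.adj_comm u v]
  by_cases h1 : G.Adj v u <;> by_cases h2 : G.Adj v w <;> by_cases h3 : G.Adj u w <;>
    simp [h1, h2, h3]

theorem adjSeq_four (G : SimpleGraph V) :
    adjSeq G 4 = ∑ v, ∑ w, ((univ.filter fun u => G.Adj v u ∧ G.Adj w u).card : ℝ) ^ 2 := by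
  unfold adjSeq
  rw [Matrix.trace]
  refine sum_congr rfl fun v _ => ?_
  rw [Matrix.diag_apply, show (4 : ℕ) = 2 + 2 from rfl, pow_add, Matrix.mul_apply]
  refine sum_congr rfl fun u _ => ?_
  rw [adjMatrix_sq_apply, adjMatrix_sq_apply, pow_two]
  simp only [and_comm (a := G.Adj u _)]

/-- For a graph all of whose row sums are `r`, the traces of the powers of the complement are
determined by those of `1 + A`, up to a correction depending only on the parameters. -/
theorem exists_adjSeq_compl (n r i : ℕ) :
    ∃ c : ℝ, ∀ (V : Type) [Fintype V] (F : SimpleGraph V), InRegularClass r n F →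
      adjSeq Fᶜ i = (-1) ^ i * Matrix.trace ((1 + F.adjMatrix ℝ) ^ i) + c := by
  have key : ∀ i : ℕ, ∃ c : ℝ, ∀ (V : Type) [Fintype V] (F : SimpleGraph V),
      InRegularClass r n F → Fᶜ.adjMatrix ℝ ^ i
        = (-1 : ℝ) ^ i • (1 + F.adjMatrix ℝ) ^ i + c • Matrix.of fun _ _ => (1 : ℝ) := by
    intro i
    induction i with
    | zero => exact ⟨0, fun V _ F _ => by simp⟩
    | succ i ih =>
      obtain ⟨c, hc⟩ := ih
      -- With X = 1 + A this is the coefficient of J in ((-1)^i X^i + cJ)(J - X), since X^i J =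
      -- (1+r)^i J, J² = nJ and JX = (1+r)J.
      refine ⟨(-1) ^ i * (1 + r) ^ i + c * n - c * (1 + r), fun V _ F hF => ?_⟩
      set J : Matrix V V ℝ := Matrix.of fun _ _ => (1 : ℝ) with hJ
      have hA : Fᶜ.adjMatrix ℝ = J - (1 + F.adjMatrix ℝ) := by
        ext a b
        by_cases hab : a = b
        · subst hab; simp [J]
        · by_cases h : F.Adj a b <;> simp [J, hab, h]
      have hFJ : F.adjMatrix ℝ * J = (r : ℝ) • J := by
        ext a b
        simp [J, Matrix.mul_apply, SimpleGraph.adjMatrix_apply, ← hF.card_filter_adj a]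
      have hJF : J * F.adjMatrix ℝ = (r : ℝ) • J := by
        ext a b
        simp [J, Matrix.mul_apply, SimpleGraph.adjMatrix_apply, ← hF.card_filter_adj b,
          F.adj_comm]
      have hJJ : J * J = (n : ℝ) • J := by
        ext a b
        simp [J, Matrix.mul_apply, hF.1]
      have hXJ : ∀ k : ℕ, (1 + F.adjMatrix ℝ) ^ k * J = ((1 + r : ℝ) ^ k) • J := by
        intro k
        induction k with
        | zero => simp
        | succ k ih =>
          rw [pow_succ, mul_assoc, add_mul, hFJ, one_mul, ← one_smul ℝ J, smul_smul, ← add_smul,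
            one_smul, mul_one, mul_smul_comm, ih, smul_smul]
          congr 1; ring
      have hJX : J * (1 + F.adjMatrix ℝ) = (1 + r : ℝ) • J := by
        rw [mul_add, mul_one, hJF]; module
      rw [pow_succ, hc V F hF, hA, ← hJ, mul_sub, add_mul, add_mul, smul_mul_assoc,
        smul_mul_assoc, hXJ, hJJ, smul_mul_assoc, smul_mul_assoc, hJX,
        ← pow_succ, pow_succ (-1 : ℝ) i]
      module
  obtain ⟨c, hc⟩ := key i
  refine ⟨c * n, fun V _ F hF => ?_⟩
  unfold adjSeq
  have := hc V F hF
  have h2 : ∀ M : Matrix V V ℝ, M = (-1 : ℝ) ^ i • (1 + F.adjMatrix ℝ) ^ i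
      + c • Matrix.of (fun _ _ => (1 : ℝ)) →
      M.trace = (-1) ^ i * Matrix.trace ((1 + F.adjMatrix ℝ) ^ i) + c * n := by
    rintro M rfl
    rw [Matrix.trace_add, Matrix.trace_smul, Matrix.trace_smul]
    simp [Matrix.trace, hF.1]
  rw [← h2 _ this]
  congr!

theorem trace_one_add_pow (F : SimpleGraph V) (i : ℕ) :
    Matrix.trace ((1 + F.adjMatrix ℝ) ^ i) = ∑ j ∈ range (i + 1), (i.choose j : ℝ) * adjSeq F j := by
  rw [add_comm, (Commute.one_right (F.adjMatrix ℝ)).add_pow, Matrix.trace_sum]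
  refine sum_congr rfl fun j _ => ?_
  rw [one_pow, mul_one, adjSeq, ← nsmul_eq_mul', Matrix.trace_smul, nsmul_eq_mul]

end Traces

/-! ### Closed neighborhoods that are K₅ minus an edge. -/

section AlmostClique

variable {V : Type*}

/-- The closed neighborhood of `v` is `{v, a, b, c, d}` and it induces `K₅` without the
edge `cd`. -/
structure AlmostClique (G : SimpleGraph V) (v a b c d : V) : Prop where
  adj_iff : ∀ y, G.Adj v y ↔ y = a ∨ y = b ∨ y = c ∨ y = d
  ab : G.Adj a b
  ac : G.Adj a c
  ad : G.Adj a d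
  bc : G.Adj b c
  bd : G.Adj b d
  cd_ne : c ≠ d
  cd : ¬ G.Adj c d

namespace AlmostClique

variable {G : SimpleGraph V} {v a b c d : V}

theorem swap (hv : AlmostClique G v a b c d) : AlmostClique G v a b d c :=
  ⟨fun y => by rw [hv.adj_iff]; tauto, hv.ab, hv.ad, hv.ac, hv.bd, hv.bc, hv.cd_ne.symm,
    fun h => hv.cd h.symm⟩

theorem swap' (hv : AlmostClique G v a b c d) : AlmostClique G v b a c d :=
  ⟨fun y => by rw [hv.adj_iff]; tauto, hv.ab.symm, hv.bc, hv.bd, hv.ac, hv.ad, hv.cd_ne, hv.cd⟩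

theorem va (hv : AlmostClique G v a b c d) : G.Adj v a := (hv.adj_iff a).2 (by tauto)
theorem vb (hv : AlmostClique G v a b c d) : G.Adj v b := (hv.adj_iff b).2 (by tauto)
theorem vc (hv : AlmostClique G v a b c d) : G.Adj v c := (hv.adj_iff c).2 (by tauto)
theorem vd (hv : AlmostClique G v a b c d) : G.Adj v d := (hv.adj_iff d).2 (by tauto)

end AlmostClique

end AlmostClique

/-! ### Defects of vertices in 4-regular graphs. -/

section Defect

open scoped Classical

variable {V : Type*} [Fintype V]

/-- The number of ordered pairs of distinct nonadjacent neighbors of a vertex. -/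
noncomputable def defect (G : SimpleGraph V) (v : V) : ℕ :=
  (univ.filter fun p : V × V =>
    (G.Adj v p.1 ∧ G.Adj v p.2) ∧ p.1 ≠ p.2 ∧ ¬ G.Adj p.1 p.2).card

/-- Four neighbors form 4 · 3 = 12 ordered pairs, each either adjacent or counted by the defect. -/
theorem InRegularClass.card_triangles_add_defect {n : ℕ} {G : SimpleGraph V}
    (h : InRegularClass 4 n G) (v : V) :
    (univ.filter fun p : V × V => G.Adj v p.1 ∧ G.Adj v p.2 ∧ G.Adj p.1 p.2).card
      + defect G v = 12 := by
  set N := univ.filter fun w => G.Adj v w with hN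
  have hNc : N.card = 4 := h.card_filter_adj v
  have h12 : N.offDiag.card = 12 := by rw [offDiag_card, hNc]
  rw [← h12, defect, ← card_union_of_disjoint]
  · congr 1
    ext p
    simp only [mem_union, mem_filter, mem_univ, true_and, mem_offDiag, N]
    have : G.Adj p.1 p.2 → p.1 ≠ p.2 := fun h => h.ne
    tauto
  · rw [Finset.disjoint_left]
    intro p hp hp'
    simp only [mem_filter, mem_univ, true_and] at hp hp'
    exact hp'.2.2 hp.2.2

theorem InRegularClass.adjSeq_three_add_sum_defect {n : ℕ} {G : SimpleGraph V}
    (h : InRegularClass 4 n G) :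
    adjSeq G 3 + ((∑ v, defect G v : ℕ) : ℝ) = 12 * n := by
  rw [adjSeq_three]
  push_cast
  rw [← sum_add_distrib]
  have : ∀ v, ((univ.filter fun p : V × V =>
      G.Adj v p.1 ∧ G.Adj v p.2 ∧ G.Adj p.1 p.2).card : ℝ) + (defect G v : ℝ) = 12 := by
    intro v
    exact_mod_cast h.card_triangles_add_defect v
  rw [sum_congr rfl fun v _ => this v]
  simp [h.1, mul_comm]

theorem InRegularClass.adj_iff_of_four {n : ℕ} {G : SimpleGraph V} (h : InRegularClass 4 n G)
    {v a b c d : V} (ha : G.Adj v a) (hb : G.Adj v b) (hc : G.Adj v c) (hd : G.Adj v d)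
    (hab : a ≠ b) (hac : a ≠ c) (had : a ≠ d) (hbc : b ≠ c) (hbd : b ≠ d) (hcd : c ≠ d) (y : V) :
    G.Adj v y ↔ y = a ∨ y = b ∨ y = c ∨ y = d := by
  have hs : ({a, b, c, d} : Finset V) = univ.filter fun w => G.Adj v w := by
    refine Finset.eq_of_subset_of_card_le ?_ ?_
    · intro x hx
      simp only [mem_insert, mem_singleton] at hx
      rcases hx with rfl | rfl | rfl | rfl <;> simpa
    · rw [h.card_filter_adj]
      simp [hab, hac, had, hbc, hbd, hcd]
  have := congrArg (y ∈ ·) hs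
  simpa using this.symm

theorem InRegularClass.exists_adj_notMem {d n : ℕ} {G : SimpleGraph V} (h : InRegularClass d n G)
    (v : V) (s : Finset V) (hs : s.card < d) : ∃ x, G.Adj v x ∧ x ∉ s := by
  obtain ⟨x, hx, hxs⟩ := Finset.exists_mem_notMem_of_card_lt_card
    (s := s) (t := univ.filter fun w => G.Adj v w) (by rwa [h.card_filter_adj])
  exact ⟨x, by simpa using hx, hxs⟩

/-- Nonadjacent pairs come with their reversals, so a second missing edge among the neighbors would
already make the defect 4. -/
theorem InRegularClass.almostClique_of_defect_lt {n : ℕ} {G : SimpleGraph V}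
    (h : InRegularClass 4 n G) {v : V} (hv : defect G v ≠ 0) (hv4 : defect G v < 4) :
    ∃ a b c d, AlmostClique G v a b c d := by
  obtain ⟨⟨c, d⟩, hcd⟩ := Finset.card_pos.1 (Nat.pos_of_ne_zero hv)
  simp only [mem_filter, mem_univ, true_and] at hcd
  obtain ⟨⟨hvc, hvd⟩, hne, hcd⟩ := hcd
  obtain ⟨a, hva, ha⟩ := h.exists_adj_notMem v {c, d} (by rw [card_pair hne]; norm_num)
  obtain ⟨b, hvb, hb⟩ := h.exists_adj_notMem v {a, c, d} (lt_of_le_of_lt card_le_three (by norm_num))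
  simp only [mem_insert, mem_singleton, not_or] at ha hb
  have key : ∀ x y, G.Adj v x → G.Adj v y → x ≠ y → ¬ (x = c ∧ y = d) → ¬ (x = d ∧ y = c) →
      G.Adj x y := by
    intro x y hx hy hxy h1 h2
    by_contra hxy'
    have : ({(x, y), (y, x), (c, d), (d, c)} : Finset (V × V)).card ≤ defect G v := by
      refine Finset.card_le_card ?_
      intro p hp
      simp only [mem_insert, mem_singleton] at hp
      have e1 : ¬ G.Adj y x := fun h => hxy' h.symm
      have e2 : ¬ G.Adj d c := fun h => hcd h.symm
      rcases hp with rfl | rfl | rfl | rfl <;> simp [*, hxy.symm, hne.symm]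
    rw [Finset.card_insert_of_notMem, Finset.card_insert_of_notMem,
      Finset.card_insert_of_notMem, Finset.card_singleton] at this
    · omega
    all_goals simp only [mem_insert, mem_singleton, Prod.mk.injEq, not_or]; grind
  refine ⟨a, b, c, d, h.adj_iff_of_four hva hvb hvc hvd (by grind) (by grind) (by grind) (by grind)
    (by grind) (by grind), ?_, ?_, ?_, ?_, ?_, hne, hcd⟩
  all_goals apply key <;> grind

namespace AlmostClique

variable {G : SimpleGraph V} {n : ℕ} {v a b c d : V}

theorem rotate (h : InRegularClass 4 n G) (hv : AlmostClique G v a b c d) :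
    AlmostClique G a v b c d :=
  ⟨h.adj_iff_of_four hv.va.symm hv.ab hv.ac hv.ad hv.vb.ne hv.vc.ne hv.vd.ne hv.bc.ne hv.bd.ne
    hv.cd_ne, hv.vb, hv.vc, hv.vd, hv.bc, hv.bd, hv.cd_ne, hv.cd⟩

/-- The neighborhood of an end of an almost clique. -/
theorem exists_outer (h : InRegularClass 4 n G) (hv : AlmostClique G v a b c d) :
    ∃ x, (∀ y, G.Adj c y ↔ y = v ∨ y = a ∨ y = b ∨ y = x) ∧ x ≠ v ∧ x ≠ a ∧ x ≠ b ∧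
      ¬ G.Adj v x ∧ ¬ G.Adj a x ∧ ¬ G.Adj b x := by
  obtain ⟨x, hcx, hx⟩ := h.exists_adj_notMem c {v, a, b}
    (lt_of_le_of_lt card_le_three (by norm_num))
  simp only [mem_insert, mem_singleton, not_or] at hx
  have h1 := (hv.rotate h).adj_iff
  have h2 := (hv.swap'.rotate h).adj_iff
  have h3 := hv.adj_iff
  have h4 := hcx.ne
  have h5 := hv.cd
  have h6 : x ≠ d := by rintro rfl; exact h5 hcx
  refine ⟨x, h.adj_iff_of_four hv.vc.symm hv.ac.symm hv.bc.symm hcx hv.va.ne hv.vb.ne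
    (Ne.symm hx.1) hv.ab.ne (Ne.symm hx.2.1) (Ne.symm hx.2.2), hx.1, hx.2.1, hx.2.2, ?_, ?_, ?_⟩
  · rw [h3]; grind
  · rw [h1]; grind
  · rw [h2]; grind

/-- The fourth neighbor of the end `c` is nonadjacent to `v`, `a` and `b`, whereas the neighborhood
of a center misses a single edge. -/
theorem not_almostClique_end (h : InRegularClass 4 n G) (hv : AlmostClique G v a b c d)
    {p q r s : V} (hc : AlmostClique G c p q r s) : False := by
  obtain ⟨x, hx, h1, h2, h3, h4, h5, h6⟩ := hv.exists_outer h
  have hN : ∀ y z, G.Adj c y → G.Adj c z → y ≠ z → ¬ G.Adj y z →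
      (y = r ∧ z = s) ∨ (y = s ∧ z = r) := by
    intro y z hy hz hyz hn
    rw [hc.adj_iff] at hy hz
    have := hc.ab; have := hc.ac; have := hc.ad; have := hc.bc; have := hc.bd
    have := hc.ab.symm; have := hc.ac.symm; have := hc.ad.symm; have := hc.bc.symm
    have := hc.bd.symm
    rcases hy with rfl | rfl | rfl | rfl <;> rcases hz with rfl | rfl | rfl | rfl <;> simp_all
  have e1 := hN v x ((hx _).2 (by tauto)) ((hx _).2 (by tauto)) (Ne.symm h1) h4
  have e2 := hN a x ((hx _).2 (by tauto)) ((hx _).2 (by tauto)) (Ne.symm h2) h5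
  have := hv.va.ne
  grind

theorem six_le_defect_end (h : InRegularClass 4 n G) (hv : AlmostClique G v a b c d) :
    6 ≤ defect G c := by
  obtain ⟨x, hx, h1, h2, h3, h4, h5, h6⟩ := hv.exists_outer h
  have hcard : ({(v, x), (a, x), (b, x), (x, v), (x, a), (x, b)} : Finset (V × V)).card
      ≤ defect G c := by
    refine Finset.card_le_card ?_
    intro p hp
    simp only [mem_insert, mem_singleton] at hp
    have e1 : ¬ G.Adj x v := fun h => h4 h.symm
    have e2 : ¬ G.Adj x a := fun h => h5 h.symm
    have e3 : ¬ G.Adj x b := fun h => h6 h.symm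
    rcases hp with rfl | rfl | rfl | rfl | rfl | rfl <;> simp [*, h1.symm, h2.symm, h3.symm]
  have := hv.va.ne; have := hv.vb.ne; have := hv.ab.ne
  rw [Finset.card_insert_of_notMem, Finset.card_insert_of_notMem,
    Finset.card_insert_of_notMem, Finset.card_insert_of_notMem, Finset.card_insert_of_notMem,
    Finset.card_singleton] at hcard
  · omega
  all_goals simp only [mem_insert, mem_singleton, Prod.mk.injEq, not_or]; grind

/-- The outer neighbor of an end of an almost clique is not a center of an almost clique. -/
theorem not_almostClique_outer (h : InRegularClass 4 n G) (hv : AlmostClique G v a b c d)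
    {x : V} (hcx : G.Adj c x) (h1 : x ≠ v) (h2 : x ≠ a) (h3 : x ≠ b) {p q r s : V}
    (hx : AlmostClique G x p q r s) : False := by
  obtain ⟨x', hx', g1, g2, g3, g4, g5, g6⟩ := hv.exists_outer h
  have : x = x' := by have := (hx' x).1 hcx; tauto
  subst this
  -- Since `p` and `q` would be centers as well, the end `c` is neither, so it is an end of the
  -- second piece and adjacent to `p`. Then `p` is a common neighbor of `c` and `x`, but `x` is
  -- adjacent to no neighbor of `c`.
  have hp : c ≠ p := by
    rintro rfl
    exact hv.not_almostClique_end h (hx.rotate h)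
  have hq : c ≠ q := by
    rintro rfl
    exact hv.not_almostClique_end h (hx.swap'.rotate h)
  have hc := (hx.adj_iff c).1 hcx.symm
  have hcp : G.Adj c p := by
    rcases hc with rfl | rfl | rfl | rfl
    exacts [absurd rfl hp, absurd rfl hq, hx.ac.symm, hx.ad.symm]
  rcases (hx' p).1 hcp with rfl | rfl | rfl | rfl
  exacts [g4 hx.va.symm, g5 hx.va.symm, g6 hx.va.symm, hx.va.ne rfl]

end AlmostClique

/-- The centers of almost cliques. -/
noncomputable def almostCenters (G : SimpleGraph V) : Finset V :=
  univ.filter fun v => ∃ a b c d, AlmostClique G v a b c d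

/-- The ends of almost cliques. -/
noncomputable def almostEnds (G : SimpleGraph V) : Finset V :=
  univ.filter fun c => ∃ v a b d, AlmostClique G v a b c d

/-- Double counting of the edges between centers and ends: a center sees exactly the two ends of its
piece, and an end sees exactly three centers, because its outer neighbor is not one. -/
theorem InRegularClass.two_mul_card_almostCenters {n : ℕ} {G : SimpleGraph V}
    (h : InRegularClass 4 n G) : 2 * (almostCenters G).card = 3 * (almostEnds G).card := by
  have key := Finset.sum_card_bipartiteAbove_eq_sum_card_bipartiteBelow
    (s := almostCenters G) (t := almostEnds G) (fun v c => G.Adj v c)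
  have h1 : ∀ v ∈ almostCenters G,
      (bipartiteAbove (fun v c => G.Adj v c) (almostEnds G) v).card = 2 := by
    intro v hv
    simp only [almostCenters, mem_filter, mem_univ, true_and] at hv
    obtain ⟨a, b, c, d, hv⟩ := hv
    rw [← card_pair hv.cd_ne]
    congr 1
    ext y
    simp only [bipartiteAbove, almostEnds, mem_filter, mem_univ, true_and, mem_insert,
      mem_singleton]
    constructor
    · rintro ⟨⟨v', a', b', d', hy⟩, hvy⟩
      rw [hv.adj_iff] at hvy
      rcases hvy with rfl | rfl | rfl | rfl
      · exact (hy.not_almostClique_end h (hv.rotate h)).elim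
      · exact (hy.not_almostClique_end h (hv.swap'.rotate h)).elim
      · exact .inl rfl
      · exact .inr rfl
    · rintro (rfl | rfl)
      · exact ⟨⟨_, _, _, _, hv⟩, hv.vc⟩
      · exact ⟨⟨_, _, _, _, hv.swap⟩, hv.vd⟩
  have h2 : ∀ c ∈ almostEnds G,
      (bipartiteBelow (fun v c => G.Adj v c) (almostCenters G) c).card = 3 := by
    intro c hc
    simp only [almostEnds, mem_filter, mem_univ, true_and] at hc
    obtain ⟨v, a, b, d, hv⟩ := hc
    have : ({v, a, b} : Finset V).card = 3 := card_eq_three.2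
      ⟨v, a, b, hv.va.ne, hv.vb.ne, hv.ab.ne, rfl⟩
    rw [← this]
    congr 1
    ext y
    simp only [bipartiteBelow, almostCenters, mem_filter, mem_univ, true_and, mem_insert,
      mem_singleton]
    constructor
    · rintro ⟨⟨p, q, r, s, hy⟩, hyc⟩
      by_contra hcon
      simp only [not_or] at hcon
      exact hv.not_almostClique_outer h hyc.symm hcon.1 hcon.2.1 hcon.2.2 hy
    · rintro (rfl | rfl | rfl)
      · exact ⟨⟨_, _, _, _, hv⟩, hv.vc⟩
      · exact ⟨⟨_, _, _, _, hv.rotate h⟩, hv.ac⟩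
      · exact ⟨⟨_, _, _, _, hv.swap'.rotate h⟩, hv.bc⟩
  rw [sum_congr rfl h1, sum_congr rfl h2, sum_const, sum_const, smul_eq_mul, smul_eq_mul] at key
  omega

theorem InRegularClass.disjoint_almostCenters_almostEnds {n : ℕ} {G : SimpleGraph V}
    (h : InRegularClass 4 n G) : Disjoint (almostCenters G) (almostEnds G) := by
  rw [Finset.disjoint_left]
  intro v hv hv'
  simp only [almostCenters, almostEnds, mem_filter, mem_univ, true_and] at hv hv'
  obtain ⟨_, _, _, _, hv⟩ := hv
  obtain ⟨_, _, _, _, hv'⟩ := hv'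
  exact hv'.not_almostClique_end h hv

/-- A vertex adjacent to an end of an almost clique without belonging to it has
large defect. -/
theorem InRegularClass.six_le_defect_of_adj_end {n : ℕ} {G : SimpleGraph V}
    (h : InRegularClass 4 n G) {r c : V} (hc : c ∈ almostEnds G) (hr : r ∉ almostCenters G)
    (hrc : G.Adj r c) : 6 ≤ defect G r := by
  simp only [almostEnds, almostCenters, mem_filter, mem_univ, true_and] at hc hr
  obtain ⟨v, a, b, d, hv⟩ := hc
  obtain ⟨x, hx, h1, h2, h3, h4, h5, h6⟩ := hv.exists_outer h
  have hrx : r = x := by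
    rcases (hx r).1 hrc.symm with rfl | rfl | rfl | rfl
    · exact (hr ⟨_, _, _, _, hv⟩).elim
    · exact (hr ⟨_, _, _, _, hv.rotate h⟩).elim
    · exact (hr ⟨_, _, _, _, hv.swap'.rotate h⟩).elim
    · rfl
  subst hrx
  obtain ⟨p, hp, hp'⟩ := h.exists_adj_notMem r {c} (by simp)
  obtain ⟨q, hq, hq'⟩ := h.exists_adj_notMem r {c, p}
    (lt_of_le_of_lt card_le_two (by norm_num))
  obtain ⟨s, hs, hs'⟩ := h.exists_adj_notMem r {c, p, q}
    (lt_of_le_of_lt card_le_three (by norm_num))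
  simp only [mem_insert, mem_singleton, not_or] at hp' hq' hs'
  have hn : ∀ y, G.Adj r y → ¬ G.Adj c y := by
    intro y hy hcy
    rcases (hx y).1 hcy with rfl | rfl | rfl | rfl
    exacts [h4 hy.symm, h5 hy.symm, h6 hy.symm, hy.ne rfl]
  have hn' : ∀ y, G.Adj r y → ¬ G.Adj y c := fun y hy h => hn y hy h.symm
  have : ({(c, p), (c, q), (c, s), (p, c), (q, c), (s, c)} : Finset (V × V)).card
      ≤ defect G r := by
    refine Finset.card_le_card ?_
    intro y hy
    simp only [mem_insert, mem_singleton] at hy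
    rcases hy with rfl | rfl | rfl | rfl | rfl | rfl <;>
      simp only [mem_filter, mem_univ, true_and] <;> grind
  rw [Finset.card_insert_of_notMem, Finset.card_insert_of_notMem,
    Finset.card_insert_of_notMem, Finset.card_insert_of_notMem, Finset.card_insert_of_notMem,
    Finset.card_singleton] at this
  · omega
  all_goals simp only [mem_insert, mem_singleton, Prod.mk.injEq, not_or]; grind

end Defect

/-! ### Lower bound for the total defect. -/

section Counting

open scoped Classical

variable {V : Type*} [Fintype V]

/-- Here `u` counts the almost cliques. Each has three centers of defect at least 2 and two ends of
defect at least 6, hence 18 in place of 4 · 5 = 20; all other vertices have defect at least 4. The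
last clause gains strictness for `n = 13`, `u = 2`, where 4n - 2u = 48 only ties with the candidate.
-/
theorem InRegularClass.four_mul_le_sum_defect {n : ℕ} {G : SimpleGraph V}
    (h : InRegularClass 4 n G) (h0 : ∀ v, defect G v ≠ 0) :
    ∃ u, (almostCenters G).card = 3 * u ∧ (almostEnds G).card = 2 * u ∧ 5 * u ≤ n ∧
      4 * n ≤ ∑ v, defect G v + 2 * u ∧
      (n = 13 → 4 * n < ∑ v, defect G v + 2 * u + if u = 2 then 0 else 1) := by
  set T := almostCenters G with hT
  set Y := almostEnds G with hY
  have hdisj : Disjoint T Y := h.disjoint_almostCenters_almostEnds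
  have h23 : 2 * T.card = 3 * Y.card := h.two_mul_card_almostCenters
  have hle : T.card + Y.card ≤ n := by
    rw [← card_union_of_disjoint hdisj, ← h.1]
    exact card_le_univ _
  set f : V → ℕ := fun v => if v ∈ T then 2 else if v ∈ Y then 6 else 4 with hf
  have hsum : ∑ v, f v + 2 * T.card = 4 * n + 2 * Y.card := by
    have e1 : ∑ v : V, (if v ∈ T then 2 else 0) = 2 * T.card := by
      rw [sum_ite_mem, univ_inter, sum_const, smul_eq_mul, mul_comm]
    have e2 : ∑ v : V, (if v ∈ Y then 2 else 0) = 2 * Y.card := by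
      rw [sum_ite_mem, univ_inter, sum_const, smul_eq_mul, mul_comm]
    have e3 : ∑ _v : V, 4 = 4 * n := by
      rw [sum_const, card_univ, h.1, smul_eq_mul, mul_comm]
    rw [← e1, ← e2, ← e3, ← sum_add_distrib, ← sum_add_distrib]
    refine sum_congr rfl fun v _ => ?_
    have hTY : v ∈ T → v ∉ Y := fun hv => Finset.disjoint_left.1 hdisj hv
    simp only [hf]
    split_ifs <;> first | rfl | tauto
  have hfle : ∀ v ∈ univ, f v ≤ defect G v := by
    intro v _
    simp only [hf]
    split_ifs with h1 h2
    · by_contra hlt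
      obtain ⟨p, hp⟩ := Finset.card_pos.1 (Nat.pos_of_ne_zero (h0 v))
      have : ({p, (p.2, p.1)} : Finset (V × V)).card ≤ defect G v := by
        refine Finset.card_le_card ?_
        intro q hq
        simp only [mem_insert, mem_singleton] at hq
        rcases hq with rfl | rfl
        · exact hp
        · simp only [mem_filter, mem_univ, true_and] at hp ⊢
          exact ⟨hp.1.symm, hp.2.1.symm, fun h => hp.2.2 h.symm⟩
      rw [card_pair] at this
      · omega
      · rintro heq
        simp only [mem_filter, mem_univ, true_and] at hp
        exact hp.2.1 (congrArg Prod.fst heq)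
    · simp only [hY, almostEnds, mem_filter, mem_univ, true_and] at h2
      obtain ⟨v, a, b, d, hv⟩ := h2
      exact hv.six_le_defect_end h
    · by_contra hlt
      refine h1 ?_
      simp only [hT, almostCenters, mem_filter, mem_univ, true_and]
      exact h.almostClique_of_defect_lt (h0 v) (by omega)
  have hmain := sum_le_sum hfle
  refine ⟨Y.card / 2, by omega, by omega, by omega, by omega, fun hn => ?_⟩
  split_ifs with hu
  -- Two almost cliques leave three vertices, too few to hold four neighbors of one of them. The
  -- neighbors of a center lie in its own piece, so the edge leaving the three vertices must reach
  -- an end.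
  · have : ∃ r, r ∉ T ∧ r ∉ Y ∧ ∃ c ∈ Y, G.Adj r c := by
      by_contra hcon
      push Not at hcon
      have hR : (univ \ (T ∪ Y)).card = 3 := by
        rw [card_sdiff_of_subset (subset_univ _), card_union_of_disjoint hdisj, card_univ, h.1]
        omega
      obtain ⟨r, hr⟩ := Finset.card_pos.1 (by rw [hR]; norm_num : 0 < (univ \ (T ∪ Y)).card)
      simp only [mem_sdiff, mem_univ, true_and, mem_union, not_or] at hr
      have hsub : (univ.filter fun w => G.Adj r w) ⊆ univ \ (T ∪ Y) := by
        intro w hw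
        simp only [mem_filter, mem_sdiff, mem_univ, true_and, mem_union, not_or] at hw ⊢
        refine ⟨fun hwT => ?_, fun hwY => hcon r hr.1 hr.2 w hwY hw⟩
        have hwT' := hwT
        simp only [hT, almostCenters, mem_filter, mem_univ, true_and] at hwT
        obtain ⟨a, b, c, d, hwc⟩ := hwT
        simp only [hT, hY, almostCenters, almostEnds, mem_filter, mem_univ, true_and] at hr
        rcases (hwc.adj_iff r).1 hw.symm with rfl | rfl | rfl | rfl
        · exact hr.1 ⟨_, _, _, _, hwc.rotate h⟩
        · exact hr.1 ⟨_, _, _, _, hwc.swap'.rotate h⟩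
        · exact hr.2 ⟨_, _, _, _, hwc⟩
        · exact hr.2 ⟨_, _, _, _, hwc.swap⟩
      have := card_le_card hsub
      rw [hR, h.card_filter_adj] at this
      omega
    obtain ⟨r, hrT, hrY, c, hc, hrc⟩ := this
    have h6 := h.six_le_defect_of_adj_end hc hrT hrc
    have : ∑ v, f v < ∑ v, defect G v := sum_lt_sum hfle ⟨r, mem_univ _, by
      simp only [hf, if_neg hrT, if_neg hrY]; omega⟩
    omega
  · omega

/-- The total defect of the complement of the base graph on `5 + ρ` vertices. -/
def baseDefect : ℕ → ℕ
  | 0 => 0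
  | 1 => 24
  | 2 => 42
  | _ => 48

/-- The bound 4n - 2u with n ≥ 10 + ρ and 5u ≤ n suffices except for `ρ = 3`, `k = 0`, which needs
the refinement at 13 vertices. -/
theorem InRegularClass.baseDefect_lt_sum_defect {ρ k : ℕ} {G : SimpleGraph V} (hρ : ρ < 5)
    (h : InRegularClass 4 (5 + ρ + 5 * (k + 1)) G) (h0 : ∀ v, defect G v ≠ 0) :
    baseDefect ρ < ∑ v, defect G v := by
  obtain ⟨u, -, -, h1, h2, h3⟩ := h.four_mul_le_sum_defect h0
  interval_cases ρ <;> simp only [baseDefect] <;> try omega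
  by_cases hk : k = 0
  · subst hk
    have := h3 (by norm_num)
    split_ifs at this <;> omega
  · omega

end Counting

/-! ### Splitting off K₅ components. -/

section Peeling

open scoped Classical

/-- The disjoint union of `k` copies of `K₅`. -/
abbrev cliqueCopies (k : ℕ) : SimpleGraph (Fin k × Fin 5) :=
  (joinPower (⊤ : SimpleGraph (Fin 5))ᶜ k)ᶜ

theorem cliqueCopies_adj {k : ℕ} {x y : Fin k × Fin 5} :
    (cliqueCopies k).Adj x y ↔ x ≠ y ∧ x.1 = y.1 := by
  simp only [SimpleGraph.compl_adj, joinPower, SimpleGraph.top_adj]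
  have : x ≠ y ↔ x.1 ≠ y.1 ∨ x.2 ≠ y.2 := by rw [Ne, Prod.ext_iff]; tauto
  tauto

/-- Splitting off the last copy. -/
def cliqueCopiesSucc (k : ℕ) :
    cliqueCopies k ⊕g (⊤ : SimpleGraph (Fin 5)) ≃g cliqueCopies (k + 1) where
  toEquiv := (Equiv.sumCongr (Equiv.refl _) (Equiv.uniqueProd (Fin 5) (Fin 1)).symm).trans
    ((Equiv.sumProdDistrib (Fin k) (Fin 1) (Fin 5)).symm.trans
      (Equiv.prodCongr finSumFinEquiv (Equiv.refl _)))
  map_rel_iff' := by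
    rintro (⟨a, a'⟩ | a) (⟨b, b'⟩ | b)
    · rw [cliqueCopies_adj]
      simp [cliqueCopies_adj, -SimpleGraph.compl_adj]
    · rw [cliqueCopies_adj]
      simp [Fin.ext_iff, a.2.ne]
    · rw [cliqueCopies_adj]
      simp [Fin.ext_iff, b.2.ne']
    · rw [cliqueCopies_adj]
      simp

/-- Defect 0 makes the closed neighborhood a K₅. Its vertices have used up their degree 4, so no
edge leaves it. -/
theorem InRegularClass.exists_peel {V : Type*} [Fintype V] {n : ℕ} {G : SimpleGraph V} (h : InRegularClass 4 (n + 5) G)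
    {v : V} (hv : defect G v = 0) :
    ∃ (W : Set V) (_ : Fintype W) (F : SimpleGraph W), InRegularClass 4 n F ∧
      Nonempty (F ⊕g (⊤ : SimpleGraph (Fin 5)) ≃g G) := by
  have hcl : ∀ a b, G.Adj v a → G.Adj v b → a ≠ b → G.Adj a b := by
    intro a b ha hb hab
    by_contra hn
    rw [defect, card_eq_zero] at hv
    have : ((a, b) : V × V) ∈ (∅ : Finset (V × V)) := by
      rw [← hv]; simp [ha, hb, hab, hn]
    simp at this
  set q : V → Prop := fun x => x = v ∨ G.Adj v x with hq
  have hqq : ∀ a b, q a → q b → a ≠ b → G.Adj a b := by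
    rintro a b (rfl | ha) (rfl | hb) hab
    exacts [absurd rfl hab, hb, ha.symm, hcl a b ha hb hab]
  have hqc : (univ.filter q).card = 5 := by
    have : univ.filter q = insert v (univ.filter fun w => G.Adj v w) := by
      ext x; simp [hq]
    rw [this, card_insert_of_notMem (by simp), h.card_filter_adj]
  have hq5 : ∀ a, q a → ∀ b, G.Adj a b → q b := by
    intro a ha
    have hs : (univ.filter q).erase a = univ.filter fun w => G.Adj a w := by
      refine Finset.eq_of_subset_of_card_le ?_ ?_
      · intro x hx
        simp only [mem_erase, mem_filter, mem_univ, true_and] at hx ⊢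
        exact hqq a x ha hx.2 hx.1.symm
      · rw [h.card_filter_adj, card_erase_of_mem (by simpa using ha), hqc]
    intro b hb
    have : b ∈ (univ.filter q).erase a := by rw [hs]; simpa using hb
    simpa using (mem_erase.1 this).2
  have hcq : Fintype.card {x // q x} = 5 := by rw [Fintype.card_subtype, hqc]
  refine ⟨{x | ¬ q x}, (inferInstance : Fintype {x // ¬ q x}), G.comap Subtype.val, ?_, ?_⟩
  · rw [inRegularClass_iff]
    refine ⟨?_, fun x => ?_⟩
    · refine (Fintype.card_subtype_compl q).trans ?_
      rw [hcq, h.1]; omega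
    · rw [← h.card_filter_adj x.1]
      refine Finset.card_bij (fun y _ => y.1) ?_ ?_ ?_
      · intro y hy; simpa using hy
      · intro y _ z _ hyz; exact Subtype.ext hyz
      · intro y hy
        simp only [mem_filter, mem_univ, true_and] at hy
        exact ⟨⟨y, fun hqy => x.2 (hq5 y hqy _ hy.symm)⟩, by simpa using hy, rfl⟩
  · have e := (Fintype.equivFinOfCardEq hcq).symm
    refine ⟨⟨(Equiv.sumComm _ _).trans ((Equiv.sumCongr e (Equiv.refl _)).trans
      (Equiv.sumCompl q)), ?_⟩⟩
    rintro (a | a) (b | b)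
    · exact Iff.rfl
    · exact iff_of_false (fun hab => a.2 (hq5 _ (e b).2 _ hab.symm)) (by simp)
    · exact iff_of_false (fun hab => b.2 (hq5 _ (e a).2 _ hab)) (by simp)
    · simp only [Equiv.trans_apply, Equiv.sumComm_apply, Sum.swap_inr, Equiv.sumCongr_apply,
        Sum.map_inl, SimpleGraph.sum_adj, SimpleGraph.top_adj]
      refine ⟨fun h => by rintro rfl; exact h.ne rfl, fun h => hqq _ _ (e a).2 (e b).2 ?_⟩
      intro hab
      exact h (e.injective (Subtype.ext hab))

end Peeling

/-! ### Tools for recognizing small regular graphs. -/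

section SmallRegular

open scoped Classical

variable {V : Type*} [Fintype V]

theorem InRegularClass.adj_iff_mem {d n : ℕ} {G : SimpleGraph V} (h : InRegularClass d n G)
    {v : V} {s : Finset V} (hs : ∀ x ∈ s, G.Adj v x) (hd : s.card = d) (y : V) :
    G.Adj v y ↔ y ∈ s := by
  have hs : s = univ.filter fun w => G.Adj v w := by
    refine Finset.eq_of_subset_of_card_le ?_ ?_
    · intro x hx
      simpa using hs x hx
    · rw [h.card_filter_adj, hd]
  rw [hs]; simp

/-- An injective homomorphism between regular graphs with the same parameters is an
isomorphism. -/
theorem InRegularClass.nonempty_iso {W : Type*} [Fintype W] {d n : ℕ} {G : SimpleGraph V}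
    {H : SimpleGraph W} (hG : InRegularClass d n G) (hH : InRegularClass d n H) (f : W → V)
    (hf : Function.Injective f) (hadj : ∀ i j, H.Adj i j → G.Adj (f i) (f j)) :
    Nonempty (G ≃g H) := by
  have hb : Function.Bijective f :=
    (Fintype.bijective_iff_injective_and_card f).2 ⟨hf, hH.1.trans hG.1.symm⟩
  refine ⟨SimpleGraph.Iso.symm ⟨Equiv.ofBijective f hb, ?_⟩⟩
  intro i j
  refine ⟨fun h => ?_, hadj i j⟩
  have := (hG.adj_iff_mem (v := f i) (s := (univ.filter fun w => H.Adj i w).image f)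
    (by simpa using fun w => hadj i w)
    (by rw [card_image_of_injective _ hf, hH.card_filter_adj]) (f j)).1 h
  simpa [hf.eq_iff] using this

theorem adjSeq_three_eq_zero {G : SimpleGraph V}
    (h : ∀ a b c, G.Adj a b → G.Adj a c → ¬ G.Adj b c) : adjSeq G 3 = 0 := by
  rw [adjSeq_three]
  refine sum_eq_zero fun v _ => ?_
  rw [Nat.cast_eq_zero, card_eq_zero, filter_eq_empty_iff]
  rintro ⟨a, b⟩ _ ⟨h1, h2, h3⟩
  exact h v a b h1 h2 h3

theorem adjSeq_three_pos {G : SimpleGraph V} {a b c : V} (h1 : G.Adj a b) (h2 : G.Adj a c)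
    (h3 : G.Adj b c) : 0 < adjSeq G 3 := by
  rw [adjSeq_three]
  refine sum_pos' (fun v _ => Nat.cast_nonneg _) ⟨a, mem_univ _, ?_⟩
  rw [Nat.cast_pos, card_pos]
  exact ⟨(b, c), by simp [*]⟩

theorem not_adj_of_adjSeq_three_nonpos {G : SimpleGraph V} (h : adjSeq G 3 ≤ 0) (a b c : V)
    (h1 : G.Adj a b) (h2 : G.Adj a c) : ¬ G.Adj b c :=
  fun h3 => h.not_gt (adjSeq_three_pos h1 h2 h3)

end SmallRegular

/-! ### Degrees and traces of the base graphs. -/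

section BaseGraphs

instance : DecidableRel threeK2.Adj :=
  fun a b => by unfold threeK2; rw [SimpleGraph.fromEdgeSet_adj]; infer_instance

instance : DecidableRel graphH8.Adj :=
  fun a b => by unfold graphH8; rw [SimpleGraph.fromEdgeSet_adj]; infer_instance

instance : DecidableRel graphH9.Adj :=
  fun a b => by unfold graphH9; rw [SimpleGraph.fromEdgeSet_adj]; infer_instance

theorem inRegularClass_of_decide {d n : ℕ} {G : SimpleGraph (Fin n)} [DecidableRel G.Adj]
    (h : ∀ v, (univ.filter fun w => G.Adj v w).card = d) : InRegularClass d n G := by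
  rw [inRegularClass_iff]
  refine ⟨Fintype.card_fin n, fun v => ?_⟩
  rw [← h v]
  congr!

theorem inRegularClass_threeK2 : InRegularClass 1 6 threeK2 :=
  inRegularClass_of_decide (by decide)

theorem inRegularClass_cycleGraph : InRegularClass 2 7 (SimpleGraph.cycleGraph 7) :=
  inRegularClass_of_decide (by decide)

theorem inRegularClass_graphH8 : InRegularClass 3 8 graphH8 :=
  inRegularClass_of_decide (by decide)

theorem inRegularClass_graphH9 : InRegularClass 4 9 graphH9 :=
  inRegularClass_of_decide (by decide)

theorem adjSeq_cycleGraph : adjSeq (SimpleGraph.cycleGraph 7) 3 = 0 :=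
  adjSeq_three_eq_zero (by decide)

theorem adjSeq_graphH8 : adjSeq graphH8 3 = 0 := adjSeq_three_eq_zero (by decide)

theorem adjSeq_graphH8_four : adjSeq graphH8 4 = 152 := by
  have : ∑ v, ∑ w, (univ.filter fun u => graphH8.Adj v u ∧ graphH8.Adj w u).card ^ 2 = 152 := by
    decide +kernel
  rw [adjSeq_four]
  calc _ = ((∑ v, ∑ w,
      (univ.filter fun u => graphH8.Adj v u ∧ graphH8.Adj w u).card ^ 2 : ℕ) : ℝ) := by
        push_cast; congr!
    _ = 152 := by rw [this]; norm_num

theorem adjSeq_three_of_decide {n c : ℕ} {G : SimpleGraph (Fin n)} [DecidableRel G.Adj]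
    (h : ∑ v, (univ.filter fun p : Fin n × Fin n =>
      G.Adj v p.1 ∧ G.Adj v p.2 ∧ G.Adj p.1 p.2).card = c) : adjSeq G 3 = c := by
  rw [adjSeq_three, ← h]
  push_cast
  congr!

theorem adjSeq_graphH9 : adjSeq graphH9 3 = 12 := by
  have := adjSeq_three_of_decide (G := graphH9) (c := 12) (by decide +kernel)
  exact_mod_cast this

end BaseGraphs

/-! ### Uniqueness on six and seven vertices. -/

section Classification

open scoped Classical

variable {V : Type*} [Fintype V]

theorem InRegularClass.exists_notMem {d n : ℕ} {G : SimpleGraph V} (h : InRegularClass d n G)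
    (s : Finset V) (hs : s.card < n) : ∃ x, x ∉ s := by
  by_contra! hcon
  have : s = univ := eq_univ_of_forall hcon
  rw [this, card_univ, h.1] at hs
  omega

theorem InRegularClass.mem_of_nodup {d n : ℕ} {G : SimpleGraph V} (h : InRegularClass d n G)
    {l : List V} (hl : l.Nodup) (hn : l.length = n) (y : V) : y ∈ l := by
  have : l.toFinset = univ := by
    rw [← card_eq_iff_eq_univ, List.toFinset_card_of_nodup hl, h.1, hn]
  have hy := mem_univ y
  rwa [← this, List.mem_toFinset] at hy

theorem InRegularClass.nonempty_iso_threeK2 {G : SimpleGraph V} (h : InRegularClass 1 6 G) :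
    Nonempty (G ≃g threeK2) := by
  have hp : ∀ v, ∃ w, G.Adj v w ∧ ∀ y, G.Adj v y → y = w := by
    intro v
    obtain ⟨w, hw, -⟩ := h.exists_adj_notMem v ∅ (by simp)
    exact ⟨w, hw, fun y hy => by simpa using (h.adj_iff_mem (v := v) (s := {w}) (by simpa) (by simp) y).1 hy⟩
  obtain ⟨a, -⟩ := h.exists_notMem ∅ (by simp)
  obtain ⟨b, hab, hb⟩ := hp a
  obtain ⟨c, hc⟩ := h.exists_notMem {a, b} (lt_of_le_of_lt card_le_two (by norm_num))
  obtain ⟨d, hcd, hd⟩ := hp c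
  obtain ⟨e, he⟩ := h.exists_notMem {a, b, c, d} (lt_of_le_of_lt card_le_four (by norm_num))
  obtain ⟨f, hef, hf⟩ := hp e
  obtain ⟨a', _, ha⟩ := hp b
  obtain ⟨c', _, hc'⟩ := hp d
  have e1 := ha a hab.symm
  have e2 := hc' c hcd.symm
  subst e1 e2
  simp only [mem_insert, mem_singleton, not_or] at hc he
  have h1 := hab.ne; have h2 := hcd.ne; have h3 := hef.ne
  have hda : d ≠ a := by rintro rfl; exact hc.2 (hb c hcd.symm)
  have hdb : d ≠ b := by rintro rfl; exact hc.1 (ha c hcd.symm)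
  have hfa : f ≠ a := by rintro rfl; exact he.2.1 (hb e hef.symm)
  have hfb : f ≠ b := by rintro rfl; exact he.1 (ha e hef.symm)
  have hfc : f ≠ c := by rintro rfl; exact he.2.2.2 (hd e hef.symm)
  have hfd : f ≠ d := by rintro rfl; exact he.2.2.1 (hc' e hef.symm)
  refine h.nonempty_iso inRegularClass_threeK2 ![a, b, c, d, e, f] ?_ ?_
  · rw [← List.nodup_ofFn]
    simp
    grind
  · have := hab.symm; have := hcd.symm; have := hef.symm
    intro i j hij
    fin_cases i <;> fin_cases j <;> first | assumption | exact absurd hij (by decide)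

theorem InRegularClass.exists_adj_iff_of_two {n : ℕ} {G : SimpleGraph V}
    (h : InRegularClass 2 n G) {v u : V} (hu : G.Adj v u) :
    ∃ w, w ≠ u ∧ ∀ y, G.Adj v y ↔ y = u ∨ y = w := by
  obtain ⟨w, hw, hwu⟩ := h.exists_adj_notMem v {u} (by simp)
  simp only [mem_singleton] at hwu
  refine ⟨w, hwu, fun y => ?_⟩
  simpa using h.adj_iff_mem (v := v) (s := {u, w}) (by simp [hu, hw]) (card_pair (Ne.symm hwu)) y

/-- The graph is a union of cycles, and 7 is not a sum of two or more integers that are at least 4.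
The proof walks from `a0` in both directions and excludes each early closure. -/
theorem InRegularClass.nonempty_iso_cycleGraph {G : SimpleGraph V} (h : InRegularClass 2 7 G)
    (ht : ∀ a b c, G.Adj a b → G.Adj a c → ¬ G.Adj b c) :
    Nonempty (G ≃g SimpleGraph.cycleGraph 7) := by
  obtain ⟨a0, -⟩ := h.exists_notMem ∅ (by simp)
  obtain ⟨a1, h01, -⟩ := h.exists_adj_notMem a0 ∅ (by simp)
  obtain ⟨a6, h61, h0⟩ := h.exists_adj_iff_of_two h01
  have h06 : G.Adj a0 a6 := (h0 _).2 (.inr rfl)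
  obtain ⟨a2, h20, h1⟩ := h.exists_adj_iff_of_two h01.symm
  have h12 : G.Adj a1 a2 := (h1 _).2 (.inr rfl)
  obtain ⟨a5, h50, h6⟩ := h.exists_adj_iff_of_two h06.symm
  have h65 : G.Adj a6 a5 := (h6 _).2 (.inr rfl)
  have n16 := ht _ _ _ h01 h06
  have n26 : a2 ≠ a6 := by rintro rfl; exact n16 h12
  have n51 : a5 ≠ a1 := by rintro rfl; exact n16 h65.symm
  -- A 4-cycle would leave three vertices, which could only form a triangle.
  have h25 : a2 ≠ a5 := by
    rintro rfl
    obtain ⟨x, hx, h2⟩ := h.exists_adj_iff_of_two h12.symm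
    obtain rfl : a6 = x := ((h2 _).1 h65.symm).resolve_left h61
    obtain ⟨b, hb⟩ := h.exists_notMem {a0, a1, a2, a6} (lt_of_le_of_lt card_le_four (by norm_num))
    simp only [mem_insert, mem_singleton, not_or] at hb
    have hcl : ∀ y z, G.Adj y z → ¬ (y = a0 ∨ y = a1 ∨ y = a2 ∨ y = a6) →
        ¬ (z = a0 ∨ z = a1 ∨ z = a2 ∨ z = a6) := by
      rintro y z hyz hy (rfl | rfl | rfl | rfl)
      · rcases (h0 _).1 hyz.symm with rfl | rfl <;> simp at hy
      · rcases (h1 _).1 hyz.symm with rfl | rfl <;> simp at hy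
      · rcases (h2 _).1 hyz.symm with rfl | rfl <;> simp at hy
      · rcases (h6 _).1 hyz.symm with rfl | rfl <;> simp at hy
    obtain ⟨c, hbc, -⟩ := h.exists_adj_notMem b ∅ (by simp)
    obtain ⟨d, hdc, hb'⟩ := h.exists_adj_iff_of_two hbc
    obtain ⟨e, heb, hc'⟩ := h.exists_adj_iff_of_two hbc.symm
    have hbd : G.Adj b d := (hb' _).2 (.inr rfl)
    have hce : G.Adj c e := (hc' _).2 (.inr rfl)
    have hc := hcl _ _ hbc (by simp [hb])
    have hd := hcl _ _ hbd (by simp [hb])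
    have he := hcl _ _ hce hc
    have e1 := h01.ne; have e2 := h06.ne; have e3 := h12.ne; have e4 := hbc.ne; have e5 := hbd.ne
    have hn : [a0, a1, a2, a6, b, c, d].Nodup := by
      clear ht h hcl hb' hc' h0 h1 h2 h6
      simp
      grind
    have := h.mem_of_nodup hn rfl e
    simp only [List.mem_cons, List.not_mem_nil, or_false] at this
    have hce' := hce.ne
    have hed : e ≠ d := by rintro rfl; exact ht _ _ _ hbc.symm hce hbd
    simp only [not_or] at he
    simp [he, heb, hce'.symm, hed] at this
  obtain ⟨a3, h31, h2⟩ := h.exists_adj_iff_of_two h12.symm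
  obtain ⟨a4, h46, h5⟩ := h.exists_adj_iff_of_two h65.symm
  have h23 : G.Adj a2 a3 := (h2 _).2 (.inr rfl)
  have h54 : G.Adj a5 a4 := (h5 _).2 (.inr rfl)
  have e1 := h01.ne; have e2 := h06.ne; have e3 := h12.ne; have e4 := h65.ne
  have e5 := h23.ne; have e5' := h23.ne'; have e6 := h54.ne
  have n30 : a3 ≠ a0 := by
    rintro rfl
    exact ht _ _ _ h01.symm h12 h23.symm
  have n40 : a4 ≠ a0 := by
    rintro rfl
    exact ht _ _ _ h06.symm h65 h54.symm
  have n36 : a3 ≠ a6 := by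
    rintro rfl
    exact ((h6 _).1 h23.symm).elim h20 h25
  have n41 : a4 ≠ a1 := by
    rintro rfl
    exact ((h1 _).1 h54.symm).elim h50 (Ne.symm h25)
  -- A 5-cycle would leave two vertices, too few for a vertex outside it together with its two
  -- neighbors.
  have h35 : a3 ≠ a5 := by
    rintro rfl
    have hcl : ∀ y z, G.Adj y z → ¬ (y = a0 ∨ y = a1 ∨ y = a2 ∨ y = a3 ∨ y = a6) →
        ¬ (z = a0 ∨ z = a1 ∨ z = a2 ∨ z = a3 ∨ z = a6) := by
      obtain rfl : a2 = a4 := ((h5 _).1 h23.symm).resolve_left n26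
      rintro y z hyz hy (rfl | rfl | rfl | rfl | rfl)
      · rcases (h0 _).1 hyz.symm with rfl | rfl <;> simp at hy
      · rcases (h1 _).1 hyz.symm with rfl | rfl <;> simp at hy
      · rcases (h2 _).1 hyz.symm with rfl | rfl <;> simp at hy
      · rcases (h5 _).1 hyz.symm with rfl | rfl <;> simp at hy
      · rcases (h6 _).1 hyz.symm with rfl | rfl <;> simp at hy
    obtain ⟨b, hb⟩ := h.exists_notMem {a0, a1, a2, a3, a6}
      (lt_of_le_of_lt card_le_five (by norm_num))
    simp only [mem_insert, mem_singleton, not_or] at hb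
    obtain ⟨c, hbc, -⟩ := h.exists_adj_notMem b ∅ (by simp)
    obtain ⟨d, hdc, hb'⟩ := h.exists_adj_iff_of_two hbc
    have hbd : G.Adj b d := (hb' _).2 (.inr rfl)
    have hc := hcl _ _ hbc (by simp [hb])
    have hd := hcl _ _ hbd (by simp [hb])
    have e7 := hbc.ne; have e8 := hbd.ne
    have hn : [a0, a1, a2, a3, a6, b, c].Nodup := by
      clear ht h hcl hb' h0 h1 h2 h6 h5
      simp
      grind
    have := h.mem_of_nodup hn rfl d
    simp only [List.mem_cons, List.not_mem_nil, or_false] at this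
    simp only [not_or] at hd
    simp [hd, e8.symm, hdc] at this
  have h42 : a4 ≠ a2 := by
    rintro rfl
    rcases (h2 _).1 h54.symm with h | h
    · exact n51 h
    · exact h35 h.symm
  -- A 6-cycle would leave one vertex without neighbors.
  have h34 : a3 ≠ a4 := by
    rintro rfl
    obtain ⟨x, hx, h3⟩ := h.exists_adj_iff_of_two h23.symm
    obtain rfl : a5 = x := ((h3 _).1 h54.symm).resolve_left (Ne.symm h25)
    obtain ⟨b, hb⟩ := h.exists_notMem {a0, a1, a2, a3, a5, a6}
      (lt_of_le_of_lt card_le_six (by norm_num))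
    simp only [mem_insert, mem_singleton, not_or] at hb
    obtain ⟨c, hbc, -⟩ := h.exists_adj_notMem b ∅ (by simp)
    have hn : [a0, a1, a2, a3, a5, a6, b].Nodup := by
      clear ht h h0 h1 h2 h6 h5 h3
      simp
      grind
    have := h.mem_of_nodup hn rfl c
    simp only [List.mem_cons, List.not_mem_nil, or_false] at this
    rcases this with rfl | rfl | rfl | rfl | rfl | rfl | rfl
    · have := (h0 _).1 hbc.symm; simp [hb] at this
    · have := (h1 _).1 hbc.symm; simp [hb] at this
    · have := (h2 _).1 hbc.symm; simp [hb] at this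
    · have := (h3 _).1 hbc.symm; simp [hb] at this
    · have := (h5 _).1 hbc.symm; simp [hb] at this
    · have := (h6 _).1 hbc.symm; simp [hb] at this
    · exact hbc.ne rfl
  have hnd : [a0, a1, a2, a3, a4, a5, a6].Nodup := by
    clear ht h h0 h1 h2 h6 h5
    simp
    grind
  have hadj34 : G.Adj a3 a4 := by
    obtain ⟨y, hy, h3⟩ := h.exists_adj_iff_of_two h23.symm
    have h3y : G.Adj a3 y := (h3 _).2 (.inr rfl)
    have := h.mem_of_nodup hnd rfl y
    simp only [List.mem_cons, List.not_mem_nil, or_false] at this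
    rcases this with rfl | rfl | rfl | rfl | rfl | rfl | rfl
    · rcases (h0 _).1 h3y.symm with h' | h' <;> contradiction
    · rcases (h1 _).1 h3y.symm with h' | h' <;> contradiction
    · exact absurd rfl hy
    · exact (h3y.ne rfl).elim
    · exact h3y
    · rcases (h5 _).1 h3y.symm with h' | h' <;> contradiction
    · rcases (h6 _).1 h3y.symm with h' | h' <;> contradiction
  refine h.nonempty_iso inRegularClass_cycleGraph ![a0, a1, a2, a3, a4, a5, a6] ?_ ?_
  · rw [← List.nodup_ofFn]
    simpa using hnd
  · have := h12.symm; have := h23.symm; have := h54.symm; have := h65.symm; have := h06.symm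
    have := h01.symm; have := hadj34.symm
    intro i j hij
    fin_cases i <;> fin_cases j <;> first | assumption | exact absurd hij (by decide)

end Classification

/-! ### Triangle-free cubic graphs on eight vertices. -/

section Wagner

open scoped Classical

variable {V : Type*} [Fintype V]

/-- The number of common neighbors of two vertices. -/
noncomputable def codegree (G : SimpleGraph V) (v w : V) : ℕ :=
  (univ.filter fun u => G.Adj v u ∧ G.Adj w u).card

theorem InRegularClass.sum_codegree {d n : ℕ} {G : SimpleGraph V} (h : InRegularClass d n G)
    (v : V) : ∑ w, codegree G v w = d * d := by
  have h1 : ∀ w, codegree G v w = ∑ u ∈ univ.filter (fun u => G.Adj v u),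
      if G.Adj w u then 1 else 0 := by
    intro w
    rw [codegree, ← card_filter, filter_filter]
  simp_rw [h1]
  rw [sum_comm]
  have h2 : ∀ u, ∑ w, (if G.Adj w u then 1 else 0) = d := by
    intro u
    rw [← card_filter, ← h.card_filter_adj u]
    simp only [G.adj_comm u]
  simp_rw [h2]
  rw [sum_const, h.card_filter_adj, smul_eq_mul]

theorem InRegularClass.codegree_self {d n : ℕ} {G : SimpleGraph V} (h : InRegularClass d n G)
    (v : V) : codegree G v v = d := by
  simp only [codegree, and_self]
  exact h.card_filter_adj v

theorem codegree_eq_zero {G : SimpleGraph V} (ht : ∀ a b c, G.Adj a b → G.Adj a c → ¬ G.Adj b c)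
    {v w : V} (hvw : G.Adj v w) : codegree G v w = 0 := by
  rw [codegree, card_eq_zero, filter_eq_empty_iff]
  rintro u - ⟨h1, h2⟩
  exact ht _ _ _ hvw h1 h2

theorem InRegularClass.card_nonneighbors {d n : ℕ} {G : SimpleGraph V} (h : InRegularClass d n G)
    (v : V) : (univ.filter fun w => w ≠ v ∧ ¬ G.Adj v w).card + d + 1 = n := by
  have h1 := h.compl.card_filter_adj v
  have h2 : (univ.filter fun w => w ≠ v ∧ ¬ G.Adj v w) = univ.filter fun w => Gᶜ.Adj v w := by
    ext w; simp [SimpleGraph.compl_adj, eq_comm]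
  have h3 : d < n := by
    have h4 : (univ.filter fun w => G.Adj v w) ⊂ univ := by
      rw [Finset.ssubset_univ_iff]
      intro h5
      have := mem_univ v
      rw [← h5] at this
      simp at this
    have := card_lt_card h4
    rwa [h.card_filter_adj, card_univ, h.1] at this
  have h5 : (univ.filter fun w => w ≠ v ∧ ¬ G.Adj v w).card = n - 1 - d := by
    rw [h2, ← h1]
    congr!
  omega

/-- In a triangle-free cubic graph on eight vertices, the numbers of closed 4-walks is minimal
only if any two nonadjacent vertices have one or two common neighbors. -/
theorem InRegularClass.codegree_of_adjSeq_four_le {G : SimpleGraph V} (h : InRegularClass 3 8 G)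
    (ht : ∀ a b c, G.Adj a b → G.Adj a c → ¬ G.Adj b c) (h4 : adjSeq G 4 ≤ 152) (v w : V)
    (hvw : v ≠ w) (hn : ¬ G.Adj v w) : codegree G v w = 1 ∨ codegree G v w = 2 := by
  -- For nonadjacent vertices this is (c-1)(c-2) ≥ 0, with equality only for c = 1, 2. The codegrees
  -- 3 (the vertex itself) and 0 (its neighbors) satisfy 3c = c². Summing over the row gives 27 ≤ Σ
  -- c² + 8, so 152 = 8 · 19 is attained only if every row is tight.
  have hpt : ∀ v w, 3 * codegree G v w ≤
      codegree G v w ^ 2 + if w ≠ v ∧ ¬ G.Adj v w then 2 else 0 := by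
    intro v w
    split_ifs with hc
    · obtain h0 | h0 | h0 : codegree G v w = 0 ∨ codegree G v w = 1 ∨ 2 ≤ codegree G v w := by
        omega
      · simp [h0]
      · simp [h0]
      · nlinarith [mul_self_nonneg ((codegree G v w : ℤ) - 1)]
    · by_cases hvw : w = v
      · subst hvw; rw [h.codegree_self]; norm_num
      · rw [codegree_eq_zero ht (by tauto)]; norm_num
  have hrow : ∀ v, ∑ w, (codegree G v w ^ 2 + if w ≠ v ∧ ¬ G.Adj v w then 2 else 0)
      = ∑ w, codegree G v w ^ 2 + 8 := by
    intro v
    rw [sum_add_distrib, ← sum_filter, sum_const, smul_eq_mul]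
    have := h.card_nonneighbors v
    omega
  have hrow' : ∀ v, ∑ w, 3 * codegree G v w = 27 := by
    intro v
    rw [← mul_sum, h.sum_codegree]; norm_num
  have hle : ∀ v, 19 ≤ ∑ w, codegree G v w ^ 2 := by
    intro v
    have := sum_le_sum fun w (_ : w ∈ univ) => hpt v w
    rw [hrow, hrow'] at this
    omega
  have htot : ∑ v, ∑ w, codegree G v w ^ 2 ≤ 152 := by
    rw [adjSeq_four] at h4
    have : ((∑ v, ∑ w, codegree G v w ^ 2 : ℕ) : ℝ) ≤ 152 := by
      push_cast; exact h4
    exact_mod_cast this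
  by_contra hcon
  have hlt : 19 < ∑ w, codegree G v w ^ 2 := by
    have : ∑ w, 3 * codegree G v w <
        ∑ w, (codegree G v w ^ 2 + if w ≠ v ∧ ¬ G.Adj v w then 2 else 0) := by
      refine sum_lt_sum (fun w _ => hpt v w) ⟨w, mem_univ _, ?_⟩
      rw [if_pos ⟨hvw.symm, hn⟩]
      obtain h0 | h0 : codegree G v w = 0 ∨ 3 ≤ codegree G v w := by omega
      · rw [h0]; norm_num
      · nlinarith
    rw [hrow, hrow'] at this
    omega
  have : ∑ _v : V, 19 < ∑ v, ∑ w, codegree G v w ^ 2 :=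
    sum_lt_sum (fun v _ => hle v) ⟨v, mem_univ _, hlt⟩
  rw [sum_const, card_univ, h.1, smul_eq_mul] at this
  omega

theorem InRegularClass.adj_iff_of_three {n : ℕ} {G : SimpleGraph V} (h : InRegularClass 3 n G)
    {v a b c : V} (ha : G.Adj v a) (hb : G.Adj v b) (hc : G.Adj v c)
    (hab : a ≠ b) (hac : a ≠ c) (hbc : b ≠ c) (y : V) :
    G.Adj v y ↔ y = a ∨ y = b ∨ y = c := by
  have := h.adj_iff_mem (v := v) (s := {a, b, c}) (by simp [ha, hb, hc])
    (card_eq_three.2 ⟨a, b, c, hab, hac, hbc, rfl⟩) y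
  simpa using this

/-- The nonneighbors of `v` contain the path `p1, w3, w4, p2`. As `p1` and `x` share the neighbor
`w3`, they are nonadjacent, so `p1` sees the other two neighbors of `v`; the same holds for `p2` and
`y`. The 8-cycle is then `v, x, w3, p1, z, p2, w4, y`, with the remaining edges as long diagonals.
-/
theorem InRegularClass.nonempty_iso_graphH8_of_path {G : SimpleGraph V}
    (h : InRegularClass 3 8 G) (ht : ∀ a b c, G.Adj a b → G.Adj a c → ¬ G.Adj b c)
    {v x y w3 w4 p1 p2 : V} (hvx : G.Adj v x) (hvy : G.Adj v y) (hxy : x ≠ y)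
    (nw3 : w3 ≠ v) (nw4 : w4 ≠ v) (hw3 : ¬ G.Adj v w3) (hw4 : ¬ G.Adj v w4) (h34 : w3 ≠ w4)
    (h3x : G.Adj w3 x) (h4y : G.Adj w4 y) (hadj34 : G.Adj w3 w4)
    (n12 : p1 ≠ p2) (n13 : p1 ≠ w3) (n14 : p1 ≠ w4) (n23 : p2 ≠ w3) (n24 : p2 ≠ w4)
    (n1 : p1 ≠ v) (n2 : p2 ≠ v) (hv1 : ¬ G.Adj v p1) (hv2 : ¬ G.Adj v p2)
    (c1 : ∃ s t, s ≠ t ∧ G.Adj v s ∧ G.Adj v t ∧ G.Adj p1 s ∧ G.Adj p1 t)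
    (c2 : ∃ s t, s ≠ t ∧ G.Adj v s ∧ G.Adj v t ∧ G.Adj p2 s ∧ G.Adj p2 t)
    (h31 : G.Adj w3 p1) (h42 : G.Adj w4 p2) : Nonempty (G ≃g graphH8) := by
  obtain ⟨s, t, hst, hvs, hvt, h1s, h1t⟩ := c1
  obtain ⟨s', t', hst', hvs', hvt', h2s, h2t⟩ := c2
  obtain ⟨z, hvz, hz⟩ := h.exists_adj_notMem v {x, y}
    (lt_of_le_of_lt card_le_two (by norm_num))
  simp only [mem_insert, mem_singleton, not_or] at hz
  have hNv := h.adj_iff_of_three hvx hvy hvz hxy (Ne.symm hz.1) (Ne.symm hz.2)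
  have n1x : ¬ G.Adj p1 x := fun h' => ht _ _ _ h31 h3x h'
  have n2y : ¬ G.Adj p2 y := fun h' => ht _ _ _ h42 h4y h'
  have h1 : G.Adj p1 y ∧ G.Adj p1 z := by
    rcases (hNv s).1 hvs with rfl | rfl | rfl <;> rcases (hNv t).1 hvt with rfl | rfl | rfl <;>
      first | exact absurd rfl hst | exact absurd h1s n1x | exact absurd h1t n1x |
        exact ⟨h1s, h1t⟩ | exact ⟨h1t, h1s⟩
  have h2 : G.Adj p2 x ∧ G.Adj p2 z := by
    rcases (hNv s').1 hvs' with rfl | rfl | rfl <;>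
      rcases (hNv t').1 hvt' with rfl | rfl | rfl <;>
      first | exact absurd rfl hst' | exact absurd h2s n2y | exact absurd h2t n2y |
        exact ⟨h2s, h2t⟩ | exact ⟨h2t, h2s⟩
  obtain ⟨h1y, h1z⟩ := h1
  obtain ⟨h2x, h2z⟩ := h2
  refine h.nonempty_iso inRegularClass_graphH8 ![v, x, w3, p1, z, p2, w4, y] ?_ ?_
  · rw [← List.nodup_ofFn]
    have hne : ∀ a b, G.Adj v a → ¬ G.Adj v b → a ≠ b := by
      rintro a _ h1 h2 rfl; exact h2 h1
    have g1 := hne x _ hvx hv1; have g2 := hne x _ hvx hv2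
    have g3 := hne x _ hvx hw3; have g4 := hne x _ hvx hw4
    have g5 := (hne y _ hvy hv1).symm; have g6 := (hne y _ hvy hv2).symm
    have g7 := (hne y _ hvy hw3).symm; have g8 := (hne y _ hvy hw4).symm
    have k1 := (hne z _ hvz hv1).symm; have k2 := hne z _ hvz hv2
    have k3 := (hne z _ hvz hw3).symm; have k4 := hne z _ hvz hw4
    have l1 := hvx.ne; have l2 := hvy.ne; have l3 := hvz.ne
    have l4 := nw3.symm; have l5 := nw4.symm
    have z1 := Ne.symm hz.1
    simp [g1, g2, g3, g4, g5, g6, g7, g8, k1, k2, k3, k4, l1, l2, l3, l4, l5, n1.symm, n2.symm,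
      n12, n13.symm, n14, n23.symm, n24, h34, hz.2, z1, hxy]
  · have := hvx.symm; have := hvy.symm; have := hvz.symm; have := h3x.symm; have := h4y.symm
    have := h31.symm; have := h42.symm; have := hadj34.symm; have := h1y.symm
    have := h1z.symm; have := h2x.symm; have := h2z.symm
    intro i j hij
    fin_cases i <;> fin_cases j <;> first | assumption | exact absurd hij (by decide)

/-- The four nonneighbors of `v` have codegrees 1 or 2 with `v`, of sum 9 - 3 = 6, hence 2, 2, 1, 1.
Inside the nonneighborhood their degrees are therefore 1, 1, 2, 2, and the induced graph turns out
to be a path. -/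
theorem InRegularClass.nonempty_iso_graphH8 {G : SimpleGraph V} (h : InRegularClass 3 8 G)
    (ht : ∀ a b c, G.Adj a b → G.Adj a c → ¬ G.Adj b c) (h4 : adjSeq G 4 ≤ 152) :
    Nonempty (G ≃g graphH8) := by
  obtain ⟨v, -⟩ := h.exists_notMem ∅ (by simp)
  have hcod := fun w => h.codegree_of_adjSeq_four_le ht h4 v w
  set W := univ.filter fun w => w ≠ v ∧ ¬ G.Adj v w with hW
  have hWc : W.card = 4 := by
    have := h.card_nonneighbors v
    rw [← hW] at this
    omega
  have hWsum : ∑ w ∈ W, codegree G v w = 6 := by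
    have h1 := h.sum_codegree v
    rw [← sum_filter_add_sum_filter_not univ fun w => w ≠ v ∧ ¬ G.Adj v w] at h1
    have h2 : ∑ w ∈ univ.filter (fun w => ¬ (w ≠ v ∧ ¬ G.Adj v w)), codegree G v w = 3 := by
      rw [sum_eq_single_of_mem v (by simp)]
      · exact h.codegree_self v
      · intro w hw hwv
        simp only [mem_filter, mem_univ, true_and] at hw
        exact codegree_eq_zero ht (by tauto)
    rw [← hW] at h1
    omega
  have hmemW : ∀ w, w ∈ W ↔ w ≠ v ∧ ¬ G.Adj v w := by simp [hW]
  have hsplit : ∀ w ∈ W, codegree G v w = 1 + if codegree G v w = 2 then 1 else 0 := by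
    intro w hw
    rcases hcod w ((hmemW w).1 hw).1.symm ((hmemW w).1 hw).2 with h | h <;> simp [h]
  rw [sum_congr rfl hsplit, sum_add_distrib, sum_const, hWc, ← card_filter] at hWsum
  have hc2 : (W.filter fun w => codegree G v w = 2).card = 2 := by
    simp only [smul_eq_mul] at hWsum
    omega
  have hc1 : (W.filter fun w => ¬ codegree G v w = 2).card = 2 := by
    have := card_filter_add_card_filter_not (s := W) (fun w => codegree G v w = 2)
    omega
  obtain ⟨w1, w2, h12, hw12⟩ := card_eq_two.1 hc2
  obtain ⟨w3, w4, h34, hw34⟩ := card_eq_two.1 hc1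
  have hmem2 : ∀ w, (w = w1 ∨ w = w2) ↔ (w ∈ W ∧ codegree G v w = 2) := by
    intro w
    have := congrArg (w ∈ ·) hw12
    simpa using this.symm
  have hmem1 : ∀ w, (w = w3 ∨ w = w4) ↔ (w ∈ W ∧ ¬ codegree G v w = 2) := by
    intro w
    have := congrArg (w ∈ ·) hw34
    simpa using this.symm
  have hmem : ∀ w, w ≠ v → ¬ G.Adj v w → w = w1 ∨ w = w2 ∨ w = w3 ∨ w = w4 := by
    intro w h1 h2
    have h3 := (hmemW w).2 ⟨h1, h2⟩
    by_cases h4 : codegree G v w = 2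
    · rcases (hmem2 w).2 ⟨h3, h4⟩ with h | h <;> simp [h]
    · rcases (hmem1 w).2 ⟨h3, h4⟩ with h | h <;> simp [h]
  -- the neighbors of the vertices of codegree two
  have htwo : ∀ w, w = w1 ∨ w = w2 → ∃ s t r, G.Adj v s ∧ G.Adj v t ∧ ¬ G.Adj v r ∧ s ≠ t ∧
      ∀ y, G.Adj w y ↔ y = s ∨ y = t ∨ y = r := by
    intro w hw
    have h1 := ((hmem2 w).1 hw).2
    obtain ⟨s, t, hst, hs⟩ := card_eq_two.1 h1
    have h2 : ∀ y, (y = s ∨ y = t) ↔ (G.Adj v y ∧ G.Adj w y) := by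
      intro y
      have := congrArg (y ∈ ·) hs
      simpa using this.symm
    obtain ⟨r, hr, hr'⟩ := h.exists_adj_notMem w {s, t} (lt_of_le_of_lt card_le_two (by norm_num))
    simp only [mem_insert, mem_singleton] at hr'
    have hs := (h2 s).1 (.inl rfl)
    have ht := (h2 t).1 (.inr rfl)
    rw [not_or] at hr'
    refine ⟨s, t, r, hs.1, ht.1, fun h => ?_, hst, h.adj_iff_of_three hs.2 ht.2 hr hst
      (Ne.symm hr'.1) (Ne.symm hr'.2)⟩
    exact not_or.2 hr' ((h2 r).2 ⟨h, hr⟩)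
  have hone : ∀ w, w = w3 ∨ w = w4 → ∃ s r q, G.Adj v s ∧ ¬ G.Adj v r ∧ ¬ G.Adj v q ∧ r ≠ q ∧
      ∀ y, G.Adj w y ↔ y = s ∨ y = r ∨ y = q := by
    intro w hw
    have h1 := (hmem1 w).1 hw
    have h2 := (hmemW w).1 h1.1
    obtain ⟨s, hs⟩ := card_eq_one.1 ((hcod w h2.1.symm h2.2).resolve_right h1.2)
    have h3 : ∀ y, y = s ↔ (G.Adj v y ∧ G.Adj w y) := by
      intro y
      have := congrArg (y ∈ ·) hs
      simpa using this.symm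
    have hs := (h3 s).1 rfl
    obtain ⟨r, hr, hrs⟩ := h.exists_adj_notMem w {s} (by simp)
    obtain ⟨q, hq, hq'⟩ := h.exists_adj_notMem w {s, r}
      (lt_of_le_of_lt card_le_two (by norm_num))
    simp only [mem_insert, mem_singleton, not_or] at hrs hq'
    exact ⟨s, r, q, hs.1, fun h => hrs ((h3 r).2 ⟨h, hr⟩), fun h => hq'.1 ((h3 q).2 ⟨h, hq⟩),
      Ne.symm hq'.2, h.adj_iff_of_three hs.2 hr hq (Ne.symm hrs) (Ne.symm hq'.1)
        (Ne.symm hq'.2)⟩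
  have hw1 := (hmemW w1).1 ((hmem2 w1).1 (.inl rfl)).1
  have hw2 := (hmemW w2).1 ((hmem2 w2).1 (.inr rfl)).1
  have hw3 := (hmemW w3).1 ((hmem1 w3).1 (.inl rfl)).1
  have hw4 := (hmemW w4).1 ((hmem1 w4).1 (.inr rfl)).1
  have h13 : w1 ≠ w3 := fun h => ((hmem1 w1).1 (.inl h)).2 ((hmem2 w1).1 (.inl rfl)).2
  have h14 : w1 ≠ w4 := fun h => ((hmem1 w1).1 (.inr h)).2 ((hmem2 w1).1 (.inl rfl)).2
  have h23 : w2 ≠ w3 := fun h => ((hmem1 w2).1 (.inl h)).2 ((hmem2 w2).1 (.inr rfl)).2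
  have h24 : w2 ≠ w4 := fun h => ((hmem1 w2).1 (.inr h)).2 ((hmem2 w2).1 (.inr rfl)).2
  clear hsplit hc1 hc2 hw12 hw34 hWsum hmem1 hmem2 hmemW
  clear_value W
  clear hW hWc hcod h4
  obtain ⟨s1, t1, r1, hvs1, hvt1, hvr1, hst1, hN1⟩ := htwo w1 (.inl rfl)
  obtain ⟨s2, t2, r2, hvs2, hvt2, hvr2, hst2, hN2⟩ := htwo w2 (.inr rfl)
  obtain ⟨x, r3, q3, hvx, hvr3, hvq3, hrq3, hN3⟩ := hone w3 (.inl rfl)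
  obtain ⟨y, r4, q4, hvy, hvr4, hvq4, hrq4, hN4⟩ := hone w4 (.inr rfl)
  clear htwo hone
  have hnv : ∀ w u, G.Adj w u → ¬ G.Adj v w → u ≠ v := by
    rintro w u h1 h2 rfl
    exact h2 h1.symm
  -- there is a single neighbor of `w1` and of `w2` outside the neighborhood of `v`
  have hu1 : ∀ a b, G.Adj w1 a → G.Adj w1 b → ¬ G.Adj v a → ¬ G.Adj v b → a = b := by
    have key : ∀ a, G.Adj w1 a → ¬ G.Adj v a → a = r1 := by
      intro a h1 h2
      rcases (hN1 a).1 h1 with rfl | rfl | rfl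
      exacts [absurd hvs1 h2, absurd hvt1 h2, rfl]
    intro a b h1 h2 h3 h4
    rw [key a h1 h3, key b h2 h4]
  have hu2 : ∀ a b, G.Adj w2 a → G.Adj w2 b → ¬ G.Adj v a → ¬ G.Adj v b → a = b := by
    have key : ∀ a, G.Adj w2 a → ¬ G.Adj v a → a = r2 := by
      intro a h1 h2
      rcases (hN2 a).1 h1 with rfl | rfl | rfl
      exacts [absurd hvs2 h2, absurd hvt2 h2, rfl]
    intro a b h1 h2 h3 h4
    rw [key a h1 h3, key b h2 h4]
  have hux : ∀ a, G.Adj w3 a → G.Adj v a → a = x := by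
    intro a h1 h2
    rcases (hN3 a).1 h1 with rfl | rfl | rfl
    exacts [rfl, absurd h2 hvr3, absurd h2 hvq3]
  have huy : ∀ a, G.Adj w4 a → G.Adj v a → a = y := by
    intro a h1 h2
    rcases (hN4 a).1 h1 with rfl | rfl | rfl
    exacts [rfl, absurd h2 hvr4, absurd h2 hvq4]
  have h3r : G.Adj w3 r3 := (hN3 _).2 (.inr (.inl rfl))
  have h3q : G.Adj w3 q3 := (hN3 _).2 (.inr (.inr rfl))
  have h4r : G.Adj w4 r4 := (hN4 _).2 (.inr (.inl rfl))
  have h4q : G.Adj w4 q4 := (hN4 _).2 (.inr (.inr rfl))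
  have h3x : G.Adj w3 x := (hN3 _).2 (.inl rfl)
  have h4y : G.Adj w4 y := (hN4 _).2 (.inl rfl)
  have m3r := hmem r3 (hnv _ _ h3r hw3.2) hvr3
  have m3q := hmem q3 (hnv _ _ h3q hw3.2) hvq3
  have m4r := hmem r4 (hnv _ _ h4r hw4.2) hvr4
  have m4q := hmem q4 (hnv _ _ h4q hw4.2) hvq4
  -- Otherwise `w3` and `w4` would both be adjacent to `w1`, which has only one neighbor outside the
  -- neighborhood of `v`.
  have hadj34 : G.Adj w3 w4 := by
    by_contra hn
    have e3 : ∀ a b, G.Adj w3 a → G.Adj w3 b → ¬ G.Adj v a → ¬ G.Adj v b → a ≠ b →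
        G.Adj w3 w1 := by
      intro a b h1 h2 h3 h4 h5
      rcases hmem a (hnv _ _ h1 hw3.2) h3 with rfl | rfl | rfl | rfl
      · exact h1
      · rcases hmem b (hnv _ _ h2 hw3.2) h4 with rfl | rfl | rfl | rfl
        exacts [h2, absurd rfl h5, (h2.ne rfl).elim, (hn h2).elim]
      · exact (h1.ne rfl).elim
      · exact (hn h1).elim
    have e4 : ∀ a b, G.Adj w4 a → G.Adj w4 b → ¬ G.Adj v a → ¬ G.Adj v b → a ≠ b →
        G.Adj w4 w1 := by
      intro a b h1 h2 h3 h4 h5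
      rcases hmem a (hnv _ _ h1 hw4.2) h3 with rfl | rfl | rfl | rfl
      · exact h1
      · rcases hmem b (hnv _ _ h2 hw4.2) h4 with rfl | rfl | rfl | rfl
        exacts [h2, absurd rfl h5, (hn h2.symm).elim, (h2.ne rfl).elim]
      · exact (hn h1.symm).elim
      · exact (h1.ne rfl).elim
    exact h34 (hu1 _ _ (e3 _ _ h3r h3q hvr3 hvq3 hrq3).symm (e4 _ _ h4r h4q hvr4 hvq4 hrq4).symm
      hw3.2 hw4.2)
  -- the second neighbors of `w3` and `w4`
  have f3 : G.Adj w3 w1 ∨ G.Adj w3 w2 := by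
    rcases m3r with rfl | rfl | rfl | rfl
    · exact .inl h3r
    · exact .inr h3r
    · exact (h3r.ne rfl).elim
    · rcases m3q with rfl | rfl | rfl | rfl
      exacts [.inl h3q, .inr h3q, (h3q.ne rfl).elim, absurd rfl hrq3]
  have f4 : G.Adj w4 w1 ∨ G.Adj w4 w2 := by
    rcases m4r with rfl | rfl | rfl | rfl
    · exact .inl h4r
    · exact .inr h4r
    · rcases m4q with rfl | rfl | rfl | rfl
      exacts [.inl h4q, .inr h4q, absurd rfl hrq4, (h4q.ne rfl).elim]
    · exact (h4r.ne rfl).elim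
  have hxy : x ≠ y := by
    rintro rfl
    exact ht _ _ _ h3x hadj34 h4y.symm
  have fin : ∀ p1 p2 : V, p1 ≠ p2 → p1 ≠ w3 → p1 ≠ w4 → p2 ≠ w3 → p2 ≠ w4 → p1 ≠ v → p2 ≠ v →
      ¬ G.Adj v p1 → ¬ G.Adj v p2 →
      (∃ s t, s ≠ t ∧ G.Adj v s ∧ G.Adj v t ∧ G.Adj p1 s ∧ G.Adj p1 t) →
      (∃ s t, s ≠ t ∧ G.Adj v s ∧ G.Adj v t ∧ G.Adj p2 s ∧ G.Adj p2 t) →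
      G.Adj w3 p1 → G.Adj w4 p2 → Nonempty (G ≃g graphH8) :=
    fun p1 p2 n12 n13 n14 n23 n24 n1 n2 hv1 hv2 c1 c2 h31 h42 =>
      h.nonempty_iso_graphH8_of_path ht hvx hvy hxy hw3.1 hw4.1 hw3.2 hw4.2 h34 h3x h4y hadj34
        n12 n13 n14 n23 n24 n1 n2 hv1 hv2 c1 c2 h31 h42
  have g1 : ∃ s t, s ≠ t ∧ G.Adj v s ∧ G.Adj v t ∧ G.Adj w1 s ∧ G.Adj w1 t :=
    ⟨s1, t1, hst1, hvs1, hvt1, (hN1 _).2 (.inl rfl), (hN1 _).2 (.inr (.inl rfl))⟩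
  have g2 : ∃ s t, s ≠ t ∧ G.Adj v s ∧ G.Adj v t ∧ G.Adj w2 s ∧ G.Adj w2 t :=
    ⟨s2, t2, hst2, hvs2, hvt2, (hN2 _).2 (.inl rfl), (hN2 _).2 (.inr (.inl rfl))⟩
  rcases f3 with f3 | f3 <;> rcases f4 with f4 | f4
  · exact absurd (hu1 _ _ f3.symm f4.symm hw3.2 hw4.2) h34
  · exact fin w1 w2 h12 h13 h14 h23 h24 hw1.1 hw2.1 hw1.2 hw2.2 g1 g2 f3 f4
  · exact fin w2 w1 h12.symm h23 h24 h13 h14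
      hw2.1 hw1.1 hw2.2 hw1.2 g2 g1 f3 f4
  · exact absurd (hu2 _ _ f3.symm f4.symm hw3.2 hw4.2) h34

end Wagner

/-! ### 4-regular graphs on nine vertices with at most two triangles. -/

section NineVertices

open scoped Classical

variable {V : Type*} [Fintype V]

/-- Twice the number of triangles through a vertex. -/
noncomputable def localTriangles (G : SimpleGraph V) (v : V) : ℕ :=
  (univ.filter fun p : V × V => G.Adj v p.1 ∧ G.Adj v p.2 ∧ G.Adj p.1 p.2).card

theorem adjSeq_three_eq_sum_localTriangles (G : SimpleGraph V) :
    adjSeq G 3 = ((∑ v, localTriangles G v : ℕ) : ℝ) := by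
  rw [adjSeq_three]; push_cast; rfl

theorem two_le_localTriangles {G : SimpleGraph V} {v a b : V} (h1 : G.Adj v a) (h2 : G.Adj v b)
    (h3 : G.Adj a b) : 2 ≤ localTriangles G v := by
  have : ({(a, b), (b, a)} : Finset (V × V)).card ≤ localTriangles G v := by
    refine Finset.card_le_card ?_
    intro p hp
    simp only [mem_insert, mem_singleton] at hp
    rcases hp with rfl | rfl <;> simp [h1, h2, h3, h3.symm]
  rwa [card_pair (by simp [h3.ne])] at this

theorem four_le_localTriangles {G : SimpleGraph V} {v u a b : V} (h1 : G.Adj v u)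
    (ha : G.Adj v a) (hb : G.Adj v b) (hua : G.Adj u a) (hub : G.Adj u b) (hab : a ≠ b) :
    4 ≤ localTriangles G v := by
  have : ({(u, a), (a, u), (u, b), (b, u)} : Finset (V × V)).card ≤ localTriangles G v := by
    refine Finset.card_le_card ?_
    intro p hp
    simp only [mem_insert, mem_singleton] at hp
    rcases hp with rfl | rfl | rfl | rfl <;> simp [h1, ha, hb, hua, hub, hua.symm, hub.symm]
  have n1 := hua.ne; have n2 := hub.ne
  rw [Finset.card_insert_of_notMem, Finset.card_insert_of_notMem,
    Finset.card_insert_of_notMem, Finset.card_singleton] at this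
  · exact this
  all_goals simp only [mem_insert, mem_singleton, Prod.mk.injEq, not_or]; grind

theorem nonempty_iso_graphH9_of_adj {G : SimpleGraph V} (h : InRegularClass 4 9 G)
    {v s m x1 x2 x3 x4 p q : V} (hnd : [v, s, m, x1, x2, x4, x3, p, q].Nodup)
    (e1 : G.Adj v x1) (e2 : G.Adj v x2) (e3 : G.Adj v x3) (e4 : G.Adj v x4)
    (f1 : G.Adj s x1) (f2 : G.Adj s x2) (f3 : G.Adj s x3) (f4 : G.Adj s x4)
    (g1 : G.Adj m x3) (g2 : G.Adj m x4) (g3 : G.Adj m p) (g4 : G.Adj m q)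
    (k1 : G.Adj p x1) (k2 : G.Adj p x2) (k3 : G.Adj p x4)
    (l1 : G.Adj q x1) (l2 : G.Adj q x2) (l3 : G.Adj q x3) : Nonempty (G ≃g graphH9) := by
  refine h.nonempty_iso inRegularClass_graphH9 ![v, s, m, x1, x2, x4, x3, p, q] ?_ ?_
  · rw [← List.nodup_ofFn]
    simpa using hnd
  · have := e1.symm; have := e2.symm; have := e3.symm; have := e4.symm
    have := f1.symm; have := f2.symm; have := f3.symm; have := f4.symm
    have := g1.symm; have := g2.symm; have := g3.symm; have := g4.symm
    have := k1.symm; have := k2.symm; have := k3.symm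
    have := l1.symm; have := l2.symm; have := l3.symm
    intro i j hij
    fin_cases i <;> fin_cases j <;> first | assumption | exact absurd hij (by decide)

/-- Two triangles cannot cover nine vertices, so some `v` lies in none and its neighborhood `N` is
independent. Each vertex of `N` then misses exactly one of the four nonneighbors `W`, and a vertex
of `W` has as many neighbors in `W` as nonneighbors in `N`. Hence `W` carries two edges; they are
not disjoint, and a path with two edges plus an isolated vertex determines the graph. -/
theorem InRegularClass.nonempty_iso_graphH9 {G : SimpleGraph V} (h : InRegularClass 4 9 G)
    (h3 : adjSeq G 3 ≤ 12) : Nonempty (G ≃g graphH9) := by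
  have hsum : ∑ v, localTriangles G v ≤ 12 := by
    rw [adjSeq_three_eq_sum_localTriangles] at h3
    exact_mod_cast h3
  obtain ⟨v, hv⟩ : ∃ v, localTriangles G v < 2 := by
    by_contra! hcon
    have := card_nsmul_le_sum univ (fun v => localTriangles G v) 2 fun v _ => hcon v
    rw [card_univ, h.1, smul_eq_mul] at this
    omega
  have hind : ∀ a b, G.Adj v a → G.Adj v b → ¬ G.Adj a b := fun a b h1 h2 h3 =>
    absurd (two_le_localTriangles h1 h2 h3) (by omega)
  obtain ⟨N, hN⟩ : ∃ N : Finset V, ∀ x, x ∈ N ↔ G.Adj v x :=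
    ⟨univ.filter fun x => G.Adj v x, by simp⟩
  obtain ⟨W, hW⟩ : ∃ W : Finset V, ∀ w, w ∈ W ↔ w ≠ v ∧ ¬ G.Adj v w :=
    ⟨univ.filter fun w => w ≠ v ∧ ¬ G.Adj v w, by simp⟩
  have hNc : N.card = 4 := by
    rw [← h.card_filter_adj v]; congr 1; ext x; simp [hN]
  have hWc : W.card = 4 := by
    have h1 := h.card_nonneighbors v
    have h2 : W = univ.filter fun w => w ≠ v ∧ ¬ G.Adj v w := by ext w; simp [hW]
    rw [h2]; omega
  have hWN : ∀ w ∈ W, (W.filter fun u => G.Adj w u).card = (N.filter fun x => ¬ G.Adj w x).card := by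
    intro w hw
    have h1 : (univ.filter fun u => G.Adj w u)
        = (N.filter fun u => G.Adj w u) ∪ (W.filter fun u => G.Adj w u) := by
      ext u
      simp only [mem_filter, mem_univ, true_and, mem_union, hN, hW]
      have : G.Adj w u → u ≠ v := by rintro h1 rfl; exact ((hW w).1 hw).2 h1.symm
      tauto
    have h2 : Disjoint (N.filter fun u => G.Adj w u) (W.filter fun u => G.Adj w u) := by
      rw [Finset.disjoint_left]
      intro u hu hu'
      simp only [mem_filter, hN, hW] at hu hu'
      exact hu'.1.2 hu.1
    have h3 := congrArg card h1
    rw [card_union_of_disjoint h2, h.card_filter_adj] at h3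
    have := card_filter_add_card_filter_not (s := N) (fun u => G.Adj w u)
    omega
  have hNW : ∀ x ∈ N, (W.filter fun w => ¬ G.Adj w x).card = 1 := by
    intro x hx
    have hvx := (hN x).1 hx
    have h1 : (univ.filter fun u => G.Adj x u) = insert v (W.filter fun w => G.Adj w x) := by
      ext u
      simp only [mem_filter, mem_univ, true_and, mem_insert, hW, G.adj_comm u x]
      constructor
      · intro hxu
        by_cases huv : u = v
        · exact .inl huv
        · exact .inr ⟨⟨huv, fun hvu => hind _ _ hvx hvu hxu⟩, hxu⟩
      · rintro (rfl | h1)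
        exacts [hvx.symm, h1.2]
    have h2 := congrArg card h1
    rw [card_insert_of_notMem (by simp [hW]), h.card_filter_adj] at h2
    have := card_filter_add_card_filter_not (s := W) (fun w => G.Adj w x)
    omega
  have hsum4 : ∑ w ∈ W, (N.filter fun x => ¬ G.Adj w x).card = 4 := by
    have := Finset.sum_card_bipartiteAbove_eq_sum_card_bipartiteBelow
      (s := W) (t := N) (fun w x => ¬ G.Adj w x)
    simp only [bipartiteAbove, bipartiteBelow] at this
    rw [this, sum_congr rfl hNW, sum_const, hNc, smul_eq_mul]
  -- If the two edges of `W` were disjoint, the ends of each would have at least 4 - 1 - 1 = 2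
  -- common neighbors in `N`, giving Σ ≥ 4 · 4 > 12.
  by_cases hall : ∀ w ∈ W, (W.filter fun u => G.Adj w u).card ≤ 1
  · exfalso
    have hone : ∀ w ∈ W, (N.filter fun x => ¬ G.Adj w x).card = 1 := by
      have h1 : ∀ w ∈ W, (N.filter fun x => ¬ G.Adj w x).card ≤ 1 := fun w hw => by
        rw [← hWN w hw]; exact hall w hw
      have h2 : ∑ w ∈ W, (N.filter fun x => ¬ G.Adj w x).card = ∑ w ∈ W, 1 := by
        rw [hsum4, sum_const, hWc, smul_eq_mul]
      exact (sum_eq_sum_iff_of_le h1).1 h2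
    have h4 : ∀ w ∈ W, 4 ≤ localTriangles G w := by
      intro w hw
      have h1 := hone w hw
      rw [← hWN w hw] at h1
      obtain ⟨u, hu⟩ := card_pos.1 (by rw [h1]; norm_num : 0 < (W.filter fun u => G.Adj w u).card)
      rw [mem_filter] at hu
      have h2 : N.card ≤ (N.filter fun x => G.Adj w x ∧ G.Adj u x).card
          + ((N.filter fun x => ¬ G.Adj w x).card + (N.filter fun x => ¬ G.Adj u x).card) := by
        refine le_trans ?_ (le_trans (card_union_le _ _)
          (Nat.add_le_add_left (card_union_le _ _) _))
        refine card_le_card fun x hx => ?_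
        simp only [mem_union, mem_filter, hx, true_and]
        tauto
      rw [hone w hw, hone u hu.1, hNc] at h2
      obtain ⟨a, ha, b, hb, hab⟩ := one_lt_card.1
        (by omega : 1 < (N.filter fun x => G.Adj w x ∧ G.Adj u x).card)
      rw [mem_filter] at ha hb
      exact four_le_localTriangles hu.2 ha.2.1 hb.2.1 ha.2.2 hb.2.2 hab
    have h5 := card_nsmul_le_sum W (fun w => localTriangles G w) 4 h4
    rw [hWc, smul_eq_mul] at h5
    have h6 : ∑ w ∈ W, localTriangles G w ≤ ∑ w, localTriangles G w :=
      sum_le_sum_of_subset (subset_univ _)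
    omega
  · push Not at hall
    obtain ⟨m, hm, hm2⟩ := hall
    obtain ⟨p, hp, q, hq, hpq⟩ := one_lt_card.1 hm2
    rw [mem_filter] at hp hq
    have hmpq : ({m, p, q} : Finset V).card = 3 :=
      card_eq_three.2 ⟨m, p, q, hp.2.ne, hq.2.ne, hpq, rfl⟩
    obtain ⟨s, hs, hs'⟩ := Finset.exists_mem_notMem_of_card_lt_card
      (s := ({m, p, q} : Finset V)) (t := W) (by omega)
    simp only [mem_insert, mem_singleton, not_or] at hs'
    have hcard4 : ({s, m, p, q} : Finset V).card = 4 := by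
      rw [card_insert_of_notMem (by simp [hs']), hmpq]
    have hWeq : W = {s, m, p, q} := by
      refine (eq_of_subset_of_card_le ?_ (by omega)).symm
      intro x hx
      simp only [mem_insert, mem_singleton] at hx
      rcases hx with rfl | rfl | rfl | rfl
      exacts [hs, hm, hp.1, hq.1]
    have hp1 : 1 ≤ (W.filter fun u => G.Adj p u).card :=
      card_pos.2 ⟨m, by simp [hm, hp.2.symm]⟩
    have hq1 : 1 ≤ (W.filter fun u => G.Adj q u).card :=
      card_pos.2 ⟨m, by simp [hm, hq.2.symm]⟩
    -- The degrees inside `W` sum to 4 and are at least 2, 1, 1 at `m`, `p`, `q`, so these are exact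
    -- and `s` has degree 0.
    rw [← sum_congr rfl hWN, sum_congr hWeq fun _ _ => rfl, sum_insert (by simp [hs']),
      sum_insert (by simp [hp.2.ne, hq.2.ne]), sum_insert (by simp [hpq]), sum_singleton] at hsum4
    have c1 : (N.filter fun x => ¬ G.Adj s x).card = 0 := by rw [← hWN s hs]; omega
    have c2 : (N.filter fun x => ¬ G.Adj m x).card = 2 := by rw [← hWN m hm]; omega
    have c3 : (N.filter fun x => ¬ G.Adj p x).card = 1 := by rw [← hWN p hp.1]; omega
    have c4 : (N.filter fun x => ¬ G.Adj q x).card = 1 := by rw [← hWN q hq.1]; omega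
    have hS : ∀ x, G.Adj v x → G.Adj s x := by
      intro x hx
      by_contra hn
      have : x ∈ N.filter fun x => ¬ G.Adj s x := by simp [hN, hx, hn]
      rw [card_eq_zero.1 c1] at this
      simp at this
    have huniq : ∀ x, G.Adj v x → ∀ a b, a ∈ W → b ∈ W → ¬ G.Adj a x → ¬ G.Adj b x → a = b := by
      intro x hx a b ha hb h1 h2
      exact card_le_one.1 (hNW x ((hN x).2 hx)).le a (by simp [ha, h1]) b (by simp [hb, h2])
    obtain ⟨x1, hx1, x2, hx2, h12⟩ := one_lt_card.1 (by omega :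
      1 < (N.filter fun x => ¬ G.Adj m x).card)
    obtain ⟨x3, hx3⟩ := card_pos.1 (by omega : 0 < (N.filter fun x => ¬ G.Adj p x).card)
    obtain ⟨x4, hx4⟩ := card_pos.1 (by omega : 0 < (N.filter fun x => ¬ G.Adj q x).card)
    rw [mem_filter, hN] at hx1 hx2 hx3 hx4
    have hmp := hp.2.ne; have hmq := hq.2.ne
    have n13 : x1 ≠ x3 := by rintro rfl; exact hmp (huniq _ hx1.1 _ _ hm hp.1 hx1.2 hx3.2)
    have n14 : x1 ≠ x4 := by rintro rfl; exact hmq (huniq _ hx1.1 _ _ hm hq.1 hx1.2 hx4.2)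
    have n23 : x2 ≠ x3 := by rintro rfl; exact hmp (huniq _ hx2.1 _ _ hm hp.1 hx2.2 hx3.2)
    have n24 : x2 ≠ x4 := by rintro rfl; exact hmq (huniq _ hx2.1 _ _ hm hq.1 hx2.2 hx4.2)
    have n34 : x3 ≠ x4 := by rintro rfl; exact hpq (huniq _ hx3.1 _ _ hp.1 hq.1 hx3.2 hx4.2)
    have hadj : ∀ x a b, G.Adj v x → a ∈ W → b ∈ W → a ≠ b → ¬ G.Adj a x → G.Adj b x := by
      intro x a b hx ha hb hab h1
      by_contra h2
      exact hab (huniq x hx a b ha hb h1 h2)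
    refine nonempty_iso_graphH9_of_adj h (v := v) (s := s) (m := m) (x1 := x1) (x2 := x2)
      (x3 := x3) (x4 := x4) (p := p) (q := q) ?_ hx1.1 hx2.1 hx3.1 hx4.1 (hS _ hx1.1)
      (hS _ hx2.1) (hS _ hx3.1) (hS _ hx4.1) (hadj x3 p m hx3.1 hp.1 hm hmp.symm hx3.2)
      (hadj x4 q m hx4.1 hq.1 hm hmq.symm hx4.2) hp.2 hq.2
      (hadj x1 m p hx1.1 hm hp.1 hmp hx1.2) (hadj x2 m p hx2.1 hm hp.1 hmp hx2.2)
      (hadj x4 q p hx4.1 hq.1 hp.1 hpq.symm hx4.2)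
      (hadj x1 m q hx1.1 hm hq.1 hmq hx1.2) (hadj x2 m q hx2.1 hm hq.1 hmq hx2.2)
      (hadj x3 p q hx3.1 hp.1 hq.1 hpq hx3.2)
    have hxw : ∀ x w, G.Adj v x → w ∈ W → x ≠ w := by
      rintro x _ h1 h2 rfl
      exact ((hW _).1 h2).2 h1
    have hvw : ∀ w ∈ W, v ≠ w := fun w hw => ((hW w).1 hw).1.symm
    have a1 := hx1.1.ne; have a2 := hx2.1.ne; have a3 := hx3.1.ne; have a4 := hx4.1.ne
    have b1 := hvw s hs; have b2 := hvw m hm; have b3 := hvw p hp.1; have b4 := hvw q hq.1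
    have d1 := (hxw x1 s hx1.1 hs).symm; have d2 := (hxw x2 s hx2.1 hs).symm
    have d3 := (hxw x3 s hx3.1 hs).symm; have d4 := (hxw x4 s hx4.1 hs).symm
    have d5 := (hxw x1 m hx1.1 hm).symm; have d6 := (hxw x2 m hx2.1 hm).symm
    have d7 := (hxw x3 m hx3.1 hm).symm; have d8 := (hxw x4 m hx4.1 hm).symm
    have r1 := hxw x1 p hx1.1 hp.1; have r2 := hxw x2 p hx2.1 hp.1
    have r3 := hxw x3 p hx3.1 hp.1; have r4 := hxw x4 p hx4.1 hp.1
    have r5 := hxw x1 q hx1.1 hq.1; have r6 := hxw x2 q hx2.1 hq.1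
    have r7 := hxw x3 q hx3.1 hq.1; have r8 := hxw x4 q hx4.1 hq.1
    simp only [List.nodup_cons, List.mem_cons, List.not_mem_nil, or_false, not_or,
      List.nodup_nil, and_true, not_false_eq_true]
    exact ⟨⟨b1, b2, a1, a2, a4, a3, b3, b4⟩, ⟨hs'.1, d1, d2, d4, d3, hs'.2.1, hs'.2.2⟩,
      ⟨d5, d6, d8, d7, hmp, hmq⟩, ⟨h12, n14, n13, r1, r5⟩, ⟨n24, n23, r2, r6⟩,
      ⟨n34.symm, r4, r8⟩, ⟨r3, r7⟩, hpq⟩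

end NineVertices

/-! ### Extremality of the complement by induction on the number of blocks. -/

section Main

open scoped Classical

theorem inRegularClass_baseGraph {ρ : ℕ} (hρ : ρ < 5) :
    InRegularClass ρ (5 + ρ) (baseGraph ρ) := by
  interval_cases ρ
  · exact inRegularClass_of_decide (G := (⊤ : SimpleGraph (Fin 5))ᶜ) (by decide)
  · exact inRegularClass_threeK2
  · exact inRegularClass_cycleGraph
  · exact inRegularClass_graphH8
  · exact inRegularClass_graphH9

/-- The extremal property of the base graphs among regular graphs with the same parameters. -/
theorem InRegularClass.base_cases {ρ : ℕ} (hρ : ρ < 5) {V : Type*} [Fintype V]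
    {G : SimpleGraph V} (h : InRegularClass ρ (5 + ρ) G) :
    Nonempty (G ≃g baseGraph ρ) ∨ adjSeq (baseGraph ρ) 3 < adjSeq G 3 ∨
      adjSeq (baseGraph ρ) 3 = adjSeq G 3 ∧ adjSeq (baseGraph ρ) 4 < adjSeq G 4 := by
  interval_cases ρ
  · left
    refine h.nonempty_iso (inRegularClass_baseGraph (ρ := 0) (by norm_num))
      (Fintype.equivFinOfCardEq h.1).symm (Equiv.injective _) ?_
    intro i j hij
    exact absurd hij (by simp [baseGraph])
  · exact .inl h.nonempty_iso_threeK2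
  · by_cases h3 : adjSeq G 3 ≤ 0
    · exact .inl (h.nonempty_iso_cycleGraph (not_adj_of_adjSeq_three_nonpos h3))
    · refine .inr (.inl ?_)
      rw [show adjSeq (baseGraph 2) 3 = 0 from adjSeq_cycleGraph]
      exact not_le.1 h3
  · have h8 : adjSeq (baseGraph 3) 3 = 0 := adjSeq_graphH8
    have h84 : adjSeq (baseGraph 3) 4 = 152 := adjSeq_graphH8_four
    by_cases h3 : adjSeq G 3 ≤ 0
    · have ht := not_adj_of_adjSeq_three_nonpos h3
      by_cases h4 : adjSeq G 4 ≤ 152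
      · exact .inl (h.nonempty_iso_graphH8 ht h4)
      · refine .inr (.inr ⟨?_, ?_⟩)
        · rw [h8, adjSeq_three_eq_zero ht]
        · rw [h84]; exact not_le.1 h4
    · refine .inr (.inl ?_)
      rw [h8]
      exact not_le.1 h3
  · by_cases h3 : adjSeq G 3 ≤ 12
    · exact .inl (h.nonempty_iso_graphH9 h3)
    · refine .inr (.inl ?_)
      rw [show adjSeq (baseGraph 4) 3 = 12 from adjSeq_graphH9]
      exact not_le.1 h3

/-- The third and fourth trace of the complement of a regular graph. -/
theorem exists_adjSeq_compl_three_four (n r : ℕ) :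
    ∃ c₃ c₄ : ℝ, ∀ (V : Type) [Fintype V] (F : SimpleGraph V), InRegularClass r n F →
      adjSeq Fᶜ 3 = c₃ - adjSeq F 3 ∧ adjSeq Fᶜ 4 = c₄ + 4 * adjSeq F 3 + adjSeq F 4 := by
  obtain ⟨c, hc⟩ := exists_adjSeq_compl n r 3
  obtain ⟨d, hd⟩ := exists_adjSeq_compl n r 4
  refine ⟨c - n - 3 * (n * r), d + n + 6 * (n * r), fun V _ F hF => ?_⟩
  rw [hc V F hF, hd V F hF, trace_one_add_pow, trace_one_add_pow]
  simp only [sum_range_succ, range_zero, sum_empty, adjSeq_zero, adjSeq_one, hF.adjSeq_two, hF.1]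
  norm_num [Nat.choose]
  constructor <;> ring

theorem InRegularClass.adjSeq_three_of_complete {V : Type*} [Fintype V] {n : ℕ}
    {G : SimpleGraph V} (h : InRegularClass 4 n G) (hG : ∀ a b, a ≠ b → G.Adj a b) :
    adjSeq G 3 = 12 * n := by
  have h1 := h.adjSeq_three_add_sum_defect
  have h2 : ∀ v, defect G v = 0 := by
    intro v
    rw [defect, card_eq_zero, filter_eq_empty_iff]
    rintro p - ⟨-, h3, h4⟩
    exact h4 (hG _ _ h3)
  simpa only [h2, sum_const_zero, Nat.cast_zero, add_zero] using h1

theorem inRegularClass_top : InRegularClass 4 5 (⊤ : SimpleGraph (Fin 5)) :=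
  inRegularClass_of_decide (by decide)

theorem adjSeq_top : adjSeq (⊤ : SimpleGraph (Fin 5)) 3 = 60 := by
  rw [inRegularClass_top.adjSeq_three_of_complete fun _ _ h => h]; norm_num

/-- The complement of the extremal graph with `k + 1` blocks. -/
abbrev extremalCompl (ρ k : ℕ) : SimpleGraph (Fin (5 + ρ) ⊕ (Fin k × Fin 5)) :=
  (baseGraph ρ)ᶜ ⊕g cliqueCopies k

theorem adjSeq_extremalCompl_succ (ρ k i : ℕ) :
    adjSeq (extremalCompl ρ (k + 1)) i
      = adjSeq (extremalCompl ρ k) i + adjSeq (⊤ : SimpleGraph (Fin 5)) i := by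
  rw [adjSeq_sum, adjSeq_sum, ← adjSeq_iso (cliqueCopiesSucc k), adjSeq_sum, add_assoc]

theorem adjSeq_extremalCompl_zero (ρ i : ℕ) :
    adjSeq (extremalCompl ρ 0) i = adjSeq (baseGraph ρ)ᶜ i := by
  rw [adjSeq_sum]
  simp [adjSeq, Matrix.trace]

theorem InRegularClass.regular_compl_baseGraph {ρ : ℕ} (hρ : ρ < 5) :
    InRegularClass 4 (5 + ρ) (baseGraph ρ)ᶜ := by
  have := (inRegularClass_baseGraph hρ).compl
  rwa [show 5 + ρ - 1 - ρ = 4 by omega] at this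

theorem le_adjSeq_compl_baseGraph {ρ : ℕ} (hρ : ρ < 5) :
    12 * ((5 + ρ : ℕ) : ℝ) ≤ adjSeq (baseGraph ρ)ᶜ 3 + baseDefect ρ := by
  interval_cases ρ
  · have : adjSeq (baseGraph 0)ᶜ 3 = (60 : ℕ) := by
      refine adjSeq_three_of_decide (G := (⊤ : SimpleGraph (Fin 5))ᶜᶜ) ?_
      decide +kernel
    rw [this]; norm_num [baseDefect]
  · have : adjSeq (baseGraph 1)ᶜ 3 = (48 : ℕ) := by
      refine adjSeq_three_of_decide (G := threeK2ᶜ) ?_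
      decide +kernel
    rw [this]; norm_num [baseDefect]
  · have : adjSeq (baseGraph 2)ᶜ 3 = (42 : ℕ) := by
      refine adjSeq_three_of_decide (G := (SimpleGraph.cycleGraph 7)ᶜ) ?_
      decide +kernel
    rw [this]; norm_num [baseDefect]
  · have : adjSeq (baseGraph 3)ᶜ 3 = (48 : ℕ) := by
      refine adjSeq_three_of_decide (G := graphH8ᶜ) ?_
      decide +kernel
    rw [this]; norm_num [baseDefect]
  · have : adjSeq (baseGraph 4)ᶜ 3 = (60 : ℕ) := by
      refine adjSeq_three_of_decide (G := graphH9ᶜ) ?_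
      decide +kernel
    rw [this]; norm_num [baseDefect]

/-- A further K₅ adds 5 vertices and 60 = 12 · 5 to the third trace, so the total defect does not
grow with `k`. -/
theorem le_adjSeq_extremalCompl {ρ : ℕ} (hρ : ρ < 5) (k : ℕ) :
    12 * ((5 + ρ + 5 * k : ℕ) : ℝ) ≤ adjSeq (extremalCompl ρ k) 3 + baseDefect ρ := by
  induction k with
  | zero => simpa [adjSeq_extremalCompl_zero] using le_adjSeq_compl_baseGraph hρ
  | succ k ih =>
    rw [adjSeq_extremalCompl_succ, adjSeq_top]
    push_cast at ih ⊢
    linarith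

/-- Every 4-regular graph is isomorphic to the complement of the extremal graph, or is
distinguished from it by its third and fourth traces. -/
theorem InRegularClass.extremal_cases {ρ : ℕ} (hρ : ρ < 5) (k : ℕ) (V : Type) [Fintype V]
    {F : SimpleGraph V} (h : InRegularClass 4 (5 + ρ + 5 * k) F) :
    Nonempty (F ≃g extremalCompl ρ k) ∨ adjSeq F 3 < adjSeq (extremalCompl ρ k) 3 ∨
      adjSeq F 3 = adjSeq (extremalCompl ρ k) 3 ∧
        adjSeq (extremalCompl ρ k) 4 < adjSeq F 4 := by
  induction k generalizing V with
  | zero =>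
    rw [adjSeq_extremalCompl_zero, adjSeq_extremalCompl_zero]
    have h' : InRegularClass ρ (5 + ρ) Fᶜ := by
      have := InRegularClass.compl h
      rwa [show 5 + ρ + 5 * 0 - 1 - 4 = ρ by omega] at this
    obtain ⟨c₃, c₄, hc⟩ := exists_adjSeq_compl_three_four (5 + ρ) 4
    obtain ⟨hF3, hF4⟩ := hc V F h
    obtain ⟨hB3, hB4⟩ := hc _ _ (InRegularClass.regular_compl_baseGraph hρ)
    rw [compl_compl] at hB3 hB4
    rcases h'.base_cases hρ with he | h3 | ⟨h3, h4⟩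
    · left
      obtain ⟨e⟩ := he
      have e' : F ≃g (baseGraph ρ)ᶜ := by
        refine ⟨e.toEquiv, fun {a b} => ?_⟩
        have := e.map_adj_iff (v := a) (w := b)
        rw [SimpleGraph.compl_adj] at this
        rw [SimpleGraph.compl_adj]
        change (_ ≠ _ ∧ ¬ (baseGraph ρ).Adj (e a) (e b)) ↔ _
        rw [this, ne_eq, EmbeddingLike.apply_eq_iff_eq]
        have := @SimpleGraph.Adj.ne _ F a b
        tauto
      refine ⟨⟨e'.toEquiv.trans (Equiv.sumEmpty _ _).symm, fun {a b} => ?_⟩⟩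
      exact e'.map_adj_iff
    · right; left; linarith
    · right; right; constructor <;> linarith
  | succ k ih =>
    -- A K₅ component contributes equally to both sides and can be cancelled; without one, the third
    -- trace alone decides.
    by_cases h0 : ∃ v, defect F v = 0
    · obtain ⟨v, hv⟩ := h0
      obtain ⟨W, _, F', hF', ⟨e⟩⟩ := InRegularClass.exists_peel
        (n := 5 + ρ + 5 * k) (by rwa [show 5 + ρ + 5 * k + 5 = 5 + ρ + 5 * (k + 1) by ring]) hv
      rw [adjSeq_extremalCompl_succ, adjSeq_extremalCompl_succ, ← adjSeq_iso e, ← adjSeq_iso e,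
        adjSeq_sum F', adjSeq_sum F']
      rcases ih W hF' with he | h3 | ⟨h3, h4⟩
      · left
        obtain ⟨e'⟩ := he
        exact ⟨e.symm.trans ((SimpleGraph.Iso.sumCongr e' SimpleGraph.Iso.refl).trans
          (SimpleGraph.Iso.sumAssoc.trans
            (SimpleGraph.Iso.sumCongr SimpleGraph.Iso.refl (cliqueCopiesSucc k))))⟩
      · right; left; linarith
      · right; right; constructor <;> linarith
    · push Not at h0
      right; left
      have h1 := h.baseDefect_lt_sum_defect hρ h0
      have h2 := h.adjSeq_three_add_sum_defect
      have h3 := le_adjSeq_extremalCompl hρ (k + 1)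
      have h4 : (baseDefect ρ : ℝ) < ((∑ v, defect F v : ℕ) : ℝ) := by exact_mod_cast h1
      linarith

end Main

/-! ### Trace-minimality and uniqueness. -/

section TraceMinimal

open scoped Classical

theorem InRegularClass.sum {V W : Type*} [Fintype V] [Fintype W] {d m n : ℕ} {G : SimpleGraph V}
    {H : SimpleGraph W} (hG : InRegularClass d m G) (hH : InRegularClass d n H) :
    InRegularClass d (m + n) (G ⊕g H) := by
  rw [inRegularClass_iff]
  refine ⟨by rw [Fintype.card_sum, hG.1, hH.1], ?_⟩
  rintro (v | v)
  · rw [← hG.card_filter_adj v, ← card_map (Function.Embedding.inl : V ↪ V ⊕ W)]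
    congr 1
    ext (x | x) <;> simp
  · rw [← hH.card_filter_adj v, ← card_map (Function.Embedding.inr : W ↪ V ⊕ W)]
    congr 1
    ext (x | x) <;> simp

theorem inRegularClass_cliqueCopies (k : ℕ) : InRegularClass 4 (5 * k) (cliqueCopies k) := by
  induction k with
  | zero => exact ⟨by simp, fun v => v.1.elim0⟩
  | succ k ih => exact (ih.sum inRegularClass_top).of_iso (cliqueCopiesSucc k)

theorem inRegularClass_extremalCompl {ρ : ℕ} (hρ : ρ < 5) (k : ℕ) :
    InRegularClass 4 (5 + ρ + 5 * k) (extremalCompl ρ k) :=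
  (InRegularClass.regular_compl_baseGraph hρ).sum (inRegularClass_cliqueCopies k)

theorem graphH_eq_compl (n : ℕ) : graphH n = (extremalCompl (n % 5) (n / 5 - 1))ᶜ := rfl

theorem five_add_mod {n : ℕ} (hn : 5 ≤ n) : 5 + n % 5 + 5 * (n / 5 - 1) = n := by omega

theorem inRegularClass_extremalCompl_mod {n : ℕ} (hn : 5 ≤ n) :
    InRegularClass 4 n (extremalCompl (n % 5) (n / 5 - 1)) := by
  have := inRegularClass_extremalCompl (Nat.mod_lt n (by norm_num)) (n / 5 - 1)
  rwa [five_add_mod hn] at this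

theorem inRegularClass_graphH {n : ℕ} (hn : 5 ≤ n) : InRegularClass (n - 5) n (graphH n) := by
  have := (inRegularClass_extremalCompl_mod hn).compl
  rwa [show n - 1 - 4 = n - 5 by omega] at this

theorem InRegularClass.extremal_cases_mod {n : ℕ} (hn : 5 ≤ n) (V : Type) [Fintype V]
    {F : SimpleGraph V} (h : InRegularClass 4 n F) :
    Nonempty (F ≃g extremalCompl (n % 5) (n / 5 - 1)) ∨
      adjSeq F 3 < adjSeq (extremalCompl (n % 5) (n / 5 - 1)) 3 ∨
      adjSeq F 3 = adjSeq (extremalCompl (n % 5) (n / 5 - 1)) 3 ∧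
        adjSeq (extremalCompl (n % 5) (n / 5 - 1)) 4 < adjSeq F 4 := by
  refine InRegularClass.extremal_cases (Nat.mod_lt n (by norm_num)) _ V ?_
  rwa [five_add_mod hn]

/-- An isomorphism of the complements is an isomorphism. -/
def isoOfCompl {V W : Type*} {G : SimpleGraph V} {H : SimpleGraph W} (e : Gᶜ ≃g H) :
    G ≃g Hᶜ where
  toEquiv := e.toEquiv
  map_rel_iff' {a b} := by
    have h1 : H.Adj (e a) (e b) ↔ Gᶜ.Adj a b := e.map_adj_iff
    rw [SimpleGraph.compl_adj]
    change e a ≠ e b ∧ ¬ H.Adj (e a) (e b) ↔ _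
    rw [h1, SimpleGraph.compl_adj, ne_eq, EmbeddingLike.apply_eq_iff_eq]
    have := @SimpleGraph.Adj.ne _ G a b
    tauto

/-- The first two traces agree by regularity, so `j` is 3 or 4. Equality below `j`, more than
`SeqLexLE` asks for, is what uniqueness needs. -/
theorem nonempty_iso_graphH_or_lt {n : ℕ} (hn : 5 ≤ n) (V : Type) [Fintype V] {G : SimpleGraph V}
    (h : InRegularClass (n - 5) n G) :
    Nonempty (G ≃g graphH n) ∨ ∃ j, 1 ≤ j ∧
      (∀ i, 1 ≤ i → i < j → adjSeq (graphH n) i = adjSeq G i) ∧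
        adjSeq (graphH n) j < adjSeq G j := by
  have hF : InRegularClass 4 n Gᶜ := by
    have := h.compl
    rwa [show n - 1 - (n - 5) = 4 by omega] at this
  have hE := inRegularClass_extremalCompl_mod hn
  obtain ⟨c₃, c₄, hc⟩ := exists_adjSeq_compl_three_four n 4
  obtain ⟨hG3, hG4⟩ := hc V _ hF
  obtain ⟨hE3, hE4⟩ := hc _ _ hE
  rw [compl_compl] at hG3 hG4
  rw [← graphH_eq_compl] at hE3 hE4
  have h1 : adjSeq (graphH n) 1 = adjSeq G 1 := by rw [adjSeq_one, adjSeq_one]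
  have h2 : adjSeq (graphH n) 2 = adjSeq G 2 := by
    rw [(inRegularClass_graphH hn).adjSeq_two, h.adjSeq_two]
  rcases hF.extremal_cases_mod hn V with he | h3 | ⟨h3, h4⟩
  · obtain ⟨e⟩ := he
    exact .inl ⟨isoOfCompl e⟩
  · refine .inr ⟨3, by norm_num, fun i hi hi' => ?_, by linarith⟩
    interval_cases i
    exacts [h1, h2]
  · refine .inr ⟨4, by norm_num, fun i hi hi' => ?_, by linarith⟩
    interval_cases i
    exacts [h1, h2, by linarith]

theorem isTraceMinimal_graphH {n : ℕ} (hn : 5 ≤ n) : IsTraceMinimal (n - 5) n (graphH n) := by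
  refine ⟨inRegularClass_graphH hn, fun H hH => ?_⟩
  rcases nonempty_iso_graphH_or_lt hn (Fin n) hH with he | ⟨j, h1, h2, h3⟩
  · obtain ⟨e⟩ := he
    exact .inl fun i _ => (adjSeq_iso e i).symm
  · exact .inr ⟨j, h1, fun i hi hij => (h2 i hi hij).le, h3⟩

/-- The graph `graphH n` transported to `Fin n`. -/
theorem exists_iso_graphH {n : ℕ} (hn : 5 ≤ n) :
    ∃ H : SimpleGraph (Fin n), Nonempty (H ≃g graphH n) := by
  have e := (Fintype.equivFinOfCardEq (inRegularClass_graphH hn).1).symm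
  exact ⟨(graphH n).comap e, ⟨SimpleGraph.Iso.comap e (graphH n)⟩⟩

theorem IsTraceMinimal.nonempty_iso_graphH {n : ℕ} (hn : 5 ≤ n) {G : SimpleGraph (Fin n)}
    (h : IsTraceMinimal (n - 5) n G) : Nonempty (G ≃g graphH n) := by
  obtain ⟨H, ⟨e⟩⟩ := exists_iso_graphH hn
  rcases nonempty_iso_graphH_or_lt hn (Fin n) h.1 with he | ⟨j, h1, h2, h3⟩
  · exact he
  · exfalso
    rcases h.2 H ((inRegularClass_graphH hn).of_iso e.symm) with h4 | ⟨i, hi, h5, h6⟩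
    · exact h3.not_ge ((h4 j h1).trans (adjSeq_iso e j)).le
    · rw [adjSeq_iso e] at h6
      rcases lt_trichotomy i j with hij | rfl | hij
      · exact h6.ne' (h2 i hi hij)
      · exact h3.not_gt h6
      · have := h5 j h1 hij
        rw [adjSeq_iso e] at this
        exact h3.not_ge this

end TraceMinimal

/-! ### Kirchhoff's matrix tree theorem. -/

section MatrixTree

open scoped Classical

/-- The tree with a given parent function. -/
def parentGraph {V : Type*} (r : V) (f : V → V) : SimpleGraph V :=
  SimpleGraph.fromRel fun a b => a ≠ r ∧ f a = b

theorem parentGraph_adj {V : Type*} {r : V} {f : V → V} {a b : V} :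
    (parentGraph r f).Adj a b ↔ a ≠ b ∧ ((a ≠ r ∧ f a = b) ∨ (b ≠ r ∧ f b = a)) :=
  SimpleGraph.fromRel_adj _ _ _

variable {V : Type*} [Fintype V]

/-- The polynomial det(1 - tM) is a unit of ℝ[t], hence constant, and its value at t = 0 is 1. -/
theorem Matrix.det_one_sub_of_isNilpotent {M : Matrix V V ℝ} (hM : IsNilpotent M) :
    (1 - M).det = 1 := by
  obtain ⟨c, -, hc⟩ := Polynomial.isUnit_iff.1 (Matrix.isUnit_charpolyRev_of_isNilpotent hM)
  have h0 : c = 1 := by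
    have := Matrix.eval_charpolyRev (M := M)
    rw [← hc, Polynomial.eval_C] at this
    exact this
  have h1 : (M.charpolyRev).eval 1 = (1 - M).det := by
    rw [Matrix.charpolyRev, ← Polynomial.coe_evalRingHom, RingHom.map_det]
    congr 1
    ext i j
    by_cases hij : i = j <;> simp [hij]
  rw [← h1, ← hc, h0, Polynomial.eval_C]

/-- The graph of a function fixing `r`, as a matrix, without the loop at `r`. -/
noncomputable def parentMatrix (r : V) (f : V → V) : Matrix V V ℝ :=
  Matrix.of fun v u => if v ≠ r ∧ f v = u then 1 else 0

theorem parentMatrix_mulVec (r : V) (f : V → V) (x : V → ℝ) (v : V) :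
    (parentMatrix r f).mulVec x v = if v = r then 0 else x (f v) := by
  by_cases h : v = r <;> simp [Matrix.mulVec, dotProduct, parentMatrix, h]

theorem isNilpotent_parentMatrix {r : V} {f : V → V} (hf : ∀ v, ∃ k, f^[k] v = r) :
    IsNilpotent (parentMatrix r f) := by
  have key : ∀ j v, f^[j] v = r → ∀ k, j < k → ∀ x : V → ℝ,
      ((parentMatrix r f) ^ k).mulVec x v = 0 := by
    intro j
    induction j with
    | zero =>
      intro v hv k hk x
      obtain ⟨k, rfl⟩ := Nat.exists_eq_succ_of_ne_zero hk.ne'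
      rw [pow_succ', ← Matrix.mulVec_mulVec, parentMatrix_mulVec, if_pos (show v = r from hv)]
    | succ j ih =>
      intro v hv k hk x
      obtain ⟨k, rfl⟩ := Nat.exists_eq_succ_of_ne_zero (Nat.ne_zero_of_lt hk)
      rw [pow_succ', ← Matrix.mulVec_mulVec, parentMatrix_mulVec]
      split_ifs
      · rfl
      · exact ih (f v) (by rwa [Function.iterate_succ_apply] at hv) k (by omega) x
  choose k hk using hf
  refine ⟨univ.sup k + 1, ?_⟩
  refine Matrix.ext_of_mulVec_single fun i => ?_
  ext v
  rw [key (k v) v (hk v) _ (Nat.lt_succ_of_le (le_sup (mem_univ v)))]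
  simp

/-- If every orbit reaches `r`, the parent matrix is nilpotent. Otherwise the indicator of the
vertices that never reach `r` is a nonzero kernel vector. -/
theorem det_one_sub_parentMatrix (r : V) (f : V → V) :
    (1 - parentMatrix r f).det = if ∀ v, ∃ k, f^[k] v = r then 1 else 0 := by
  split_ifs with hf
  · exact Matrix.det_one_sub_of_isNilpotent (isNilpotent_parentMatrix hf)
  · push Not at hf
    obtain ⟨v, hv⟩ := hf
    rw [← Matrix.exists_mulVec_eq_zero_iff]
    refine ⟨fun u => if ∃ k, f^[k] u = r then 0 else 1, ?_, ?_⟩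
    · intro h
      have := congrFun h v
      simp [hv] at this
    · ext u
      rw [Matrix.sub_mulVec, Matrix.one_mulVec, Pi.sub_apply, parentMatrix_mulVec, Pi.zero_apply]
      by_cases hu : u = r
      · have : ∃ k, f^[k] u = r := ⟨0, hu⟩
        rw [if_pos this, if_pos hu, sub_zero]
      · have : (∃ k, f^[k] u = r) ↔ ∃ k, f^[k] (f u) = r := by
          constructor
          · rintro ⟨k, hk⟩
            obtain ⟨k, rfl⟩ : ∃ j, k = j + 1 :=
              Nat.exists_eq_succ_of_ne_zero (by rintro rfl; exact hu hk)
            exact ⟨k, hk⟩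
          · rintro ⟨k, hk⟩
            exact ⟨k + 1, hk⟩
        simp [this, hu]

/-- The functions that assign to every vertex but the root `r` a neighbor, and whose iterates
reach the root. -/
noncomputable def parentFunctions (G : SimpleGraph V) (r : V) : Finset (V → V) :=
  univ.filter fun f => f r = r ∧ (∀ v, v ≠ r → G.Adj v (f v)) ∧ ∀ v, ∃ k, f^[k] v = r

/-- Row `v ≠ r` of the Laplacian is the sum of e_v - e_w over the neighbors `w`. Multilinear
expansion chooses one neighbor `f v` per row, and the resulting determinant is 1 or 0 according to
whether `f` leads to the root. -/
theorem det_updateRow_lapMatrix (G : SimpleGraph V) (r : V) :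
    ((G.lapMatrix ℝ).updateRow r (Pi.single r 1)).det = (parentFunctions G r).card := by
  set A : V → Finset V := fun v => if v = r then {r} else univ.filter fun w => G.Adj v w with hA
  set g : V → V → (V → ℝ) := fun v w =>
    if v = r then Pi.single r 1 else Pi.single v 1 - Pi.single w 1 with hg
  have hrow : (G.lapMatrix ℝ).updateRow r (Pi.single r 1) = Matrix.of fun v => ∑ w ∈ A v, g v w := by
    ext v u
    by_cases hv : v = r
    · subst hv
      simp [hA, hg]
    · rw [Matrix.updateRow_ne hv]
      simp only [SimpleGraph.lapMatrix, SimpleGraph.degMatrix, Matrix.sub_apply, Matrix.of_apply,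
        hA, hg, if_neg hv, Finset.sum_apply, Pi.sub_apply, sum_sub_distrib, sum_const, nsmul_eq_mul,
        SimpleGraph.adjMatrix_apply, Matrix.diagonal_apply, Pi.single_apply]
      have hd : (univ.filter fun w => G.Adj v w).card = G.degree v := by
        rw [← SimpleGraph.card_neighborFinset_eq_degree, SimpleGraph.neighborFinset_eq_filter]
      rw [hd]
      congr 1
      · by_cases h : v = u <;> simp [h, eq_comm]
      · simp
  rw [hrow]
  have hml := (Matrix.detRowAlternating (n := V) (R := ℝ)).toMultilinearMap.map_sum_finset
    (fun v w => g v w) A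
  have hml' : (Matrix.of fun v => ∑ w ∈ A v, g v w).det
      = ∑ f ∈ Fintype.piFinset A, (Matrix.of fun v => g v (f v)).det := hml
  rw [hml', parentFunctions, card_filter]
  push_cast
  rw [← sum_filter_add_sum_filter_not univ (fun f => f ∈ Fintype.piFinset A)]
  have hmemA : ∀ f, f ∈ Fintype.piFinset A ↔ f r = r ∧ ∀ v, v ≠ r → G.Adj v (f v) := by
    intro f
    rw [Fintype.mem_piFinset]
    constructor
    · intro h
      refine ⟨by simpa [hA] using h r, fun v hv => by simpa [hA, hv] using h v⟩
    · rintro ⟨h1, h2⟩ v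
      by_cases hv : v = r
      · subst hv; simp [hA, h1]
      · simp [hA, hv, h2 v hv]
  have h0 : ∑ f ∈ univ.filter (fun f => ¬ f ∈ Fintype.piFinset A),
      (if f r = r ∧ (∀ v, v ≠ r → G.Adj v (f v)) ∧ ∀ v, ∃ k, f^[k] v = r then (1 : ℝ) else 0)
      = 0 := by
    refine sum_eq_zero fun f hf => if_neg ?_
    simp only [mem_filter, mem_univ, true_and, hmemA] at hf
    tauto
  rw [h0, add_zero, filter_mem_eq_inter, univ_inter]
  refine sum_congr rfl fun f hf => ?_
  have hf' := (hmemA f).1 hf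
  have hM : (Matrix.of fun v => g v (f v)) = 1 - parentMatrix r f := by
    ext v u
    by_cases hv : v = r
    · subst hv
      simp [hg, parentMatrix, Matrix.one_apply, Pi.single_apply, eq_comm]
    · have hgv : g v (f v) = Pi.single v 1 - Pi.single (f v) 1 := if_neg hv
      simp only [hgv, Matrix.of_apply, Matrix.sub_apply, Pi.sub_apply, Pi.single_apply,
        Matrix.one_apply, parentMatrix, ne_eq, hv, not_false_eq_true, true_and, eq_comm (a := u)]
  rw [hM, det_one_sub_parentMatrix]
  simp only [hf'.1, true_and]
  congr 1
  simp only [eq_iff_iff]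
  exact ⟨fun h => ⟨hf'.2, h⟩, fun h => h.2⟩

/-- All vertices are joined to `r`, and there is at most one edge for each vertex other than `r`. -/
theorem isTree_parentGraph {r : V} {f : V → V} (h1 : ∀ v, v ≠ r → f v ≠ v)
    (h2 : ∀ v, ∃ k, f^[k] v = r) : (parentGraph r f).IsTree := by
  have hreach : ∀ k v, f^[k] v = r → (parentGraph r f).Reachable v r := by
    intro k
    induction k with
    | zero => rintro v rfl; exact SimpleGraph.Reachable.refl _
    | succ k ih =>
      intro v hv
      by_cases hvr : v = r
      · rw [hvr]
      · have hadj : (parentGraph r f).Adj v (f v) :=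
          parentGraph_adj.2 ⟨(h1 v hvr).symm, .inl ⟨hvr, rfl⟩⟩
        exact hadj.reachable.trans (ih (f v) hv)
  have hreach' : ∀ v, (parentGraph r f).Reachable v r := fun v => by
    obtain ⟨k, hk⟩ := h2 v
    exact hreach k v hk
  have hconn : (parentGraph r f).Connected :=
    { preconnected := fun a b => (hreach' a).trans (hreach' b).symm
      nonempty := ⟨r⟩ }
  rw [SimpleGraph.isTree_iff_connected_and_card]
  refine ⟨hconn, le_antisymm ?_ hconn.card_vert_le_card_edgeSet_add_one⟩
  have hsub : (parentGraph r f).edgeSet ⊆ (fun v => s(v, f v)) '' {v | v ≠ r} := by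
    intro e
    induction e using Sym2.ind with
    | _ a b =>
      rw [SimpleGraph.mem_edgeSet, parentGraph_adj]
      rintro ⟨-, ⟨h, rfl⟩ | ⟨h, rfl⟩⟩
      · exact ⟨a, h, rfl⟩
      · exact ⟨b, h, Sym2.eq_swap⟩
  have hle : (parentGraph r f).edgeSet.ncard ≤ {v | v ≠ r}.ncard :=
    (Set.ncard_le_ncard hsub (Set.toFinite _)).trans (Set.ncard_image_le (Set.toFinite _))
  have hc : {v | v ≠ r}.ncard + 1 = Nat.card V := by
    have := Set.ncard_add_ncard_compl ({r} : Set V)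
    rw [Set.ncard_singleton] at this
    rw [← this, add_comm]
    rfl
  rw [Nat.card_coe_set_eq, ← hc]
  omega

/-- Induction on the number of steps to the root. If `g` oriented the edge from `v` to `f v`
backwards, then `f` would swap its two ends and `v` would never reach `r`. -/
theorem parentGraph_injective {V : Type*} {r : V} {f g : V → V} (hfr : f r = r) (hgr : g r = r)
    (h1 : ∀ v, v ≠ r → f v ≠ v) (hf : ∀ v, ∃ k, f^[k] v = r)
    (h : parentGraph r f = parentGraph r g) : f = g := by
  have key : ∀ k v, f^[k] v = r → f v = g v := by
    intro k
    induction k with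
    | zero => rintro v rfl; exact hfr.trans hgr.symm
    | succ k ih =>
      intro v hv
      by_cases hvr : v = r
      · rw [hvr, hfr, hgr]
      · have hadj : (parentGraph r g).Adj v (f v) := by
          rw [← h]
          exact parentGraph_adj.2 ⟨(h1 v hvr).symm, .inl ⟨hvr, rfl⟩⟩
        rcases (parentGraph_adj.1 hadj).2 with h3 | h3
        · exact h3.2.symm
        · exfalso
          have h4 := ih (f v) hv
          rw [h3.2] at h4
          obtain ⟨j, hj⟩ := hf v
          have h5 : ∀ j, f^[j] v = v ∨ f^[j] v = f v := by
            intro j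
            induction j with
            | zero => exact .inl rfl
            | succ j ih =>
              rw [Function.iterate_succ_apply']
              rcases ih with ih | ih
              · rw [ih]; exact .inr rfl
              · rw [ih, h4]; exact .inl rfl
          rcases h5 j with h6 | h6
          · exact hvr (h6.symm.trans hj)
          · exact h3.1 (h6.symm.trans hj)
  ext v
  obtain ⟨k, hk⟩ := hf v
  exact key k v hk

/-- The parent of `v` is the next vertex on a shortest walk to `r`. The resulting tree lies in `T`
and has equally many edges. -/
theorem SimpleGraph.IsTree.exists_parentGraph_eq {T : SimpleGraph V} (hT : T.IsTree) (r : V) :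
    ∃ f : V → V, f r = r ∧ (∀ v, v ≠ r → T.Adj v (f v)) ∧ (∀ v, ∃ k, f^[k] v = r) ∧
      parentGraph r f = T := by
  have hex : ∀ v, ∃ w, (v = r → w = r) ∧ (v ≠ r → T.Adj v w ∧ T.dist w r < T.dist v r) := by
    intro v
    by_cases hv : v = r
    · exact ⟨r, fun _ => rfl, fun h => absurd hv h⟩
    · obtain ⟨p, hp⟩ := hT.connected.exists_walk_length_eq_dist v r
      cases p with
      | nil => exact absurd rfl hv
      | cons hadj q =>
        rename_i w
        refine ⟨w, fun h => absurd h hv, fun _ => ⟨hadj, ?_⟩⟩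
        rw [← hp, SimpleGraph.Walk.length_cons]
        exact Nat.lt_succ_of_le (SimpleGraph.dist_le q)
  choose f hf using hex
  have hreach : ∀ n v, T.dist v r ≤ n → ∃ k, f^[k] v = r := by
    intro n
    induction n with
    | zero =>
      intro v hv
      exact ⟨0, (hT.connected.dist_eq_zero_iff).1 (Nat.le_zero.1 hv)⟩
    | succ n ih =>
      intro v hv
      by_cases hvr : v = r
      · exact ⟨0, hvr⟩
      · obtain ⟨k, hk⟩ := ih (f v) (by have := ((hf v).2 hvr).2; omega)
        exact ⟨k + 1, hk⟩
  have hreach' : ∀ v, ∃ k, f^[k] v = r := fun v => hreach _ v le_rfl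
  refine ⟨f, (hf r).1 rfl, fun v hv => ((hf v).2 hv).1, hreach', ?_⟩
  have hle : parentGraph r f ≤ T := by
    intro a b hab
    rcases (parentGraph_adj.1 hab).2 with ⟨h1, rfl⟩ | ⟨h1, rfl⟩
    · exact ((hf a).2 h1).1
    · exact ((hf b).2 h1).1.symm
  have h1 := (SimpleGraph.isTree_iff_connected_and_card.1
    (isTree_parentGraph (fun v hv => ((hf v).2 hv).1.ne') hreach')).2
  have h2 := (SimpleGraph.isTree_iff_connected_and_card.1 hT).2
  have h3 : (parentGraph r f).edgeSet = T.edgeSet := by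
    refine Set.eq_of_subset_of_ncard_le (SimpleGraph.edgeSet_mono hle) ?_ (Set.toFinite _)
    rw [← Nat.card_coe_set_eq, ← Nat.card_coe_set_eq]
    omega
  exact SimpleGraph.edgeSet_injective h3

theorem card_parentFunctions (G : SimpleGraph V) (r : V) :
    (parentFunctions G r).card = spanningTreeCount G := by
  rw [spanningTreeCount, ← Set.ncard_coe_finset]
  refine Set.ncard_congr (fun f _ => parentGraph r f) ?_ ?_ ?_
  · intro f hf
    simp only [parentFunctions, coe_filter, mem_univ, true_and, Set.mem_ofPred_eq] at hf
    refine ⟨?_, isTree_parentGraph (fun v hv => (hf.2.1 v hv).ne') hf.2.2⟩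
    intro a b hab
    rcases (parentGraph_adj.1 hab).2 with ⟨h1, rfl⟩ | ⟨h1, rfl⟩
    · exact hf.2.1 a h1
    · exact (hf.2.1 b h1).symm
  · intro f g hf hg hfg
    simp only [parentFunctions, coe_filter, mem_univ, true_and, Set.mem_ofPred_eq] at hf hg
    exact parentGraph_injective hf.1 hg.1 (fun v hv => (hf.2.1 v hv).ne') hf.2.2 hfg
  · rintro T ⟨hTG, hT⟩
    obtain ⟨f, h1, h2, h3, h4⟩ := hT.exists_parentGraph_eq r
    refine ⟨f, ?_, h4⟩
    simp only [parentFunctions, coe_filter, mem_univ, true_and, Set.mem_ofPred_eq]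
    exact ⟨h1, fun v hv => hTG (h2 v hv), h3⟩

/-- Adding all rows of L + J to row `r` makes it n times the all-ones row, which then clears J from
the other rows. The cofactors along row `r` of L coincide, and summing them yields the second factor
n. -/
theorem det_lapMatrix_add_one (G : SimpleGraph V) (r : V) :
    (G.lapMatrix ℝ + Matrix.of fun _ _ => 1).det
      = (Fintype.card V : ℝ) ^ 2 * ((G.lapMatrix ℝ).updateRow r (Pi.single r 1)).det := by
  set L := G.lapMatrix ℝ with hL
  set n : ℝ := (Fintype.card V : ℝ) with hn
  have hrow : ∀ v, ∑ u, L v u = 0 := by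
    intro v
    have := congrFun (G.lapMatrix_mulVec_const_eq_zero (R := ℝ)) v
    simpa [Matrix.mulVec, dotProduct] using this
  have hcol : ∀ u, ∑ v, L v u = 0 := by
    intro u
    rw [← hrow u]
    exact sum_congr rfl fun v _ => (G.isSymm_lapMatrix (R := ℝ)).apply u v
  have h1 : (L + Matrix.of fun _ _ => 1).det
      = ((L + Matrix.of fun _ _ => 1).updateRow r (n • fun _ => 1)).det := by
    have := Matrix.det_updateRow_sum (L + Matrix.of fun _ _ => (1 : ℝ)) r fun _ => 1
    rw [one_smul] at this
    rw [← this]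
    congr 2
    ext u
    simp only [one_smul]
    refine (Finset.sum_apply u univ (fun v w => L v w + 1 : V → V → ℝ)).trans ?_
    simp [sum_add_distrib, hcol, hn]
  have h2 : ((L + Matrix.of fun _ _ => 1).updateRow r (fun _ => 1)).det
      = (L.updateRow r (fun _ => 1)).det := by
    refine Matrix.det_eq_of_forall_row_eq_smul_add_const (fun v => if v = r then 0 else 1) r
      (by simp) fun v u => ?_
    by_cases hv : v = r
    · subst hv; simp
    · simp [hv]
  have h3 : ∀ w, (L.updateRow r (Pi.single w 1)).det = (L.updateRow r (Pi.single r 1)).det := by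
    intro w
    have h4 : (L.updateRow r (Pi.single w 1 - Pi.single r 1)).det = 0 := by
      rw [← Matrix.exists_mulVec_eq_zero_iff]
      refine ⟨fun _ => 1, fun h => one_ne_zero (congrFun h r), ?_⟩
      ext v
      by_cases hv : v = r
      · subst hv
        simp [Matrix.mulVec, dotProduct]
      · simp [Matrix.mulVec, dotProduct, Matrix.updateRow_ne hv, hrow]
    have h5 : (Pi.single w 1 : V → ℝ) = (Pi.single w 1 - Pi.single r 1) + Pi.single r 1 := by simp
    rw [h5, Matrix.det_updateRow_add, h4, zero_add]
  have h6 : (L.updateRow r (fun _ => 1)).det = n * (L.updateRow r (Pi.single r 1)).det := by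
    have h7 : (fun _ => 1 : V → ℝ) = ∑ w, Pi.single w (1 : ℝ) := by
      ext u; simp [Finset.sum_apply, Pi.single_apply]
    have h8 : ∀ s : Finset V, (L.updateRow r (∑ w ∈ s, Pi.single w (1 : ℝ))).det
        = s.card * (L.updateRow r (Pi.single r 1)).det := by
      intro s
      induction s using Finset.induction_on with
      | empty =>
        rw [sum_empty, card_empty, Nat.cast_zero, zero_mul]
        exact Matrix.det_eq_zero_of_row_eq_zero r fun j => by simp
      | insert a s ha ih =>
        rw [sum_insert ha, Matrix.det_updateRow_add, ih, h3, card_insert_of_notMem ha]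
        push_cast; ring
    rw [h7, h8, card_univ]
  rw [h1, Matrix.det_updateRow_smul, h2, h6]
  ring

theorem lapMatrix_add_one_eq (G : SimpleGraph V) :
    G.lapMatrix ℝ + Matrix.of (fun _ _ => 1)
      = (Fintype.card V : ℝ) • (1 : Matrix V V ℝ) - Gᶜ.lapMatrix ℝ := by
  ext a b
  have hdeg : (G.degree a : ℝ) + Gᶜ.degree a + 1 = Fintype.card V := by
    have := SimpleGraph.degree_compl G a
    have h2 := G.degree_lt_card_verts a
    have h3 : Gᶜ.degree a + G.degree a + 1 = Fintype.card V := by omega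
    rw [← h3]; push_cast; ring
  simp only [SimpleGraph.lapMatrix, SimpleGraph.degMatrix, Matrix.sub_apply, Matrix.add_apply,
    Matrix.of_apply, Matrix.smul_apply, Matrix.diagonal_apply, Matrix.one_apply,
    SimpleGraph.adjMatrix_apply, SimpleGraph.compl_adj, smul_eq_mul]
  by_cases hab : a = b
  · subst hab
    simp
    linarith
  · by_cases h : G.Adj a b <;> simp [hab, h]

/-- Kirchhoff's theorem, in terms of the Laplacian matrix of the complement. -/
theorem card_sq_mul_spanningTreeCount [Nonempty V] (G : SimpleGraph V) :
    (Fintype.card V : ℝ) ^ 2 * spanningTreeCount G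
      = ((Fintype.card V : ℝ) • (1 : Matrix V V ℝ) - Gᶜ.lapMatrix ℝ).det := by
  obtain ⟨r⟩ := ‹Nonempty V›
  have h := det_lapMatrix_add_one G r
  rw [det_updateRow_lapMatrix, card_parentFunctions] at h
  rw [← h, lapMatrix_add_one_eq]

end MatrixTree

/-! ### Comparison of products through power sums. -/

section PowerSums

theorem Real.log_one_sub_le_neg_sum {x : ℝ} (h0 : 0 ≤ x) (h1 : x < 1) :
    Real.log (1 - x) ≤ -(x + x ^ 2 / 2 + x ^ 3 / 3 + x ^ 4 / 4 + x ^ 5 / 5) := by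
  have h := Real.hasSum_pow_div_log_of_abs_lt_one (x := x) (by rwa [abs_of_nonneg h0])
  have h2 := sum_le_hasSum (range 5) (fun i _ => by positivity) h
  simp only [sum_range_succ, sum_range_zero] at h2
  norm_num at h2
  linarith

theorem Real.neg_sum_le_log_one_sub {x : ℝ} (h0 : 0 ≤ x) (h1 : x ≤ 1 / 2) :
    -(x + x ^ 2 / 2 + x ^ 3 / 3 + x ^ 4 / 4 + x ^ 5 / 5) - 2 * x ^ 6 ≤ Real.log (1 - x) := by
  have h := Real.abs_log_sub_add_sum_range_le (x := x) (by rw [abs_of_nonneg h0]; linarith) 5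
  rw [abs_of_nonneg h0] at h
  have h2 : x ^ (5 + 1) / (1 - x) ≤ 2 * x ^ 6 := by
    rw [div_le_iff₀ (by linarith)]
    have : 0 ≤ x ^ 6 := by positivity
    norm_num
    nlinarith
  have h3 := (abs_le.1 (h.trans h2)).1
  simp only [sum_range_succ, sum_range_zero] at h3
  norm_num at h3
  linarith

/-- Here z = 1/n. Inserting S₂ ≥ 20n in the lower bounds gives Tₖ - Sₖ ≤ C for k = 3, 4, 5. The
threshold on `n` makes zC ≤ 1/10 and 12500z ≤ 1/20, so the left side is at most (1/50 + 3/25) z⁴,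
while a gap of 1 in the first differing power sum leaves at least z⁴/4 on the right. -/
theorem power_sum_comparison {n C z S2 S3 S4 S5 T2 T3 T4 T5 T6 : ℝ} (hC : 0 ≤ C) (hz0 : 0 < z)
    (hzn : z * n = 1) (hn : 250000 + 10 * C ≤ n)
    (s2 : 20 * n ≤ S2) (s3 : 10 * S2 - 25 * (4 * n) ≤ S3) (s4 : 75 * S2 - 250 * (4 * n) ≤ S4)
    (s5 : 500 * S2 - 1875 * (4 * n) ≤ S5)
    (t3 : T3 ≤ 100 * n + C) (t4 : T4 ≤ 500 * n + C) (t5 : T5 ≤ 2500 * n + C)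
    (t6 : T6 ≤ 12500 * n + C)
    (h : T2 + 1 ≤ S2 ∨ T2 = S2 ∧ T3 + 1 ≤ S3 ∨ T2 = S2 ∧ T3 = S3 ∧ T4 + 1 ≤ S4) :
    z ^ 5 / 5 * (T5 - S5) + 2 * (z ^ 6 * T6) < z ^ 2 / 2 * (S2 - T2) + z ^ 3 / 3 * (S3 - T3)
      + z ^ 4 / 4 * (S4 - T4) := by
  have hzC0 : 0 ≤ z * C := mul_nonneg hz0.le hC
  have h0 := mul_le_mul_of_nonneg_left hn hz0.le
  rw [hzn] at h0
  have hzC : 10 * (z * C) ≤ 1 := by linarith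
  have hz1 : 250000 * z ≤ 1 := by linarith
  have k2 := pow_pos hz0 2
  have k3 := pow_pos hz0 3
  have k4 := pow_pos hz0 4
  have k5 := pow_pos hz0 5
  have k6 := pow_pos hz0 6
  have hz2 := mul_le_mul_of_nonneg_left hz1 k2.le
  have hz3 := mul_le_mul_of_nonneg_left hz1 k3.le
  have c3 := mul_le_mul_of_nonneg_left hzC k2.le
  have c4 := mul_le_mul_of_nonneg_left hzC k3.le
  have c5 := mul_le_mul_of_nonneg_left hzC k4.le
  have d3 : z ^ 3 * (T3 - S3) ≤ z ^ 3 * C := mul_le_mul_of_nonneg_left (by linarith) k3.le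
  have d4 : z ^ 4 * (T4 - S4) ≤ z ^ 4 * C := mul_le_mul_of_nonneg_left (by linarith) k4.le
  have d5 : z ^ 5 * (T5 - S5) ≤ z ^ 5 * C := mul_le_mul_of_nonneg_left (by linarith) k5.le
  have d6 : z ^ 6 * T6 ≤ z ^ 4 * (3 / 50) := by
    have h1 : z ^ 6 * T6 ≤ z ^ 6 * (12500 * n + C) := mul_le_mul_of_nonneg_left t6 k6.le
    have h2 : z ^ 6 * (12500 * n + C) = z ^ 4 * (12500 * z * (z * n) + z * (z * C)) := by ring
    have h3 : 12500 * z * (z * n) + z * (z * C) ≤ 3 / 50 := by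
      rw [hzn]
      have := mul_le_mul_of_nonneg_left hzC hz0.le
      linarith
    rw [h2] at h1
    exact h1.trans (mul_le_mul_of_nonneg_left h3 k4.le)
  suffices z ^ 4 / 4 ≤ z ^ 2 / 2 * (S2 - T2) + z ^ 3 / 3 * (S3 - T3) + z ^ 4 / 4 * (S4 - T4) by
    linarith
  rcases h with h | ⟨h2, h⟩ | ⟨h2, h3, h⟩
  · have := mul_le_mul_of_nonneg_left (by linarith : 1 ≤ S2 - T2) k2.le
    linarith
  · have := mul_le_mul_of_nonneg_left (by linarith : 1 ≤ S3 - T3) k3.le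
    rw [h2, sub_self, mul_zero]
    linarith
  · have := mul_le_mul_of_nonneg_left (by linarith : 1 ≤ S4 - T4) k4.le
    rw [h2, h3, sub_self, sub_self, mul_zero, mul_zero]
    linarith

/-- Among nonnegative families with given first power sums, the product `∏ (n - x i)` is ruled by
the first power sum that exceeds its counterpart. -/
theorem prod_sub_lt_prod_sub {V W : Type*} [Fintype V] [Fintype W] {n : ℕ} {C : ℝ}
    (hC : 0 ≤ C) (hn : 250000 + 10 * C ≤ n) (hV : Fintype.card V = n) (hW : Fintype.card W = n)
    {x : V → ℝ} {y : W → ℝ} (hx : ∀ i, 0 ≤ x i) (hxn : ∀ i, x i ≤ n) (hy : ∀ i, 0 ≤ y i)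
    (hx1 : ∑ i, x i = 4 * n) (hx2 : 20 * n ≤ ∑ i, x i ^ 2)
    (hy1 : ∑ i, y i = 4 * n) (hy2 : ∑ i, y i ^ 2 = 20 * n)
    (hyC : ∀ k ∈ Icc 3 6, ∑ i, y i ^ k ≤ 4 * n * 5 ^ (k - 1) + C)
    (h : ∑ i, y i ^ 2 + 1 ≤ ∑ i, x i ^ 2 ∨
      ∑ i, y i ^ 2 = ∑ i, x i ^ 2 ∧ ∑ i, y i ^ 3 + 1 ≤ ∑ i, x i ^ 3 ∨
      ∑ i, y i ^ 2 = ∑ i, x i ^ 2 ∧ ∑ i, y i ^ 3 = ∑ i, x i ^ 3 ∧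
        ∑ i, y i ^ 4 + 1 ≤ ∑ i, x i ^ 4) :
    ∏ i, ((n : ℝ) - x i) < ∏ i, ((n : ℝ) - y i) := by
  have hn0 : (0 : ℝ) < n := by linarith
  have hyn : ∀ i, y i ≤ n / 2 := by
    intro i
    have h1 : y i ^ 2 ≤ 20 * n := by
      rw [← hy2]
      exact single_le_sum (f := fun i => y i ^ 2) (fun j _ => sq_nonneg _) (mem_univ i)
    by_contra! h2
    have h3 := hy i
    nlinarith
  have hypos : ∀ i, 0 < (n : ℝ) - y i := fun i => by have := hyn i; linarith
  have hprod : 0 < ∏ i, ((n : ℝ) - y i) := prod_pos fun i _ => hypos i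
  -- A vanishing factor, for which no logarithm is available, settles the claim at once.
  by_cases hxlt : ∃ i, x i = n
  · obtain ⟨i, hi⟩ := hxlt
    rw [prod_eq_zero (mem_univ i) (by rw [hi, sub_self])]
    exact hprod
  push Not at hxlt
  have hxlt' : ∀ i, x i < n := fun i => lt_of_le_of_ne (hxn i) (hxlt i)
  have hxpos : ∀ i, 0 < (n : ℝ) - x i := fun i => sub_pos.2 (hxlt' i)
  have hxprod : 0 < ∏ i, ((n : ℝ) - x i) := prod_pos fun i _ => hxpos i
  rw [← Real.log_lt_log_iff hxprod hprod, Real.log_prod (fun i _ => (hxpos i).ne'),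
    Real.log_prod (fun i _ => (hypos i).ne')]
  set z : ℝ := (n : ℝ)⁻¹ with hz
  have hz0 : 0 < z := inv_pos.2 hn0
  have hzn : z * n = 1 := inv_mul_cancel₀ hn0.ne'
  have hxlog : ∀ i, Real.log (n - x i) ≤ Real.log n
      - (z * x i + z ^ 2 / 2 * x i ^ 2 + z ^ 3 / 3 * x i ^ 3 + z ^ 4 / 4 * x i ^ 4
        + z ^ 5 / 5 * x i ^ 5) := by
    intro i
    have h1 : (n : ℝ) - x i = n * (1 - z * x i) := by linear_combination x i * hzn
    have h2 : z * x i < 1 := by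
      rw [← hzn]; exact mul_lt_mul_of_pos_left (hxlt' i) hz0
    have h3 := Real.log_one_sub_le_neg_sum (mul_nonneg hz0.le (hx i)) h2
    rw [h1, Real.log_mul hn0.ne' (by linarith)]
    simp only [mul_pow] at h3
    linarith
  have hylog : ∀ i, Real.log n
      - (z * y i + z ^ 2 / 2 * y i ^ 2 + z ^ 3 / 3 * y i ^ 3 + z ^ 4 / 4 * y i ^ 4
        + z ^ 5 / 5 * y i ^ 5) - 2 * z ^ 6 * y i ^ 6 ≤ Real.log (n - y i) := by
    intro i
    have h1 : (n : ℝ) - y i = n * (1 - z * y i) := by linear_combination y i * hzn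
    have h2 : z * y i ≤ 1 / 2 := by
      calc z * y i ≤ z * (n / 2) := mul_le_mul_of_nonneg_left (hyn i) hz0.le
        _ = 1 / 2 := by rw [← mul_div_assoc, hzn]
    have h3 := Real.neg_sum_le_log_one_sub (mul_nonneg hz0.le (hy i)) h2
    rw [h1, Real.log_mul hn0.ne' (by linarith)]
    simp only [mul_pow] at h3
    linarith
  have hxs := sum_le_sum fun i (_ : i ∈ univ) => hxlog i
  have hys := sum_le_sum fun i (_ : i ∈ univ) => hylog i
  simp only [sum_sub_distrib, sum_add_distrib, ← mul_sum, sum_const, card_univ, hV, hW] at hxs hys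
  -- These three bounds vanish to second order at 5 and to first order at 0, the Laplacian
  -- eigenvalues of K₅: x(x-5)² times 1, x+10 and x²+10x+75 is nonnegative.
  have e3 : 10 * ∑ i, x i ^ 2 - 25 * ∑ i, x i ≤ ∑ i, x i ^ 3 := by
    rw [mul_sum, mul_sum, ← sum_sub_distrib]
    refine sum_le_sum fun i _ => ?_
    have := mul_nonneg (hx i) (sq_nonneg (x i - 5))
    linarith
  have e4 : 75 * ∑ i, x i ^ 2 - 250 * ∑ i, x i ≤ ∑ i, x i ^ 4 := by
    rw [mul_sum, mul_sum, ← sum_sub_distrib]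
    refine sum_le_sum fun i _ => ?_
    have := mul_nonneg (mul_nonneg (hx i) (sq_nonneg (x i - 5))) (by linarith [hx i] : 0 ≤ x i + 10)
    linarith
  have e5 : 500 * ∑ i, x i ^ 2 - 1875 * ∑ i, x i ≤ ∑ i, x i ^ 5 := by
    rw [mul_sum, mul_sum, ← sum_sub_distrib]
    refine sum_le_sum fun i _ => ?_
    have := mul_nonneg (mul_nonneg (hx i) (sq_nonneg (x i - 5)))
      (by nlinarith [hx i] : 0 ≤ x i ^ 2 + 10 * x i + 75)
    linarith
  have f3 := hyC 3 (by simp)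
  have f4 := hyC 4 (by simp)
  have f5 := hyC 5 (by simp)
  have f6 := hyC 6 (by simp)
  norm_num at f3 f4 f5 f6
  rw [hx1] at hxs e3 e4 e5
  rw [hy1] at hys
  have := power_sum_comparison hC hz0 hzn hn hx2 e3 e4 e5 (by linarith) (by linarith)
    (T5 := ∑ i, y i ^ 5) (by linarith) (T6 := ∑ i, y i ^ 6) (by linarith) h
  linarith

end PowerSums

/-! ### Laplacian eigenvalues and their power sums. -/

section Spectrum

open scoped Classical

variable {V : Type*} [Fintype V]

theorem Matrix.IsHermitian.trace_pow_eq_sum {A : Matrix V V ℝ} (hA : A.IsHermitian) (k : ℕ) :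
    Matrix.trace (A ^ k) = ∑ i, hA.eigenvalues i ^ k := by
  conv_lhs => rw [hA.spectral_theorem, ← map_pow, Unitary.conjStarAlgAut_apply,
    Matrix.trace_mul_cycle, Unitary.coe_star_mul_self, one_mul, Matrix.diagonal_pow,
    Matrix.trace_diagonal]
  simp

theorem Matrix.IsHermitian.det_smul_one_sub {A : Matrix V V ℝ} (hA : A.IsHermitian) (t : ℝ) :
    (t • (1 : Matrix V V ℝ) - A).det = ∏ i, (t - hA.eigenvalues i) := by
  have h := Matrix.eval_charpoly A t
  rw [hA.charpoly_eq, Polynomial.eval_prod] at h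
  rw [Matrix.smul_one_eq_diagonal, ← Matrix.scalar_apply, ← h]
  simp

theorem Matrix.IsHermitian.eigenvalues_le {A : Matrix V V ℝ} (hA : A.IsHermitian) {t : ℝ}
    (h : (t • (1 : Matrix V V ℝ) - A).PosSemidef) (i : V) : hA.eigenvalues i ≤ t := by
  have h1 := h.dotProduct_mulVec_nonneg (hA.eigenvectorBasis i)
  rw [Matrix.sub_mulVec, Matrix.smul_mulVec, Matrix.one_mulVec, hA.mulVec_eigenvectorBasis,
    ← sub_smul, dotProduct_smul, dotProduct_comm, ← EuclideanSpace.inner_eq_star_dotProduct,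
    inner_self_eq_norm_sq_to_K, hA.eigenvectorBasis.orthonormal.1 i] at h1
  simpa using h1

theorem lapMatrix_compl_compl (F : SimpleGraph V) {inst : DecidableRel Fᶜᶜ.Adj} :
    Fᶜᶜ.lapMatrix ℝ = F.lapMatrix ℝ := by
  congr!
  exact compl_compl F

theorem posSemidef_of_one : (Matrix.of fun _ _ : V => (1 : ℝ)).PosSemidef := by
  have h1 : Matrix.of (fun _ _ : V => (1 : ℝ))
      = Matrix.vecMulVec (fun _ => 1) (star fun _ => (1 : ℝ)) := by
    ext i j
    simp [Matrix.vecMulVec]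
  rw [h1]
  exact Matrix.posSemidef_vecMulVec_self_star _

theorem posSemidef_card_smul_one_sub_lapMatrix (F : SimpleGraph V) :
    ((Fintype.card V : ℝ) • (1 : Matrix V V ℝ) - F.lapMatrix ℝ).PosSemidef := by
  have hL : ∀ (G : SimpleGraph V) {inst : DecidableRel G.Adj}, (G.lapMatrix ℝ).PosSemidef :=
    fun G => SimpleGraph.posSemidef_lapMatrix ℝ G
  have h := lapMatrix_add_one_eq Fᶜ
  rw [lapMatrix_compl_compl] at h
  rw [← h]
  exact (hL _).add posSemidef_of_one

/-- The traces of the powers of the Laplacian matrix. -/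
noncomputable def lapSeq (F : SimpleGraph V) (k : ℕ) : ℝ :=
  Matrix.trace (F.lapMatrix ℝ ^ k)

/-- The spanning trees of a graph are counted by the Laplacian eigenvalues of its complement. -/
theorem exists_eigenvalues_lapMatrix [Nonempty V] (F : SimpleGraph V) :
    ∃ x : V → ℝ, (∀ i, 0 ≤ x i) ∧ (∀ i, x i ≤ Fintype.card V) ∧
      (Fintype.card V : ℝ) ^ 2 * spanningTreeCount Fᶜ = ∏ i, ((Fintype.card V : ℝ) - x i) ∧
      ∀ k, lapSeq F k = ∑ i, x i ^ k := by
  have hL := SimpleGraph.posSemidef_lapMatrix ℝ F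
  refine ⟨hL.1.eigenvalues, hL.eigenvalues_nonneg,
    hL.1.eigenvalues_le (posSemidef_card_smul_one_sub_lapMatrix F), ?_, hL.1.trace_pow_eq_sum⟩
  rw [card_sq_mul_spanningTreeCount, lapMatrix_compl_compl, hL.1.det_smul_one_sub]

theorem lapSeq_two (F : SimpleGraph V) :
    lapSeq F 2 = ∑ v, ((F.degree v : ℝ) ^ 2 + F.degree v) := by
  rw [lapSeq, Matrix.trace]
  refine sum_congr rfl fun v _ => ?_
  have h : ∀ w, F.lapMatrix ℝ v w * F.lapMatrix ℝ w v
      = (if w = v then (F.degree v : ℝ) ^ 2 else 0) + if F.Adj v w then 1 else 0 := by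
    intro w
    by_cases hw : w = v
    · subst hw
      simp [SimpleGraph.lapMatrix, SimpleGraph.degMatrix, pow_two]
    · by_cases ha : F.Adj v w
      · simp [SimpleGraph.lapMatrix, SimpleGraph.degMatrix, hw, Ne.symm hw, ha, ha.symm]
      · have ha' : ¬ F.Adj w v := fun h => ha h.symm
        simp [SimpleGraph.lapMatrix, SimpleGraph.degMatrix, hw, Ne.symm hw, ha, ha']
  rw [Matrix.diag_apply, pow_two, Matrix.mul_apply, sum_congr rfl fun w _ => h w, sum_add_distrib,
    sum_ite_eq' univ v, if_pos (mem_univ v), ← SimpleGraph.card_neighborFinset_eq_degree,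
    SimpleGraph.neighborFinset_eq_filter, sum_boole]

theorem lapSeq_one (F : SimpleGraph V) :
    lapSeq F 1 = ∑ v, (F.degree v : ℝ) := by
  rw [lapSeq, pow_one, Matrix.trace]
  refine sum_congr rfl fun v _ => ?_
  simp [SimpleGraph.lapMatrix, SimpleGraph.degMatrix]

theorem InRegularClass.lapSeq_eq {d n : ℕ} {F : SimpleGraph V} (h : InRegularClass d n F)
    (k : ℕ) : lapSeq F k
      = ∑ j ∈ range (k + 1), (-1) ^ j * (d : ℝ) ^ (k - j) * k.choose j * adjSeq F j := by
  have hL : F.lapMatrix ℝ = (-1 : ℝ) • F.adjMatrix ℝ + (d : ℝ) • (1 : Matrix V V ℝ) := by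
    ext a b
    simp only [SimpleGraph.lapMatrix, SimpleGraph.degMatrix, h.2 _, Matrix.smul_apply,
      Matrix.add_apply, Matrix.sub_apply, Matrix.diagonal_apply, Matrix.one_apply, smul_eq_mul]
    split_ifs <;> ring
  have hc : Commute ((-1 : ℝ) • F.adjMatrix ℝ) ((d : ℝ) • (1 : Matrix V V ℝ)) :=
    ((Commute.one_right _).smul_right _).smul_left _
  rw [lapSeq, hL, hc.add_pow, Matrix.trace_sum]
  refine sum_congr rfl fun j _ => ?_
  rw [smul_pow, smul_pow, one_pow, Matrix.mul_smul, mul_one, ← nsmul_eq_mul', smul_smul,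
    Matrix.trace_smul, Matrix.trace_smul, adjSeq, nsmul_eq_mul, smul_eq_mul]
  ring

theorem lapSeq_top (k : ℕ) : lapSeq (⊤ : SimpleGraph V) (k + 1)
    = (Fintype.card V : ℝ) ^ k * (Fintype.card V * (Fintype.card V - 1)) := by
  set n : ℝ := (Fintype.card V : ℝ) with hn
  set J : Matrix V V ℝ := Matrix.of fun _ _ => 1 with hJ
  have hL : (⊤ : SimpleGraph V).lapMatrix ℝ = n • (1 : Matrix V V ℝ) - J := by
    ext a b
    by_cases h : a = b
    · subst h
      have : ((Fintype.card V - 1 : ℕ) : ℝ) = n - 1 := by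
        rw [Nat.cast_sub (Fintype.card_pos_iff.2 ⟨a⟩), Nat.cast_one]
      simp [hJ, SimpleGraph.lapMatrix, SimpleGraph.degMatrix, this]
    · simp [hJ, SimpleGraph.lapMatrix, SimpleGraph.degMatrix, h]
  have hJJ : J * J = n • J := by
    ext a b
    simp [hJ, Matrix.mul_apply, hn]
  have hLL : ∀ k, (n • (1 : Matrix V V ℝ) - J) ^ (k + 1)
      = n ^ k • (n • (1 : Matrix V V ℝ) - J) := by
    intro k
    induction k with
    | zero => simp
    | succ k ih =>
      rw [pow_succ, ih, smul_mul_assoc, sub_mul, mul_sub, mul_sub, hJJ]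
      simp only [smul_mul_assoc, mul_smul_comm, one_mul, mul_one]
      module
  have hpow : lapSeq (⊤ : SimpleGraph V) (k + 1)
      = Matrix.trace ((n • (1 : Matrix V V ℝ) - J) ^ (k + 1)) := by
    rw [← hL]
    unfold lapSeq
    congr!
  rw [hpow, hLL, Matrix.trace_smul, Matrix.trace_sub, Matrix.trace_smul, Matrix.trace_one]
  simp only [Matrix.trace, hJ, Matrix.diag_apply, Matrix.of_apply, sum_const, card_univ,
    nsmul_eq_mul, smul_eq_mul, ← hn]
  ring

end Spectrum

/-! ### Optimality for large n. -/

section Optimality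

open scoped Classical

theorem spanningTreeCount_le_of_iso {V W : Type*} [Finite W] {G : SimpleGraph V}
    {H : SimpleGraph W} (e : G ≃g H) : spanningTreeCount G ≤ spanningTreeCount H := by
  refine Set.ncard_le_ncard_of_injOn (fun T => T.comap e.symm) ?_ ?_ (Set.toFinite _)
  · rintro T ⟨hT, hT'⟩
    refine ⟨fun a b hab => ?_, ?_⟩
    · exact e.symm.map_adj_iff.1 (hT hab)
    · exact (SimpleGraph.Iso.comap e.symm.toEquiv T).isTree_iff.2 hT'
  · intro S _ T _ hST
    ext a b
    have := congrArg (fun K : SimpleGraph W => K.Adj (e a) (e b)) hST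
    simpa using this

/-- Each K₅ has the Laplacian eigenvalue 5 four times and thus contributes 4 · 5^(k+1). -/
theorem lapSeq_extremalCompl {ρ : ℕ} (hρ : ρ < 5) (m k : ℕ) :
    lapSeq (extremalCompl ρ m) (k + 1) = lapSeq (extremalCompl ρ 0) (k + 1) + m * (5 ^ k * 20) := by
  induction m with
  | zero => simp
  | succ m ih =>
    have h1 : lapSeq (extremalCompl ρ (m + 1)) (k + 1) = lapSeq (extremalCompl ρ m) (k + 1)
        + lapSeq (⊤ : SimpleGraph (Fin 5)) (k + 1) := by
      rw [(inRegularClass_extremalCompl hρ (m + 1)).lapSeq_eq,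
        (inRegularClass_extremalCompl hρ m).lapSeq_eq, inRegularClass_top.lapSeq_eq,
        ← sum_add_distrib]
      exact sum_congr rfl fun j _ => by rw [adjSeq_extremalCompl_succ, mul_add]
    rw [h1, ih, lapSeq_top, Fintype.card_fin]
    push_cast
    ring

/-- Only the block on 5 + ρ vertices deviates from K₅ components. Five residues and four exponents
make the error bounded independently of `n`. -/
theorem exists_lapSeq_extremalCompl_le : ∃ C : ℝ, 0 ≤ C ∧ ∀ n : ℕ, 5 ≤ n → ∀ k ∈ Icc 3 6,
    lapSeq (extremalCompl (n % 5) (n / 5 - 1)) k ≤ 4 * n * 5 ^ (k - 1) + C := by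
  refine ⟨∑ ρ ∈ range 5, ∑ k ∈ Icc 3 6, |lapSeq (extremalCompl ρ 0) k|,
    sum_nonneg fun _ _ => sum_nonneg fun _ _ => abs_nonneg _, fun n hn k hk => ?_⟩
  have hρ : n % 5 < 5 := Nat.mod_lt n (by norm_num)
  have h1 : |lapSeq (extremalCompl (n % 5) 0) k|
      ≤ ∑ ρ ∈ range 5, ∑ k ∈ Icc 3 6, |lapSeq (extremalCompl ρ 0) k| :=
    (single_le_sum (f := fun k => |lapSeq (extremalCompl (n % 5) 0) k|)
      (fun _ _ => abs_nonneg _) hk).trans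
    (single_le_sum (f := fun ρ => ∑ k ∈ Icc 3 6, |lapSeq (extremalCompl ρ 0) k|)
      (fun _ _ => sum_nonneg fun _ _ => abs_nonneg _) (mem_range.2 hρ))
  obtain ⟨j, rfl⟩ : ∃ j, k = j + 1 := ⟨k - 1, by have := (mem_Icc.1 hk).1; omega⟩
  have h2 := (le_abs_self _).trans h1
  rw [lapSeq_extremalCompl hρ, Nat.add_sub_cancel]
  have h3 : ((n / 5 - 1 : ℕ) : ℝ) * 5 ≤ n := by
    have : (n / 5 - 1) * 5 ≤ n := by omega
    exact_mod_cast this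
  have h4 := mul_le_mul_of_nonneg_left h3 (by positivity : (0 : ℝ) ≤ 5 ^ j)
  linarith

variable {V : Type*} [Fintype V]

theorem sum_degree_eq_two_mul_ncard (G : SimpleGraph V) :
    ∑ v, G.degree v = 2 * G.edgeSet.ncard := by
  have := G.sum_degrees_eq_twice_card_edges
  rwa [← Set.ncard_coe_finset, SimpleGraph.coe_edgeFinset] at this

theorem InRegularClass.two_mul_ncard_edgeSet {d n : ℕ} {G : SimpleGraph V}
    (h : InRegularClass d n G) : 2 * G.edgeSet.ncard = n * d := by
  rw [← sum_degree_eq_two_mul_ncard, sum_congr rfl fun v _ => h.2 v, sum_const, card_univ, h.1,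
    smul_eq_mul]

theorem lapSeq_compl_one (G : SimpleGraph V) : lapSeq Gᶜ 1
    = Fintype.card V * (Fintype.card V - 1 : ℝ) - ((2 * G.edgeSet.ncard : ℕ) : ℝ) := by
  have h2 : ∀ v {inst : Fintype (Gᶜ.neighborSet v)},
      (Gᶜ.degree v : ℝ) = (Fintype.card V - 1 : ℝ) - G.degree v := by
    intro v _
    have h3 := SimpleGraph.degree_compl G v
    have h4 := G.degree_lt_card_verts v
    have h5 : Gᶜ.degree v + G.degree v + 1 = Fintype.card V := by omega
    rw [← h5]
    push_cast
    ring
  rw [lapSeq_one]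
  trans ∑ v, ((Fintype.card V - 1 : ℝ) - G.degree v)
  · refine sum_congr rfl fun v _ => ?_
    rw [h2]
  rw [sum_sub_distrib, ← sum_degree_eq_two_mul_ncard,
    sum_const, card_univ, nsmul_eq_mul, Nat.cast_sum]

theorem InRegularClass.lapSeq_one {d n : ℕ} {F : SimpleGraph V} (h : InRegularClass d n F) :
    lapSeq F 1 = d * n := by
  rw [_root_.lapSeq_one, sum_congr rfl fun v _ => by rw [h.2 v], sum_const, card_univ, h.1,
    nsmul_eq_mul, mul_comm]

theorem InRegularClass.lapSeq_two {n : ℕ} {F : SimpleGraph V} (h : InRegularClass 4 n F) :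
    lapSeq F 2 = 20 * n := by
  rw [_root_.lapSeq_two, sum_congr rfl fun v _ => by rw [h.2 v], sum_const, card_univ, h.1,
    nsmul_eq_mul]
  push_cast
  ring

theorem InRegularClass.lapSeq_three {n : ℕ} {F : SimpleGraph V} (h : InRegularClass 4 n F) :
    lapSeq F 3 = 112 * n - adjSeq F 3 := by
  rw [h.lapSeq_eq]
  simp only [sum_range_succ, sum_range_zero, adjSeq_zero, adjSeq_one, h.adjSeq_two, h.1]
  norm_num [Nat.choose]
  ring

theorem InRegularClass.lapSeq_four {n : ℕ} {F : SimpleGraph V} (h : InRegularClass 4 n F) :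
    lapSeq F 4 = 640 * n - 16 * adjSeq F 3 + adjSeq F 4 := by
  rw [h.lapSeq_eq]
  simp only [sum_range_succ, sum_range_zero, adjSeq_zero, adjSeq_one, h.adjSeq_two, h.1]
  norm_num [Nat.choose]
  ring

/-- Write d² + d = (d-4)² + 9d - 16 and use that the average degree is 4, so that 9 · 4 - 16 = 20.
-/
theorem lapSeq_two_eq_of_sum_degree {F : SimpleGraph V}
    (h : lapSeq F 1 = 4 * Fintype.card V) :
    lapSeq F 2 = 20 * Fintype.card V + ∑ v, ((F.degree v : ℝ) - 4) ^ 2 := by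
  rw [lapSeq_one] at h
  have h1 : ∀ v, (F.degree v : ℝ) ^ 2 + F.degree v
      = ((F.degree v : ℝ) - 4) ^ 2 + (9 * (F.degree v : ℝ) - 16) := fun v => by ring
  rw [lapSeq_two, sum_congr rfl fun v _ => h1 v, sum_add_distrib, sum_sub_distrib, ← mul_sum, h,
    sum_const, card_univ, nsmul_eq_mul]
  ring

theorem exists_nat_eq_adjSeq_three (F : SimpleGraph V) : ∃ a : ℕ, adjSeq F 3 = a :=
  ⟨_, by rw [adjSeq_three]; exact (Nat.cast_sum _ _).symm⟩

theorem exists_nat_eq_adjSeq_four (F : SimpleGraph V) : ∃ a : ℕ, adjSeq F 4 = a :=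
  ⟨∑ v, ∑ w, (univ.filter fun u => F.Adj v u ∧ F.Adj w u).card ^ 2, by
    rw [adjSeq_four]; push_cast; rfl⟩

/-- A graph with four missing edges per vertex on average has, unless it is regular and its
complement is extremal, larger Laplacian moments of its complement. -/
theorem lapSeq_cases {n : ℕ} (hn : 5 ≤ n) {V : Type} [Fintype V] {F : SimpleGraph V}
    (hV : Fintype.card V = n) (h1 : lapSeq F 1 = 4 * n) {E : SimpleGraph _}
    (hE : E = extremalCompl (n % 5) (n / 5 - 1)) :
    Nonempty (F ≃g E) ∨ lapSeq E 2 + 1 ≤ lapSeq F 2 ∨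
      lapSeq E 2 = lapSeq F 2 ∧ lapSeq E 3 + 1 ≤ lapSeq F 3 ∨
      lapSeq E 2 = lapSeq F 2 ∧ lapSeq E 3 = lapSeq F 3 ∧ lapSeq E 4 + 1 ≤ lapSeq F 4 := by
  subst hE
  have hEr := inRegularClass_extremalCompl_mod hn
  by_cases hr : ∀ v, F.degree v = 4
  · have hF : InRegularClass 4 n F := ⟨hV, hr⟩
    rw [hF.lapSeq_two, hEr.lapSeq_two, hF.lapSeq_three, hEr.lapSeq_three, hF.lapSeq_four,
      hEr.lapSeq_four]
    -- Integrality of the traces turns the strict inequalities into gaps of at least 1.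
    obtain ⟨a, ha⟩ := exists_nat_eq_adjSeq_three F
    obtain ⟨b, hb⟩ := exists_nat_eq_adjSeq_three (extremalCompl (n % 5) (n / 5 - 1))
    obtain ⟨c, hc⟩ := exists_nat_eq_adjSeq_four F
    obtain ⟨d, hd⟩ := exists_nat_eq_adjSeq_four (extremalCompl (n % 5) (n / 5 - 1))
    rcases hF.extremal_cases_mod hn V with h | h | ⟨h, h'⟩
    · exact .inl h
    · refine .inr (.inr (.inl ⟨rfl, ?_⟩))
      rw [ha, hb] at h ⊢
      have : (a : ℝ) + 1 ≤ b := by exact_mod_cast h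
      linarith
    · refine .inr (.inr (.inr ⟨rfl, by rw [h], ?_⟩))
      rw [hc, hd] at h' ⊢
      have : (d : ℝ) + 1 ≤ c := by exact_mod_cast h'
      rw [h]
      linarith
  · push Not at hr
    obtain ⟨v, hv⟩ := hr
    refine .inr (.inl ?_)
    rw [← hV] at h1
    rw [hEr.lapSeq_two, lapSeq_two_eq_of_sum_degree h1, hV]
    have h2 : ((F.degree v : ℝ) - 4) ^ 2 ≤ ∑ v, ((F.degree v : ℝ) - 4) ^ 2 :=
      single_le_sum (f := fun v => ((F.degree v : ℝ) - 4) ^ 2) (fun _ _ => sq_nonneg _)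
        (mem_univ v)
    have h3 : (1 : ℝ) ≤ ((F.degree v : ℝ) - 4) ^ 2 := by
      have h4 : (1 : ℤ) ≤ ((F.degree v : ℤ) - 4) ^ 2 := by
        have : (F.degree v : ℤ) - 4 ≠ 0 := by
          intro h; apply hv; omega
        have := sq_pos_of_ne_zero this
        omega
      exact_mod_cast h4
    linarith

/-- Competitors need not be regular, as t-optimality ranges over all graphs with the same numbers of
vertices and edges. -/
theorem exists_forall_nonempty_iso_or_spanningTreeCount_lt : ∃ n₀ : ℕ, 5 ≤ n₀ ∧ ∀ n : ℕ, n₀ ≤ n →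
    ∀ (V : Type) [Fintype V] (G : SimpleGraph V), Fintype.card V = n →
      G.edgeSet.ncard = (graphH n).edgeSet.ncard →
        Nonempty (G ≃g graphH n) ∨ spanningTreeCount G < spanningTreeCount (graphH n) := by
  obtain ⟨C, hC, hCn⟩ := exists_lapSeq_extremalCompl_le
  obtain ⟨m, hm⟩ := exists_nat_ge (250000 + 10 * C)
  refine ⟨max 5 m, le_max_left _ _, fun n hn V _ G hV hG => ?_⟩
  have hn5 : 5 ≤ n := (le_max_left _ _).trans hn
  have hnC : 250000 + 10 * C ≤ n := hm.trans (by exact_mod_cast (le_max_right _ _).trans hn)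
  have hEr := inRegularClass_extremalCompl_mod hn5
  have hcard := (inRegularClass_graphH hn5).1
  have hpos : 0 < n := by omega
  have : Nonempty V := Fintype.card_pos_iff.1 (by omega)
  have : Nonempty (Fin (5 + n % 5) ⊕ (Fin (n / 5 - 1) × Fin 5)) :=
    Fintype.card_pos_iff.1 (by omega)
  have h1 : lapSeq Gᶜ 1 = 4 * n := by
    rw [lapSeq_compl_one, hV, hG, (inRegularClass_graphH hn5).two_mul_ncard_edgeSet, Nat.cast_mul,
      Nat.cast_sub hn5]
    push_cast
    ring
  rcases lapSeq_cases hn5 hV h1 rfl with h | h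
  · obtain ⟨e⟩ := h
    exact .inl ⟨isoOfCompl e⟩
  right
  obtain ⟨x, hx0, hxn, hxt, hxk⟩ := exists_eigenvalues_lapMatrix Gᶜ
  obtain ⟨y, hy0, -, hyt, hyk⟩ :=
    exists_eigenvalues_lapMatrix (extremalCompl (n % 5) (n / 5 - 1))
  rw [compl_compl, hV] at hxt
  rw [← graphH_eq_compl, hcard] at hyt
  rw [hV] at hxn
  have hx1 : ∑ i, x i = 4 * n := by simpa [h1] using (hxk 1).symm
  have hx2 : 20 * (n : ℝ) ≤ ∑ i, x i ^ 2 := by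
    rw [← hxk, lapSeq_two_eq_of_sum_degree (by rw [h1, hV]), hV]
    exact le_add_of_nonneg_right (sum_nonneg fun _ _ => sq_nonneg _)
  have hy1 : ∑ i, y i = 4 * n := by simpa [hEr.lapSeq_one] using (hyk 1).symm
  simp only [hxk, hyk] at h
  have hlt := prod_sub_lt_prod_sub hC hnC hV hcard hx0 hxn hy0 hx1 hx2 hy1
    (by rw [← hyk, hEr.lapSeq_two]) (fun k hk => by rw [← hyk]; exact hCn n hn5 k hk) h
  rw [← hxt, ← hyt] at hlt
  exact_mod_cast lt_of_mul_lt_mul_left hlt (by positivity)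

end Optimality

theorem corollary5p2 :
    (∀ n : ℕ, 5 ≤ n →
      IsTraceMinimal (n - 5) n (graphH n) ∧
        ∀ G : SimpleGraph (Fin n), IsTraceMinimal (n - 5) n G → Nonempty (G ≃g graphH n)) ∧
    ∃ n₀ : ℕ, 5 ≤ n₀ ∧ ∀ n : ℕ, n₀ ≤ n →
      InRegularClass (n - 5) n (graphH n) ∧ IsTOptimal (graphH n) ∧
        ∀ G : SimpleGraph (Fin n), InRegularClass (n - 5) n G → IsTOptimal G →
          Nonempty (G ≃g graphH n) := by
  refine ⟨fun n hn => ⟨isTraceMinimal_graphH hn, fun G hG => hG.nonempty_iso_graphH hn⟩, ?_⟩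
  obtain ⟨n₀, h5, h⟩ := exists_forall_nonempty_iso_or_spanningTreeCount_lt
  refine ⟨n₀, h5, fun n hn => ⟨inRegularClass_graphH (h5.trans hn), fun K hK => ?_,
    fun G hG hopt => ?_⟩⟩
  · rcases h n hn _ K (inRegularClass_graphH (h5.trans hn)).1 hK with ⟨⟨e⟩⟩ | hlt
    · exact spanningTreeCount_le_of_iso e
    · exact hlt.le
  -- Optimality of `G` only compares graphs on `Fin n`, so a copy of `graphH n` there serves as the
  -- competitor.
  · obtain ⟨H, ⟨e⟩⟩ := exists_iso_graphH (h5.trans hn)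
    have hedge : ∀ K : SimpleGraph (Fin n), InRegularClass (n - 5) n K →
        K.edgeSet.ncard = (graphH n).edgeSet.ncard := by
      intro K hK
      have h1 := hK.two_mul_ncard_edgeSet
      have h2 := (inRegularClass_graphH (h5.trans hn)).two_mul_ncard_edgeSet
      omega
    rcases h n hn _ G hG.1 (hedge G hG) with he | hlt
    · exact he
    · have hH := (inRegularClass_graphH (h5.trans hn)).of_iso e.symm
      have := hopt H ((hedge H hH).trans (hedge G hG).symm)
      have h2 := spanningTreeCount_le_of_iso e.symm
      omega
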